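/- Let $\Bbbk$ be a field and $n\ge 0$. Let $\mathbb{A}_n=\{a_1,\dots,a_n,\overline{a_1},\dots,\overline{a_n}\}$, with $\overline{\overline{x}}=x$, and $\overline{x_0x_1\cdots x_m}=\overline{x_m}\cdots\overline{x_1}\,\overline{x_0}$ for linear words. Write $c(W)$ for the cyclic word of a linear word $W$ (its class up to rotation). A linear word is freely reduced if no letter in it is followed by its inverse; a cyclic word is reduced if it is non-empty and all its linear representatives are freely reduced. Let $\mathbb{V}$ be the $\Bbbk$-vector space with basis the reduced cyclic words in $\mathbb{A}_n$. Fix a surface symbol $\mathcal{O}$, i.e. a cyclic word in which every letter of $\mathbb{A}_n$ appears exactly once. For three or four letters $x_1,\dots,x_k$ let $o(c(x_1\cdots x_k))=1$ (resp. $-1$) if they are pairwise distinct and occur in $\mathcal{O}$ in the cyclic order $x_1,\dots,x_k$ (resp. in the reverse cyclic order), and $o(c(x_1\cdots x_k))=0$ otherwise. A pair $(P,Q)$ of freely reduced linear words of length at least two is linked if one of the following holds; its sign is given in each case. In (2) and (3), $Y$ is a linear word of length at least one with first letter $x_1$ and last letter $x_2$ (the same occurrence if $Y$ has length one). (1) $P=p_1p_2$,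 $Q=q_1q_2$ and $o(c(\overline{p_1}\,\overline{q_1}p_2q_2))\ne 0$; $\mathrm{sign}(P,Q)=o(c(\overline{p_1}\,\overline{q_1}p_2q_2))$. (2) $P=p_1Yp_2$, $Q=q_1Yq_2$, $p_1\ne q_1$, $p_2\ne q_2$ and $o(c(\overline{p_1}\,\overline{q_1}x_1))=o(c(p_2q_2\overline{x_2}))$; $\mathrm{sign}(P,Q)=o(c(\overline{p_1}\,\overline{q_1}x_1))$. (3) $P=p_1Yp_2$, $Q=q_1\overline{Y}q_2$, $p_1\ne\overline{q_2}$, $p_2\ne\overline{q_1}$ and $o(c(q_2\overline{p_1}x_1))=o(c(\overline{q_1}p_2\overline{x_2}))$; $\mathrm{sign}(P,Q)=o(c(q_2\overline{p_1}x_1))$. For a reduced cyclic word $\mathcal{W}$ let $\mathbb{LP}_1(\mathcal{W})$ be the finite set of linked pairs $(P,Q)$ where $P$ and $Q$ are occurrences in $\mathcal{W}$ of linear subwords of linear representatives of $\mathcal{W}$ (so of length at most that of $\mathcal{W}$; different positions count as different occurrences). For $(P,Q)\in\mathbb{LP}_1(\mathcal{W})$ put $\delta_i(P,Q)=c(W_i)$,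 where in cases (1) and (2) $W_1$ and $W_2$ are obtained by cutting $\mathcal{W}$ immediately before $p_2$ and immediately before $q_2$, $W_1$ starting at $p_2$ and $W_2$ at $q_2$; and in case (3) $W_1$ is the subword of $\mathcal{W}$ from $p_2$ to $q_1$ and $W_2$ the one from $q_2$ to $p_1$. These are reduced cyclic words. Let $\delta:\mathbb{V}\to\mathbb{V}\otimes\mathbb{V}$ be the linear map with $$\delta(\mathcal{W})=\sum_{(P,Q)\in\mathbb{LP}_1(\mathcal{W})}\mathrm{sign}(P,Q)\,\delta_1(P,Q)\otimes\delta_2(P,Q)$$ for every reduced cyclic word $\mathcal{W}$. Theorem. $(\mathbb{V},\delta)$ is a Lie coalgebra: $s\circ\delta=-\delta$ and $(\mathrm{id}+\varepsilon+\varepsilon^2)\circ(\mathrm{id}\otimes\delta)\circ\delta=0$, where $s(x\otimes y)=y\otimes x$ and $\varepsilon(x\otimes y\otimes z)=z\otimes x\otimes y$. -/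

import Mathlib

open scoped TensorProduct

namespace CyclicWords

/-- The `2n` letters `a_1, …, a_n, ā_1, …, ā_n`. -/
abbrev Letter (n : ℕ) : Type := Fin n × Bool

/-- The involution `x ↦ x̄` on letters. -/
def Letter.bar {n : ℕ} (x : Letter n) : Letter n := (x.1, !x.2)

/-- Linear words. -/
abbrev Word (n : ℕ) : Type := List (Letter n)

/-- The inverse of a linear word: reverse it and bar every letter. -/
def Word.bar {n : ℕ} (L : Word n) : Word n := (L.map Letter.bar).reverse

/-- No letter of the word is followed by its inverse. -/
def FreelyReduced {n : ℕ} (L : Word n) : Prop := L.IsChain (fun x y => x ≠ y.bar)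

/-- A cyclic word is reduced if it is non-empty and all its linear representatives are
freely reduced. -/
def IsReducedCyclic {n : ℕ} (W : Cycle (Letter n)) : Prop :=
  W ≠ Cycle.nil ∧ ∀ L : Word n, (L : Cycle (Letter n)) = W → FreelyReduced L

/-- A surface symbol: a cyclic word in which every letter appears exactly once. -/
def IsSurfaceSymbol {n : ℕ} (O : Cycle (Letter n)) : Prop := O.Nodup ∧ ∀ x, x ∈ O

/-- There is an injective, orientation preserving, label preserving map from the letters of the
cyclic word `W` to the letters of the cyclic word `O`: after cutting both circles open, `W` is a
(not necessarily contiguous) sublist of `O`. -/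
def EmbedsIn {n : ℕ} (W O : Cycle (Letter n)) : Prop :=
  ∃ L R : Word n, (L : Cycle (Letter n)) = W ∧ (R : Cycle (Letter n)) = O ∧ L.Sublist R

open Classical in
/-- The orientation `o(c(L)) ∈ {-1, 0, 1}` of the cyclic word `c(L)` relative to `O`. -/
noncomputable def orient {n : ℕ} (O : Cycle (Letter n)) (L : Word n) : ℤ :=
  if EmbedsIn (L : Cycle (Letter n)) O then 1
  else if EmbedsIn (L : Cycle (Letter n)).reverse O then -1
  else 0

/-- Type (1): `P = p₁p₂`, `Q = q₁q₂`, and `p̄₁, q̄₁, p₂, q₂` are in positive or in negative cyclic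
order in `O`. -/
def LinkedOne {n : ℕ} (O : Cycle (Letter n)) (P Q : Word n) : Prop :=
  ∃ p₁ p₂ q₁ q₂ : Letter n, P = [p₁, p₂] ∧ Q = [q₁, q₂] ∧
    orient O [p₁.bar, q₁.bar, p₂, q₂] ≠ 0

/-- Type (2): `P = p₁Yp₂`, `Q = q₁Yq₂`. The first and the last letter of `Y` may be the same
occurrence, when `Y` has length one. -/
def LinkedTwo {n : ℕ} (O : Cycle (Letter n)) (P Q : Word n) : Prop :=
  ∃ (p₁ p₂ q₁ q₂ : Letter n) (Y : Word n) (hY : Y ≠ []),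
    P = p₁ :: (Y ++ [p₂]) ∧ Q = q₁ :: (Y ++ [q₂]) ∧ p₁ ≠ q₁ ∧ p₂ ≠ q₂ ∧
    orient O [p₁.bar, q₁.bar, Y.head hY] = orient O [p₂, q₂, (Y.getLast hY).bar]

/-- Type (3): `P = p₁Yp₂`, `Q = q₁Ȳq₂`. -/
def LinkedThree {n : ℕ} (O : Cycle (Letter n)) (P Q : Word n) : Prop :=
  ∃ (p₁ p₂ q₁ q₂ : Letter n) (Y : Word n) (hY : Y ≠ []),
    P = p₁ :: (Y ++ [p₂]) ∧ Q = q₁ :: (Y.bar ++ [q₂]) ∧ p₁ ≠ q₂.bar ∧ p₂ ≠ q₁.bar ∧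
    orient O [q₂, p₁.bar, Y.head hY] = orient O [q₁.bar, p₂, (Y.getLast hY).bar]

/-- `(P, Q)` is `O`-linked. -/
def Linked {n : ℕ} (O : Cycle (Letter n)) (P Q : Word n) : Prop :=
  FreelyReduced P ∧ FreelyReduced Q ∧ 2 ≤ P.length ∧ 2 ≤ Q.length ∧
    (LinkedOne O P Q ∨ LinkedTwo O P Q ∨ LinkedThree O P Q)

open Classical in
/-- The sign of a linked pair. For `P = p₁ x₁ ⋯ p₂` and `Q = q₁ ⋯ q₂`, it is `o(p̄₁ q̄₁ p₂ q₂)`,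
`o(p̄₁ q̄₁ x₁)`, `o(q₂ p̄₁ x₁)` for types (1), (2), (3) (for type (1), `p₂` is the letter `x₁`). -/
noncomputable def sign {n : ℕ} (O : Cycle (Letter n)) : Word n → Word n → ℤ
  | p₁ :: x₁ :: P', q₁ :: y₁ :: Q' =>
    let p₂ := (x₁ :: P').getLast (List.cons_ne_nil _ _)
    let q₂ := (y₁ :: Q').getLast (List.cons_ne_nil _ _)
    if LinkedOne O (p₁ :: x₁ :: P') (q₁ :: y₁ :: Q') then orient O [p₁.bar, q₁.bar, p₂, q₂]
    else if LinkedTwo O (p₁ :: x₁ :: P') (q₁ :: y₁ :: Q') then orient O [p₁.bar, q₁.bar, x₁]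
    else if LinkedThree O (p₁ :: x₁ :: P') (q₁ :: y₁ :: Q') then orient O [q₂, p₁.bar, x₁]
    else 0
  | _, _ => 0

/-- The linear subword of the cyclic word `c(L)` that starts at position `i` (positions are read
modulo the length of `L`) and has `k` letters. -/
def arc {n : ℕ} (L : Word n) (i k : ℕ) : Word n := (L.rotate i).take k

/-- The number of steps from position `i` forward to position `j` on the circle `c(L)`, in
`{0, …, L.length - 1}`. -/
def gap {n : ℕ} (L : Word n) (i j : ℕ) : ℕ := (((j : ℤ) - (i : ℤ)) % (L.length : ℤ)).toNat

/-- An occurrence of a linear word in a cyclic word: position of its first letter, and its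
length. -/
structure Occ where
  start : ℕ
  len : ℕ

/-- The linear word that occurs there. -/
def Occ.word {n : ℕ} (L : Word n) (A : Occ) : Word n := arc L A.start A.len

/-- The position of its last letter (an unreduced representative modulo the length of `L`). -/
def Occ.last (A : Occ) : ℕ := A.start + A.len - 1

open Classical in
/-- All occurrences of linear subwords in `c(L)`: subwords of linear representatives, hence of
length at most that of `L`. -/
noncomputable def occs {n : ℕ} (L : Word n) : Finset Occ :=
  (Finset.range L.length ×ˢ Finset.range (L.length + 1)).image (fun x => ⟨x.1, x.2⟩)

open Classical in
/-- The linked pairs of the cyclic word `c(L)`: pairs of occurrences of subwords which are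
`O`-linked. -/
noncomputable def LP₁ {n : ℕ} (O : Cycle (Letter n)) (L : Word n) : Finset (Occ × Occ) :=
  (occs L ×ˢ occs L).filter (fun x => Linked O (x.1.word L) (x.2.word L))

open Classical in
/-- `W₁`: for types (1) and (2) it starts at `p₂` and ends immediately before `q₂`; for type (3) it
starts at `p₂` and ends at `q₁`. -/
noncomputable def cut₁ {n : ℕ} (O : Cycle (Letter n)) (L : Word n) (P Q : Occ) : Word n :=
  if LinkedThree O (P.word L) (Q.word L) then arc L P.last (gap L P.last Q.start + 1)
  else arc L P.last (gap L P.last Q.last)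

open Classical in
/-- `W₂`: for types (1) and (2) it starts at `q₂` and ends immediately before `p₂`; for type (3) it
starts at `q₂` and ends at `p₁`. -/
noncomputable def cut₂ {n : ℕ} (O : Cycle (Letter n)) (L : Word n) (P Q : Occ) : Word n :=
  if LinkedThree O (P.word L) (Q.word L) then arc L Q.last (gap L Q.last P.start + 1)
  else arc L Q.last (gap L Q.last P.last)

/-- Reduced (in particular non-empty) cyclic words. -/
abbrev ReducedCyclicWord (n : ℕ) : Type := {W : Cycle (Letter n) // IsReducedCyclic W}

/-- The vector space `𝕍` with basis the reduced cyclic words. -/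
abbrev V (𝕜 : Type*) [Field 𝕜] (n : ℕ) : Type _ := ReducedCyclicWord n →₀ 𝕜

open Classical in
/-- The basis vector of a reduced cyclic word. The value `0` at cyclic words that are not reduced
is never used in the cobracket, by `isReducedCyclic_cut`. -/
noncomputable def vec (𝕜 : Type*) [Field 𝕜] {n : ℕ} (W : Cycle (Letter n)) : V 𝕜 n :=
  if h : IsReducedCyclic W then Finsupp.single ⟨W, h⟩ 1 else 0

/-- `sign(P,Q) δ₁(P,Q) ⊗ δ₂(P,Q)`. -/
noncomputable def cobracketTerm (𝕜 : Type*) [Field 𝕜] {n : ℕ} (O : Cycle (Letter n)) (L : Word n)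
    (P Q : Occ) : V 𝕜 n ⊗[𝕜] V 𝕜 n :=
  sign O (P.word L) (Q.word L) •
    (vec 𝕜 (cut₁ O L P Q : Cycle (Letter n)) ⊗ₜ[𝕜] vec 𝕜 (cut₂ O L P Q : Cycle (Letter n)))

/-- The sum defining `δ(c(L))`, computed on the linear representative `L`. -/
noncomputable def cobracketSum (𝕜 : Type*) [Field 𝕜] {n : ℕ} (O : Cycle (Letter n)) (L : Word n) :
    V 𝕜 n ⊗[𝕜] V 𝕜 n :=
  ∑ x ∈ LP₁ O L, cobracketTerm 𝕜 O L x.1 x.2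

/-! Independence of the linear representative. -/

theorem arc_mod {n : ℕ} (L : Word n) (i k : ℕ) : arc L (i % L.length) k = arc L i k := by
  simp [arc, List.rotate_mod]

theorem arc_rotate {n : ℕ} (L : Word n) (r i k : ℕ) :
    arc (L.rotate r) i k = arc L (i + r) k := by
  simp [arc, List.rotate_rotate, Nat.add_comm]

theorem arc_congr {n : ℕ} (L : Word n) {i j : ℕ} (h : i ≡ j [MOD L.length]) (k : ℕ) :
    arc L i k = arc L j k := by
  rw [← arc_mod L i, ← arc_mod L j, h]

theorem gap_congr {n : ℕ} (L : Word n) {i i' j j' : ℕ} (hi : i ≡ i' [MOD L.length])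
    (hj : j ≡ j' [MOD L.length]) : gap L i j = gap L i' j' := by
  have h : ((j : ℤ) - i) ≡ ((j' : ℤ) - i') [ZMOD L.length] :=
    Int.ModEq.sub (Int.natCast_modEq_iff.2 hj) (Int.natCast_modEq_iff.2 hi)
  unfold gap
  rw [h]

theorem gap_rotate {n : ℕ} (L : Word n) (r i j : ℕ) :
    gap (L.rotate r) i j = gap L (i + r) (j + r) := by
  unfold gap
  simp

/-- Rotating an occurrence. -/
def Occ.shift (m r : ℕ) (A : Occ) : Occ := ⟨(A.start + r) % m, A.len⟩

theorem Occ.word_rotate {n : ℕ} (L : Word n) (r : ℕ) (A : Occ) :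
    A.word (L.rotate r) = (A.shift L.length r).word L := by
  simp only [Occ.word, Occ.shift, arc_mod, arc_rotate]

theorem Occ.last_shift {n : ℕ} (L : Word n) (r : ℕ) (A : Occ) (hA : 1 ≤ A.len) :
    (A.shift L.length r).last ≡ A.last + r [MOD L.length] := by
  have h1 : (A.shift L.length r).last = (A.start + r) % L.length + (A.len - 1) := by
    simp only [Occ.last, Occ.shift]; omega
  have h2 : A.last + r = (A.start + r) + (A.len - 1) := by
    simp only [Occ.last]; omega
  rw [h1, h2]
  exact Nat.ModEq.add_right _ (Nat.mod_modEq _ _)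

theorem Occ.start_shift {n : ℕ} (L : Word n) (r : ℕ) (A : Occ) :
    (A.shift L.length r).start ≡ A.start + r [MOD L.length] := Nat.mod_modEq _ _

theorem cut₁_rotate {n : ℕ} (O : Cycle (Letter n)) (L : Word n) (r : ℕ) (P Q : Occ)
    (hP : 1 ≤ P.len) (hQ : 1 ≤ Q.len) :
    cut₁ O (L.rotate r) P Q = cut₁ O L (P.shift L.length r) (Q.shift L.length r) := by
  unfold cut₁
  simp only [arc_rotate, gap_rotate]
  rw [Occ.word_rotate L r P, Occ.word_rotate L r Q]
  rw [arc_congr L (Occ.last_shift L r P hP), arc_congr L (Occ.last_shift L r P hP),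
    gap_congr L (Occ.last_shift L r P hP) (Occ.start_shift L r Q),
    gap_congr L (Occ.last_shift L r P hP) (Occ.last_shift L r Q hQ)]

theorem cut₂_rotate {n : ℕ} (O : Cycle (Letter n)) (L : Word n) (r : ℕ) (P Q : Occ)
    (hP : 1 ≤ P.len) (hQ : 1 ≤ Q.len) :
    cut₂ O (L.rotate r) P Q = cut₂ O L (P.shift L.length r) (Q.shift L.length r) := by
  unfold cut₂
  simp only [arc_rotate, gap_rotate]
  rw [Occ.word_rotate L r P, Occ.word_rotate L r Q]
  rw [arc_congr L (Occ.last_shift L r Q hQ), arc_congr L (Occ.last_shift L r Q hQ),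
    gap_congr L (Occ.last_shift L r Q hQ) (Occ.start_shift L r P),
    gap_congr L (Occ.last_shift L r Q hQ) (Occ.last_shift L r P hP)]

theorem mem_occs {n : ℕ} (L : Word n) (A : Occ) :
    A ∈ occs L ↔ A.start < L.length ∧ A.len ≤ L.length := by
  obtain ⟨s, l⟩ := A
  simp [occs]

theorem mem_LP₁ {n : ℕ} (O : Cycle (Letter n)) (L : Word n) (x : Occ × Occ) :
    x ∈ LP₁ O L ↔ x.1 ∈ occs L ∧ x.2 ∈ occs L ∧ Linked O (x.1.word L) (x.2.word L) := by
  simp [LP₁, and_assoc]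

theorem Occ.two_le_len {n : ℕ} {L : Word n} {A : Occ} (h : 2 ≤ (A.word L).length) :
    2 ≤ A.len := by
  simp only [Occ.word, arc, List.length_take] at h
  omega

theorem Occ.shift_shift (m r r' : ℕ) (h : (r + r') % m = 0) (A : Occ) (hA : A.start < m) :
    (A.shift m r).shift m r' = A := by
  obtain ⟨s, l⟩ := A
  simp only [Occ.shift, Nat.mod_add_mod, Occ.mk.injEq, and_true]
  rw [Nat.add_assoc, Nat.add_mod, h, Nat.add_zero, Nat.mod_mod, Nat.mod_eq_of_lt hA]

theorem cobracketSum_rotate (𝕜 : Type*) [Field 𝕜] {n : ℕ} (O : Cycle (Letter n)) (L : Word n)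
    (r : ℕ) : cobracketSum 𝕜 O (L.rotate r) = cobracketSum 𝕜 O L := by
  rcases Nat.eq_zero_or_pos L.length with h0 | h0
  · rw [List.length_eq_zero_iff.1 h0]; simp
  set m := L.length with hm
  obtain ⟨r', hr'⟩ : ∃ r', (r + r') % m = 0 := by
    refine ⟨m - r % m, ?_⟩
    have := Nat.mod_lt r h0
    rw [Nat.add_mod, ← Nat.add_mod_mod, Nat.mod_add_mod]
    have : r % m + (m - r % m) = m := by omega
    rw [← Nat.mod_add_mod, Nat.mod_mod, Nat.add_mod_mod]
    rw [this]
    simp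
  have hr'' : (r' + r) % m = 0 := by rw [Nat.add_comm]; exact hr'
  unfold cobracketSum
  refine Finset.sum_nbij' (fun x => (x.1.shift m r, x.2.shift m r))
    (fun x => (x.1.shift m r', x.2.shift m r')) ?_ ?_ ?_ ?_ ?_
  · rintro ⟨P, Q⟩ hx
    simp only [mem_LP₁, mem_occs, Occ.word_rotate, List.length_rotate] at hx ⊢
    exact ⟨⟨Nat.mod_lt _ h0, hx.1.2⟩, ⟨Nat.mod_lt _ h0, hx.2.1.2⟩, hx.2.2⟩
  · rintro ⟨P, Q⟩ hx
    simp only [mem_LP₁, mem_occs, Occ.word_rotate, List.length_rotate] at hx ⊢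
    rw [← hm] at hx ⊢
    rw [Occ.shift_shift m r' r hr'' P hx.1.1, Occ.shift_shift m r' r hr'' Q hx.2.1.1]
    exact ⟨⟨Nat.mod_lt _ h0, hx.1.2⟩, ⟨Nat.mod_lt _ h0, hx.2.1.2⟩, hx.2.2⟩
  · rintro ⟨P, Q⟩ hx
    simp only [mem_LP₁, mem_occs, List.length_rotate] at hx
    simp only [Prod.mk.injEq]
    exact ⟨Occ.shift_shift m r r' hr' P hx.1.1, Occ.shift_shift m r r' hr' Q hx.2.1.1⟩
  · rintro ⟨P, Q⟩ hx
    simp only [mem_LP₁, mem_occs] at hx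
    simp only [Prod.mk.injEq]
    exact ⟨Occ.shift_shift m r' r hr'' P hx.1.1, Occ.shift_shift m r' r hr'' Q hx.2.1.1⟩
  · rintro ⟨P, Q⟩ hx
    simp only [mem_LP₁] at hx
    have h2 := hx.2.2
    have hP : 1 ≤ P.len := le_trans (by norm_num) (Occ.two_le_len h2.2.2.1)
    have hQ : 1 ≤ Q.len := le_trans (by norm_num) (Occ.two_le_len h2.2.2.2.1)
    simp only [cobracketTerm, Occ.word_rotate, cut₁_rotate O L r P Q hP hQ,
      cut₂_rotate O L r P Q hP hQ, ← hm]

/-- `δ` of a cyclic word. -/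
noncomputable def cobracketCyc (𝕜 : Type*) [Field 𝕜] {n : ℕ} (O : Cycle (Letter n))
    (W : Cycle (Letter n)) : V 𝕜 n ⊗[𝕜] V 𝕜 n :=
  Quotient.liftOn W (cobracketSum 𝕜 O) (by
    rintro L L' ⟨r, rfl⟩
    exact (cobracketSum_rotate 𝕜 O L r).symm)

/-- The cobracket `δ : 𝕍 → 𝕍 ⊗ 𝕍`, the linear map with
`δ(W) = ∑_{(P,Q) ∈ LP₁(W)} sign(P,Q) δ₁(P,Q) ⊗ δ₂(P,Q)` for every reduced cyclic word `W`. -/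
noncomputable def cobracket (𝕜 : Type*) [Field 𝕜] {n : ℕ} (O : Cycle (Letter n)) :
    V 𝕜 n →ₗ[𝕜] V 𝕜 n ⊗[𝕜] V 𝕜 n :=
  Finsupp.linearCombination 𝕜 (fun W : ReducedCyclicWord n => cobracketCyc 𝕜 O W.1)

theorem cobracket_single (𝕜 : Type*) [Field 𝕜] {n : ℕ} (O : Cycle (Letter n)) (L : Word n)
    (h : IsReducedCyclic (L : Cycle (Letter n))) :
    cobracket 𝕜 O (Finsupp.single ⟨(L : Cycle (Letter n)), h⟩ 1) =
      ∑ x ∈ LP₁ O L, cobracketTerm 𝕜 O L x.1 x.2 := by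
  simp only [cobracket, Finsupp.linearCombination_single, one_smul]
  rfl

/-! The cyclic words in the cobracket are reduced. -/

theorem isReducedCyclic_iff {n : ℕ} (L : Word n) :
    IsReducedCyclic (L : Cycle (Letter n)) ↔ L ≠ [] ∧ ∀ (i : ℕ) (x y : Letter n),
      L[i % L.length]? = some x → L[(i + 1) % L.length]? = some y → x ≠ y.bar := by
  have hnil : (L : Cycle (Letter n)) ≠ Cycle.nil ↔ L ≠ [] := by
    rw [Ne, Cycle.coe_eq_nil]
  unfold IsReducedCyclic
  rw [hnil]
  refine and_congr_right fun hL => ⟨fun h i x y hx hy => ?_, fun h L' hL' => ?_⟩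
  · have hpos : 0 < L.length := List.length_pos_iff.2 hL
    rcases Nat.lt_or_ge 1 L.length with h1 | h1
    · have hc := h (L.rotate i) (Cycle.coe_eq_coe.2 (List.IsRotated.symm ⟨i, rfl⟩))
      rw [FreelyReduced, List.isChain_iff_getElem] at hc
      have h0 := hc 0 (by simpa using h1)
      have e0 : (L.rotate i)[0]? = some x := by
        rw [List.getElem?_rotate hpos, Nat.zero_add]; exact hx
      have e1 : (L.rotate i)[0 + 1]? = some y := by
        rw [List.getElem?_rotate (by simpa using h1)]
        rw [show 0 + 1 + i = i + 1 by omega]; exact hy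
      rw [List.getElem?_eq_some_iff] at e0 e1
      obtain ⟨_, e0⟩ := e0
      obtain ⟨_, e1⟩ := e1
      rwa [e0, e1] at h0
    · have : L.length = 1 := by omega
      simp only [this, Nat.mod_one] at hx hy
      rw [hx] at hy
      obtain rfl := Option.some.inj hy
      intro hb
      have := congrArg Prod.snd hb
      simp [Letter.bar] at this
  · obtain ⟨r, rfl⟩ := (Cycle.coe_eq_coe.1 hL').symm
    rw [FreelyReduced, List.isChain_iff_getElem]
    intro i hi
    have hi' : i + 1 < L.length := by simpa using hi
    refine h (i + r) _ _ ?_ ?_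
    · rw [← List.getElem?_rotate (by omega)]
      exact List.getElem?_eq_getElem _
    · rw [show i + r + 1 = i + 1 + r by omega, ← List.getElem?_rotate (by omega)]
      exact List.getElem?_eq_getElem _

theorem arc_getElem? {n : ℕ} (L : Word n) (i k j : ℕ) (hj : j < k) (hk : k ≤ L.length) :
    (arc L i k)[j]? = L[(i + j) % L.length]? := by
  rw [arc, List.getElem?_take_of_lt hj, List.getElem?_rotate (by omega), Nat.add_comm]

theorem length_arc {n : ℕ} (L : Word n) (i k : ℕ) (hk : k ≤ L.length) :
    (arc L i k).length = k := by
  simp [arc, hk]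

/-- A non-empty arc of a reduced cyclic word closes up to a reduced cyclic word if its last letter
is not inverse to its first one. -/
theorem isReducedCyclic_arc {n : ℕ} (L : Word n) (hL : IsReducedCyclic (L : Cycle (Letter n)))
    (a k b : ℕ) (hk : 1 ≤ k) (hkL : k ≤ L.length) (hb : a + k ≡ b + 1 [MOD L.length])
    (hab : ∀ x y : Letter n, L[b % L.length]? = some x → L[a % L.length]? = some y → x ≠ y.bar) :
    IsReducedCyclic (arc L a k : Cycle (Letter n)) := by
  rw [isReducedCyclic_iff] at hL ⊢
  have hlen := length_arc L a k hkL
  refine ⟨fun h => ?_, fun i x y hx hy => ?_⟩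
  · rw [h] at hlen; simp at hlen; omega
  rw [hlen] at hx hy
  have hik : i % k < k := Nat.mod_lt _ hk
  rcases Nat.lt_or_ge (i % k + 1) k with h | h
  · have e : (i + 1) % k = i % k + 1 := by
      rw [← Nat.mod_add_mod]; exact Nat.mod_eq_of_lt h
    rw [e, arc_getElem? L a k _ h hkL] at hy
    rw [arc_getElem? L a k _ hik hkL] at hx
    exact hL.2 (a + i % k) x y hx (by rw [← hy, Nat.add_assoc])
  · have e : i % k = k - 1 := by omega
    have e' : (i + 1) % k = 0 := by
      rw [← Nat.mod_add_mod, e, Nat.sub_add_cancel hk, Nat.mod_self]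
    rw [e, arc_getElem? L a k _ (by omega) hkL] at hx
    rw [e', arc_getElem? L a k _ (by omega) hkL] at hy
    refine hab x y ?_ hy
    have : b ≡ a + (k - 1) [MOD L.length] := by
      apply Nat.ModEq.add_right_cancel' 1
      rw [show a + (k - 1) + 1 = a + k by omega]
      exact hb.symm
    rw [this]; exact hx

theorem gap_lt {n : ℕ} (L : Word n) (hL : 0 < L.length) (i j : ℕ) : gap L i j < L.length := by
  have := Int.emod_lt_of_pos ((j : ℤ) - i) (Int.natCast_pos.2 hL)
  have := Int.emod_nonneg ((j : ℤ) - i) (by omega : (L.length : ℤ) ≠ 0)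
  unfold gap; omega

theorem add_gap {n : ℕ} (L : Word n) (hL : 0 < L.length) (i j : ℕ) :
    i + gap L i j ≡ j [MOD L.length] := by
  have h := Int.emod_nonneg ((j : ℤ) - i) (by omega : (L.length : ℤ) ≠ 0)
  rw [← Int.natCast_modEq_iff]
  push_cast
  rw [gap, Int.toNat_of_nonneg h]
  calc (i : ℤ) + ((j : ℤ) - i) % L.length ≡ i + (j - i) [ZMOD L.length] :=
        Int.ModEq.add_left _ (Int.mod_modEq _ _)
    _ = j := by ring

theorem nodup_of_orient_ne_zero {n : ℕ} {O : Cycle (Letter n)} (hO : IsSurfaceSymbol O)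
    {L : Word n} (h : orient O L ≠ 0) : L.Nodup := by
  have key : ∀ W : Cycle (Letter n), EmbedsIn W O → W.Nodup := by
    rintro W ⟨A, B, rfl, rfl, hAB⟩
    exact List.Nodup.sublist hAB (Cycle.nodup_coe_iff.1 hO.1)
  unfold orient at h
  split_ifs at h with h1 h2
  · exact Cycle.nodup_coe_iff.1 (key _ h1)
  · exact Cycle.nodup_coe_iff.1 (Cycle.nodup_reverse_iff.1 (key _ h2))
  · exact absurd rfl h

theorem Letter.bar_bar {n : ℕ} (x : Letter n) : x.bar.bar = x := by
  simp [Letter.bar]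

theorem Occ.word_getElem? {n : ℕ} {L : Word n} {A : Occ} (hA : A ∈ occs L) {j : ℕ}
    (hj : j < A.len) : (A.word L)[j]? = L[(A.start + j) % L.length]? :=
  arc_getElem? L _ _ _ hj ((mem_occs L A).1 hA).2

theorem Occ.length_word {n : ℕ} {L : Word n} {A : Occ} (hA : A ∈ occs L) :
    (A.word L).length = A.len :=
  length_arc L _ _ ((mem_occs L A).1 hA).2

/-- In a linked pair not of type (3), the two subwords have the same length and different first
letters, and the letter before the last one of either word is not inverse to the last letter of the
other one. -/
theorem Linked.of_not_three {n : ℕ} {O : Cycle (Letter n)} (hO : IsSurfaceSymbol O)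
    {P Q : Word n} (h : Linked O P Q) (h3 : ¬ LinkedThree O P Q) :
    ∃ l : ℕ, P.length = l + 2 ∧ Q.length = l + 2 ∧ P[0]? ≠ Q[0]? ∧
      (∀ x y, Q[l]? = some x → P[l + 1]? = some y → x ≠ y.bar) ∧
      (∀ x y, P[l]? = some x → Q[l + 1]? = some y → x ≠ y.bar) := by
  obtain ⟨hP, hQ, -, -, h⟩ := h
  rcases h with h | h | h
  · obtain ⟨p₁, p₂, q₁, q₂, rfl, rfl, ho⟩ := h
    have hn := nodup_of_orient_ne_zero hO ho
    simp only [List.nodup_cons, List.mem_cons, List.not_mem_nil, or_false, not_or] at hn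
    refine ⟨0, rfl, rfl, ?_, ?_, ?_⟩
    · intro h
      simp only [List.getElem?_cons_zero, Option.some.injEq] at h
      exact hn.1.1 (by rw [h])
    · intro x y hx hy
      simp only [List.getElem?_cons_zero, List.getElem?_cons_succ, Option.some.injEq] at hx hy
      subst hx hy
      intro h
      exact hn.2.1.1 (by rw [h, Letter.bar_bar])
    · intro x y hx hy
      simp only [List.getElem?_cons_zero, List.getElem?_cons_succ, Option.some.injEq] at hx hy
      subst hx hy
      intro h
      exact hn.1.2.2 (by rw [h, Letter.bar_bar])
  · obtain ⟨p₁, p₂, q₁, q₂, Y, hY, rfl, rfl, hp, hq, -⟩ := h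
    have hYl : 0 < Y.length := List.length_pos_iff.2 hY
    rw [FreelyReduced, List.isChain_iff_getElem] at hP hQ
    have key : ∀ (p q : Letter n), (p :: (Y ++ [q]))[Y.length]? = Y[Y.length - 1]? := by
      intro p q
      rw [List.getElem?_cons, if_neg (by omega), List.getElem?_append_left (by omega)]
    have hP' := hP Y.length (by simp)
    have hQ' := hQ Y.length (by simp)
    refine ⟨Y.length, by simp, by simp, ?_, ?_, ?_⟩
    · simpa using hp
    · intro x y hx hy
      rw [key q₁ q₂, ← key p₁ p₂] at hx
      obtain ⟨_, hx⟩ := List.getElem?_eq_some_iff.1 hx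
      obtain ⟨_, hy⟩ := List.getElem?_eq_some_iff.1 hy
      rwa [hx, hy] at hP'
    · intro x y hx hy
      rw [key p₁ p₂, ← key q₁ q₂] at hx
      obtain ⟨_, hx⟩ := List.getElem?_eq_some_iff.1 hx
      obtain ⟨_, hy⟩ := List.getElem?_eq_some_iff.1 hy
      rwa [hx, hy] at hQ'
  · exact absurd h h3

/-- Both cyclic words `δ₁(P,Q)` and `δ₂(P,Q)` are reduced. -/
theorem isReducedCyclic_cut {n : ℕ} {O : Cycle (Letter n)} (hO : IsSurfaceSymbol O) (L : Word n)
    (hL : IsReducedCyclic (L : Cycle (Letter n))) (P Q : Occ) (h : (P, Q) ∈ LP₁ O L) :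
    IsReducedCyclic (cut₁ O L P Q : Cycle (Letter n)) ∧
      IsReducedCyclic (cut₂ O L P Q : Cycle (Letter n)) := by
  rw [mem_LP₁] at h
  obtain ⟨hP, hQ, hl⟩ := h
  simp only at hP hQ hl
  have hpos : 0 < L.length := lt_of_le_of_lt (Nat.zero_le _) ((mem_occs L P).1 hP).1
  have hPl : 2 ≤ P.len := Occ.two_le_len hl.2.2.1
  have hQl : 2 ≤ Q.len := Occ.two_le_len hl.2.2.2.1
  unfold cut₁ cut₂
  by_cases h3 : LinkedThree O (P.word L) (Q.word L)
  · rw [if_pos h3, if_pos h3]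
    obtain ⟨p₁, p₂, q₁, q₂, Y, hY, eP, eQ, hp, hq, -⟩ := h3
    have lP : P.len = Y.length + 2 := by rw [← Occ.length_word hP, eP]; simp
    have lQ : Q.len = Y.length + 2 := by rw [← Occ.length_word hQ, eQ]; simp [Word.bar]
    have fP : L[P.start % L.length]? = some p₁ := by
      have := Occ.word_getElem? hP (j := 0) (by omega)
      rw [eP] at this; simpa using this.symm
    have fQ : L[Q.start % L.length]? = some q₁ := by
      have := Occ.word_getElem? hQ (j := 0) (by omega)
      rw [eQ] at this; simpa using this.symm
    have gP : L[P.last % L.length]? = some p₂ := by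
      have := Occ.word_getElem? hP (j := Y.length + 1) (by omega)
      rw [eP] at this
      rw [show P.last = P.start + (Y.length + 1) by simp only [Occ.last]; omega, ← this]
      simp
    have gQ : L[Q.last % L.length]? = some q₂ := by
      have := Occ.word_getElem? hQ (j := Y.length + 1) (by omega)
      rw [eQ] at this
      rw [show Q.last = Q.start + (Y.length + 1) by simp only [Occ.last]; omega, ← this]
      simp [Word.bar]
    refine ⟨isReducedCyclic_arc L hL _ _ Q.start (by omega) (gap_lt L hpos _ _)
      ((add_gap L hpos _ _).add_right 1) ?_,
      isReducedCyclic_arc L hL _ _ P.start (by omega) (gap_lt L hpos _ _)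
      ((add_gap L hpos _ _).add_right 1) ?_⟩
    · intro x y hx hy
      rw [fQ] at hx; rw [gP] at hy
      obtain rfl := Option.some.inj hx
      obtain rfl := Option.some.inj hy
      intro hh; exact hq (by rw [hh, Letter.bar_bar])
    · intro x y hx hy
      rw [fP] at hx; rw [gQ] at hy
      obtain rfl := Option.some.inj hx
      obtain rfl := Option.some.inj hy
      exact hp
  · rw [if_neg h3, if_neg h3]
    obtain ⟨l, lP, lQ, h0, h1, h2⟩ := hl.of_not_three hO h3
    rw [Occ.length_word hP] at lP
    rw [Occ.length_word hQ] at lQ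
    rw [Occ.word_getElem? hP (by omega), Occ.word_getElem? hQ (by omega)] at h0
    rw [Occ.word_getElem? hP (by omega), Occ.word_getElem? hQ (by omega)] at h1 h2
    have eP : P.last = P.start + (l + 1) := by simp only [Occ.last]; omega
    have eQ : Q.last = Q.start + (l + 1) := by simp only [Occ.last]; omega
    have hne : ¬ P.last ≡ Q.last [MOD L.length] := by
      intro hh
      rw [eP, eQ] at hh
      have := Nat.ModEq.add_right_cancel' _ hh
      exact h0 (by rw [Nat.add_zero, Nat.add_zero, this])
    have g1 : 1 ≤ gap L P.last Q.last := by
      by_contra hc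
      have := add_gap L hpos P.last Q.last
      rw [show gap L P.last Q.last = 0 by omega] at this
      exact hne this
    have g2 : 1 ≤ gap L Q.last P.last := by
      by_contra hc
      have := add_gap L hpos Q.last P.last
      rw [show gap L Q.last P.last = 0 by omega] at this
      exact hne this.symm
    refine ⟨isReducedCyclic_arc L hL _ _ (Q.start + l) g1 (gap_lt L hpos _ _).le ?_ ?_,
      isReducedCyclic_arc L hL _ _ (P.start + l) g2 (gap_lt L hpos _ _).le ?_ ?_⟩
    · rw [Nat.add_assoc Q.start, ← eQ]; exact add_gap L hpos _ _
    · rw [eP]; exact h1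
    · rw [Nat.add_assoc P.start, ← eP]; exact add_gap L hpos _ _
    · rw [eQ]; exact h2

/-- `ε(x ⊗ y ⊗ z) = z ⊗ x ⊗ y`. -/
noncomputable def cyc (𝕜 A : Type*) [CommRing 𝕜] [AddCommGroup A] [Module 𝕜 A] :
    A ⊗[𝕜] (A ⊗[𝕜] A) →ₗ[𝕜] A ⊗[𝕜] (A ⊗[𝕜] A) :=
  (TensorProduct.comm 𝕜 (A ⊗[𝕜] A) A).toLinearMap ∘ₗ (TensorProduct.assoc 𝕜 A A A).symm.toLinearMap

theorem cyc_tmul (𝕜 A : Type*) [CommRing 𝕜] [AddCommGroup A] [Module 𝕜 A] (x y z : A) :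
    cyc 𝕜 A (x ⊗ₜ[𝕜] (y ⊗ₜ[𝕜] z)) = z ⊗ₜ[𝕜] (x ⊗ₜ[𝕜] y) := by
  simp [cyc]

/-- `(A, δ)` is a Lie coalgebra. -/
structure IsLieCoalgebra (𝕜 : Type*) {A : Type*} [CommRing 𝕜] [AddCommGroup A] [Module 𝕜 A]
    (δ : A →ₗ[𝕜] A ⊗[𝕜] A) : Prop where
  coskew : (TensorProduct.comm 𝕜 A A).toLinearMap ∘ₗ δ = -δ
  coJacobi : (LinearMap.id + cyc 𝕜 A + cyc 𝕜 A ∘ₗ cyc 𝕜 A) ∘ₗ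
    (TensorProduct.map LinearMap.id δ) ∘ₗ δ = 0

end CyclicWords

/-!
# The cobracket on reduced cyclic words

A cyclic word is read as a closed curve on the surface obtained by gluing the sides of a polygon
along the surface symbol. Between two consecutive letters `x`, `y` the curve runs through the
polygon along a chord from a point of the side `x̄` to a point of the side `y`. Once the ends of
the chords on each side are put in some order, two chords have an algebraic intersection number
(`crossing`), and every pair of cuts `i`, `j` of the cyclic word contributes this number times the
tensor of the two pieces into which the cuts divide the word. The sum of these contributions is
`Alphabet.cutSum`. Pieces need not be reduced; they are evaluated by `cls`, the basis vector of the
cyclic reduction, which is a function of conjugacy classes of the free group and is `0` on the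
trivial one. Two facts make `cutSum` flexible:

* If the letters after two cuts agree, or if the letter after one cut is inverse to the letter
  before the other one, then both cuts can be moved across these letters without changing the pieces
  (`pieces_add_one`, `pieces_strip`). Each coincidence of sides is thus seen from both of its ends
  with the same pair of pieces, and the sum does not depend on the order of the ends on one side
  (`sum_crossing_smul_congr`, `cutSum_labelled`).
* The sum is invariant under rotation and under free reduction (`cutSum_rotate`,
  `cutSum_concat_cancel`).

On reduced words `cutSum` is the combinatorial cobracket (`cobracketSum_eq_cutSum`). Pairs of cuts
whose four ends lie on different sides give the linked pairs of the first type. The others arrange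
themselves into maximal chains, obtained by moving both cuts along a common subword `Y` of the word
with itself, or with its inverse. For a suitable resolution of the ties only the two ends of a chain
contribute, with total `(o₁ + o₂) / 2`, where `o₁` and `o₂` are the two orientations in the
definition of a linked pair: the chain contributes if they are equal, and then with the sign of the
pair (`sum_cutCrossing_eq`).

By invariance, `cobracket (cls L) = cutSum L` holds for every word `L`, reduced or not
(`cobracket_cls`), so that the cobracket can be iterated on unreduced pieces of one fixed curve in
general position. Then coskew-symmetry is antisymmetry of the crossing number. In the co-Jacobi sum
the terms with two disjoint pairs of cuts cancel in pairs. In a term with three cuts, the second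
crossing is one of the third chord with the chord that results from smoothing the first crossing;
the three terms of this kind with the same cuts cancel by `crossing_identity`, a consequence of the
relation `σ(p,q)σ(q,r) + σ(q,r)σ(r,p) + σ(r,p)σ(p,q) = -1` between the signs of comparison of three
distinct points.
-/

open scoped TensorProduct

namespace CyclicWords

/-! ### Cyclic reduction of words -/

theorem Letter.bar_ne {n : ℕ} (x : Letter n) : x.bar ≠ x := fun h => by
  have := congrArg Prod.snd h
  simp [Letter.bar] at this

theorem Letter.bar_inj {n : ℕ} {x y : Letter n} : x.bar = y.bar ↔ x = y :=
  ⟨fun h => by rw [← Letter.bar_bar x, h, Letter.bar_bar], fun h => by rw [h]⟩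

theorem Letter.bar_eq_iff {n : ℕ} {x y : Letter n} : x.bar = y ↔ x = y.bar := by
  rw [← Letter.bar_inj, Letter.bar_bar]

theorem Letter.ne_bar_iff {n : ℕ} (x y : Letter n) : x ≠ y.bar ↔ (x.1 = y.1 → x.2 = y.2) := by
  obtain ⟨a, b⟩ := x
  obtain ⟨c, d⟩ := y
  simp only [Letter.bar, ne_eq, Prod.mk.injEq, not_and]
  cases b <;> cases d <;> simp

theorem freelyReduced_iff_isReduced {n : ℕ} (L : Word n) :
    FreelyReduced L ↔ FreeGroup.IsReduced L := by
  simp only [FreelyReduced, FreeGroup.IsReduced, Letter.ne_bar_iff]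

theorem reduceCyclically_eq_self {n : ℕ} {L : Word n} (h : FreeGroup.IsCyclicallyReduced L) :
    FreeGroup.reduceCyclically L = L := by
  induction L using List.bidirectionalRec with
  | nil => simp
  | singleton => simp
  | cons_append a l b _ =>
    rw [FreeGroup.reduceCyclically.cons_append, if_neg]
    · rfl
    · rintro ⟨h1, h2⟩
      have hb : b ∈ (a :: (l ++ [b])).getLast? := by
        rw [← List.cons_append, List.getLast?_concat]; rfl
      have := h.2 b hb a rfl h1
      rw [this] at h2
      simp at h2

/-- The cyclic reduction of a linear word, a representative of its conjugacy class in the free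
group. -/
def cycReduce {n : ℕ} (L : Word n) : Word n :=
  FreeGroup.reduceCyclically (FreeGroup.reduce L)

theorem isReduced_cons {n : ℕ} (a : Letter n) {w : Word n} (hw : FreeGroup.IsReduced w)
    (h : ∀ b ∈ w.head?, b ≠ a.bar) : FreeGroup.IsReduced (a :: w) := by
  rw [← freelyReduced_iff_isReduced] at *
  refine List.IsChain.cons hw fun b hb => ?_
  intro hh
  exact h b hb (by rw [hh, Letter.bar_bar])

theorem isReduced_concat {n : ℕ} (a : Letter n) {w : Word n}
    (hw : FreeGroup.IsReduced w) (h : ∀ b ∈ w.getLast?, b ≠ a.bar) :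
    FreeGroup.IsReduced (w ++ [a]) := by
  rw [← freelyReduced_iff_isReduced] at *
  refine List.IsChain.append hw (List.isChain_singleton a) fun x hx y hy => ?_
  simp only [List.head?_cons, Option.mem_def, Option.some.injEq] at hy
  subst hy
  exact h x hx

theorem isCyclicallyReduced_iff_bar {n : ℕ} (L : Word n) : FreeGroup.IsCyclicallyReduced L ↔
    FreeGroup.IsReduced L ∧ ∀ a ∈ L.getLast?, ∀ b ∈ L.head?, a ≠ b.bar := by
  simp only [FreeGroup.isCyclicallyReduced_iff, Letter.ne_bar_iff]

theorem reduce_cancel {n : ℕ} (u v : Word n) (x : Letter n) :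
    FreeGroup.reduce (u ++ x :: x.bar :: v) = FreeGroup.reduce (u ++ v) :=
  FreeGroup.reduce.Step.eq FreeGroup.Red.Step.not

theorem cycReduce_cancel {n : ℕ} (u v : Word n) (x : Letter n) :
    cycReduce (u ++ x :: x.bar :: v) = cycReduce (u ++ v) := by
  rw [cycReduce, reduce_cancel, cycReduce]

theorem cycReduce_of_isCyclicallyReduced {n : ℕ} {L : Word n}
    (h : FreeGroup.IsCyclicallyReduced L) : cycReduce L = L := by
  rw [cycReduce, h.1.reduce_eq, reduceCyclically_eq_self h]

/-- Cyclic reduction is a function of the cyclic word. With `w` the reduction of `L`, the cases are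
whether the first and the last letter of `w` cancel with `a`. -/
theorem coe_cycReduce_cons {n : ℕ} (a : Letter n) (L : Word n) :
    (cycReduce (a :: L) : Cycle (Letter n)) = cycReduce (L ++ [a]) := by
  have hr : FreeGroup.reduce (FreeGroup.reduce L) = FreeGroup.reduce L := FreeGroup.reduce.idem
  have h1 : cycReduce (a :: L) = cycReduce (a :: FreeGroup.reduce L) := by
    rw [cycReduce, cycReduce, FreeGroup.reduce_cons_reduce]
  have h2 : cycReduce (L ++ [a]) = cycReduce (FreeGroup.reduce L ++ [a]) := by
    rw [cycReduce, cycReduce, ← FreeGroup.reduce_append_reduce_reduce (L₁ := L),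
      ← FreeGroup.reduce_append_reduce_reduce (L₁ := FreeGroup.reduce L) (L₂ := [a]), hr]
  rw [h1, h2]
  have hw := FreeGroup.isReduced_iff_reduce_eq.2 hr
  generalize FreeGroup.reduce L = w at hw
  by_cases hs : ∃ u, w = a.bar :: u
  · obtain ⟨u, rfl⟩ := hs
    have e1 : cycReduce (a :: a.bar :: u) = cycReduce u := cycReduce_cancel [] u a
    rw [e1]
    have hu : FreeGroup.IsReduced u := hw.infix ⟨[a.bar], [], by simp⟩
    rcases List.eq_nil_or_concat' u with rfl | ⟨v, b, rfl⟩
    · have := cycReduce_cancel [] [] a.bar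
      rw [Letter.bar_bar] at this
      exact congrArg _ this.symm
    by_cases hb : b = a.bar
    · subst hb
      have e2 := cycReduce_cancel (a.bar :: v) [] a.bar
      rw [Letter.bar_bar, List.append_nil] at e2
      have e3 : a.bar :: (v ++ [a.bar]) ++ [a] = a.bar :: v ++ [a.bar, a] := by simp
      rw [e3, e2]
      have hv : FreelyReduced (a.bar :: (v ++ [a.bar])) := (freelyReduced_iff_isReduced _).2 hw
      have key : FreeGroup.IsCyclicallyReduced (v ++ [a.bar]) := by
        rw [isCyclicallyReduced_iff_bar]
        refine ⟨hu, fun x hx y hy => ?_⟩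
        simp only [List.getLast?_append, List.getLast?_singleton, Option.some_or, Option.mem_def,
          Option.some.injEq] at hx
        subst hx
        exact List.isChain_cons.1 hv |>.1 y hy
      have key2 : FreeGroup.IsCyclicallyReduced (a.bar :: v) := by
        rw [isCyclicallyReduced_iff_bar]
        have hv' : FreelyReduced ((a.bar :: v) ++ [a.bar]) := hv
        refine ⟨hw.infix ⟨[], [a.bar], by simp⟩, fun x hx y hy => ?_⟩
        simp only [List.head?_cons, Option.mem_def, Option.some.injEq] at hy
        subst hy
        exact (List.isChain_append.1 hv').2.2 x hx a.bar (by simp)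
      rw [cycReduce_of_isCyclicallyReduced key, cycReduce_of_isCyclicallyReduced key2]
      exact Cycle.coe_eq_coe.2 (List.isRotated_append (l := v) (l' := [a.bar]))
    · have : FreeGroup.IsReduced (a.bar :: (v ++ [b]) ++ [a]) := by
        refine isReduced_concat a hw fun c hc => ?_
        have : c = b := by
          rw [← List.cons_append, List.getLast?_append] at hc
          simpa using hc.symm
        rwa [this]
      rw [cycReduce, cycReduce, this.reduce_eq, hu.reduce_eq, List.cons_append,
        FreeGroup.reduceCyclically.cons_append, if_pos]
      simp [Letter.bar]
  · by_cases he : ∃ u, w = u ++ [a.bar]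
    · obtain ⟨u, rfl⟩ := he
      have hu : FreeGroup.IsReduced u := hw.infix ⟨[], [a.bar], by simp⟩
      have e2 := cycReduce_cancel u [] a.bar
      rw [Letter.bar_bar, List.append_nil] at e2
      rw [List.append_assoc]
      change _ = ((cycReduce (u ++ [a.bar, a]) : Word n) : Cycle (Letter n))
      rw [e2]
      have : FreeGroup.IsReduced (a :: (u ++ [a.bar])) := by
        refine isReduced_cons a hw fun c hc hca => hs ?_
        rw [hca] at hc
        exact ⟨_, (List.cons_head?_tail hc).symm⟩
      rw [cycReduce, cycReduce, this.reduce_eq, hu.reduce_eq,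
        FreeGroup.reduceCyclically.cons_append, if_pos]
      simp [Letter.bar]
    · have k1 : ∀ c ∈ w.head?, c ≠ a.bar := fun c hc hca => hs (by
        rw [hca] at hc
        exact ⟨_, (List.cons_head?_tail hc).symm⟩)
      have k2 : ∀ c ∈ w.getLast?, c ≠ a.bar := fun c hc hca => he (by
        rw [hca] at hc
        exact ⟨_, (List.dropLast_append_getLast? _ hc).symm⟩)
      have c1 : FreeGroup.IsCyclicallyReduced (a :: w) := by
        rw [isCyclicallyReduced_iff_bar]
        refine ⟨isReduced_cons a hw k1, fun x hx y hy => ?_⟩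
        simp only [List.head?_cons, Option.mem_def, Option.some.injEq] at hy
        subst hy
        rw [List.getLast?_cons] at hx
        cases hwl : w.getLast? with
        | none =>
          rw [hwl] at hx
          simp only [Option.getD_none, Option.mem_def, Option.some.injEq] at hx
          rw [← hx]
          exact (Letter.bar_ne _).symm
        | some c =>
          rw [hwl] at hx
          simp only [Option.getD_some, Option.mem_def, Option.some.injEq] at hx
          rw [← hx]
          exact k2 c hwl
      have c2 : FreeGroup.IsCyclicallyReduced (w ++ [a]) := by
        rw [isCyclicallyReduced_iff_bar]
        refine ⟨isReduced_concat a hw k2, fun x hx y hy => ?_⟩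
        simp only [List.getLast?_append, List.getLast?_singleton, Option.some_or, Option.mem_def,
          Option.some.injEq] at hx
        subst hx
        rw [List.head?_append] at hy
        cases hwl : w.head? with
        | none =>
          rw [hwl] at hy
          simp only [List.head?_cons, Option.none_or, Option.mem_def, Option.some.injEq] at hy
          rw [← hy]
          exact (Letter.bar_ne _).symm
        | some c =>
          rw [hwl] at hy
          simp only [Option.some_or, Option.mem_def, Option.some.injEq] at hy
          rw [← hy]
          intro hh
          exact k1 c hwl (by rw [hh, Letter.bar_bar])
      rw [cycReduce_of_isCyclicallyReduced c1, cycReduce_of_isCyclicallyReduced c2]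
      exact Cycle.coe_eq_coe.2 (List.isRotated_append (l := [a]) (l' := w))

/-- The class of a linear word in `𝕍`: the basis vector of its cyclic reduction, and `0` if the word
is trivial in the free group. -/
noncomputable def cls (𝕜 : Type*) [Field 𝕜] {n : ℕ} (L : Word n) : V 𝕜 n :=
  vec 𝕜 (cycReduce L : Cycle (Letter n))

variable {𝕜 : Type*} [Field 𝕜] {n : ℕ}

@[simp]
theorem cls_nil : cls 𝕜 ([] : Word n) = 0 := by
  have : cycReduce ([] : Word n) = [] := by simp [cycReduce]
  rw [cls, this, vec, dif_neg]
  exact fun h => h.1 rfl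

/-- The class depends only on the element of the free group. -/
theorem cls_cancel (u v : Word n) (x : Letter n) :
    cls 𝕜 (u ++ x :: x.bar :: v) = cls 𝕜 (u ++ v) := by
  rw [cls, cycReduce_cancel, cls]

theorem cls_cons (a : Letter n) (L : Word n) : cls 𝕜 (a :: L) = cls 𝕜 (L ++ [a]) := by
  rw [cls, coe_cycReduce_cons, cls]

/-- The class depends only on the cyclic word. -/
theorem cls_append_comm (u v : Word n) : cls 𝕜 (u ++ v) = cls 𝕜 (v ++ u) := by
  induction u generalizing v with
  | nil => simp
  | cons a u ih =>
    rw [List.cons_append, cls_cons, List.append_assoc, ih]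
    simp

theorem cls_conj (u : Word n) (x : Letter n) : cls 𝕜 (x :: (u ++ [x.bar])) = cls 𝕜 u := by
  rw [← List.cons_append, cls_append_comm]
  have := cls_cancel (𝕜 := 𝕜) [] u x.bar
  rwa [Letter.bar_bar] at this

theorem cls_of_isReducedCyclic {L : Word n} (h : IsReducedCyclic (L : Cycle (Letter n))) :
    cls 𝕜 L = vec 𝕜 (L : Cycle (Letter n)) := by
  rw [cls, cycReduce_of_isCyclicallyReduced]
  rw [isCyclicallyReduced_iff_bar, ← freelyReduced_iff_isReduced]
  refine ⟨h.2 L rfl, fun a ha b hb => ?_⟩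
  rcases L with _ | ⟨c, u⟩
  · simp at hb
  simp only [List.head?_cons, Option.mem_def, Option.some.injEq] at hb
  subst hb
  rcases List.eq_nil_or_concat' u with rfl | ⟨v, d, rfl⟩
  · simp only [List.getLast?_singleton, Option.mem_def, Option.some.injEq] at ha
    rw [ha]
    exact (Letter.bar_ne _).symm
  · have hda : d = a := by
      rw [← List.cons_append, List.getLast?_append] at ha
      simpa using ha
    subst hda
    have h2 := h.2 (d :: c :: v) (Cycle.coe_eq_coe.2
      (List.isRotated_append (l := [d]) (l' := c :: v)))
    exact (List.isChain_cons_cons.1 h2).1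

/-- A non-empty cyclic word that is not reduced contains a letter followed by its inverse. -/
theorem exists_rotation_cancel {L : Word n} (h0 : L ≠ [])
    (h : ¬ IsReducedCyclic (L : Cycle (Letter n))) :
    ∃ (u : Word n) (x : Letter n), L ~r u ++ [x, x.bar] := by
  have h' : ∃ L' : Word n, (L' : Cycle (Letter n)) = L ∧ ¬ FreelyReduced L' := by
    by_contra hc
    push Not at hc
    exact h ⟨fun hn => h0 ((Cycle.coe_eq_nil L).1 hn), hc⟩
  obtain ⟨L', hL', hr⟩ := h'
  rw [FreelyReduced, List.isChain_iff_forall_rel_of_append_cons_cons] at hr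
  push Not at hr
  obtain ⟨a, b, l₁, l₂, rfl, hab⟩ := hr
  rw [← Letter.bar_eq_iff] at hab
  subst hab
  refine ⟨l₂ ++ l₁, a, (Cycle.coe_eq_coe.1 hL').symm.trans ?_⟩
  have := List.isRotated_append (l := l₁ ++ [a, a.bar]) (l' := l₂)
  refine List.IsRotated.trans (by simpa using this) ?_
  rw [List.append_assoc]

/-! ### Chord diagrams and the sum over all pairs of cuts -/

/-- The algebraic intersection number of the chords `s → t` and `s' → t'`, for endpoints on a
line whose order has the (integer-valued) indicator function `lt`. -/
def crossing {E : Type*} (lt : E → E → ℤ) (s t s' t' : E) : ℤ :=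
  lt t t' - lt s t' - lt t s' + lt s s'

/-- An alphabet `E` over the letters: its elements stand for the ends, on the sides of the polygon,
of the chords of a curve. It carries the involution that passes to the other copy of a side, and an
indicator function of an order of the ends along the boundary of the polygon. The values on ties
are part of the data. -/
structure Alphabet (n : ℕ) (E : Type*) where
  bar : E → E
  lt : E → E → ℤ
  letter : E → Letter n
  letter_bar : ∀ e, letter (bar e) = (letter e).bar

/-- The list `[x a, x (a + 1), …, x (b - 1)]`. -/
def seg {E : Type*} (x : ℕ → E) (a b : ℕ) : List E := (List.range (b - a)).map fun t => x (a + t)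

section seg
variable {E : Type*} (x : ℕ → E)

@[simp] theorem length_seg (a b : ℕ) : (seg x a b).length = b - a := by simp [seg]

theorem getElem?_seg (a b i : ℕ) :
    (seg x a b)[i]? = if i < b - a then some (x (a + i)) else none := by
  rw [seg, List.getElem?_map]
  split_ifs with h
  · rw [List.getElem?_range h]; rfl
  · rw [List.getElem?_eq_none (by simpa using h)]; rfl

theorem seg_self (a : ℕ) : seg x a a = [] := by simp [seg]

theorem seg_append {a b c : ℕ} (h : a ≤ b) (h' : b ≤ c) : seg x a b ++ seg x b c = seg x a c := by
  apply List.ext_getElem?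
  intro i
  simp only [List.getElem?_append, getElem?_seg, length_seg]
  split_ifs <;> first | rfl | omega | (congr 2; omega)

theorem drop_seg (a b k : ℕ) : (seg x a b).drop k = seg x (a + k) b := by
  apply List.ext_getElem?
  intro i
  simp only [List.getElem?_drop, getElem?_seg, Nat.add_assoc]
  split_ifs <;> first | rfl | omega

theorem take_seg {a b k : ℕ} (h : a + k ≤ b) : (seg x a b).take k = seg x a (a + k) := by
  apply List.ext_getElem?
  intro i
  simp only [List.getElem?_take, getElem?_seg]
  split_ifs <;> first | rfl | omega

theorem seg_eq_cons {a b : ℕ} (h : a < b) : seg x a b = x a :: seg x (a + 1) b := by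
  rw [← seg_append x (Nat.le_succ a) h]
  simp [seg]

theorem seg_succ {a b : ℕ} (h : a ≤ b) : seg x a (b + 1) = seg x a b ++ [x b] := by
  rw [← seg_append x h (Nat.le_succ b)]
  simp [seg]

theorem seg_add_left {m : ℕ} (hx : ∀ t, x (m + t) = x t) (a b : ℕ) :
    seg x (m + a) (m + b) = seg x a b := by
  simp [seg, Nat.add_sub_add_left, Nat.add_assoc, hx]

theorem exists_eq_seg [Nonempty E] (L : List E) : ∃ x : ℕ → E, L = seg x 0 L.length := by
  refine ⟨fun i => L.getD i (Classical.arbitrary E), ?_⟩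
  apply List.ext_getElem?
  intro i
  rw [getElem?_seg]
  split_ifs with h
  · have : i < L.length := by omega
    simp [this]
  · have : L.length ≤ i := by omega
    simp [this]

theorem head?_seg {a b : ℕ} (h : a < b) : (seg x a b).head? = some (x a) := by
  rw [seg_eq_cons x h]; rfl

theorem getLast?_seg {a b : ℕ} (h : a ≤ b) : (seg x a (b + 1)).getLast? = some (x b) := by
  rw [seg_succ x h, List.getLast?_concat]

end seg

namespace Alphabet

variable {n : ℕ} {E : Type*} (A : Alphabet n E) (𝕜 : Type*) [Field 𝕜]

/-- The class of a word in the alphabet `E`. -/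
noncomputable def cl (u : List E) : V 𝕜 n := cls 𝕜 (u.map A.letter)

/-- The contribution to the cobracket of the pair of cuts that divides a cyclic word into the
pieces `u` and `v`, in this order. The chord at the cut before `u` joins the end of `v` to the
beginning of `u`. -/
noncomputable def cutTerm : List E → List E → V 𝕜 n ⊗[𝕜] V 𝕜 n
  | a :: u, b :: v =>
    crossing A.lt (A.bar ((b :: v).getLast (List.cons_ne_nil _ _))) a
      (A.bar ((a :: u).getLast (List.cons_ne_nil _ _))) b •
      (A.cl 𝕜 (a :: u) ⊗ₜ[𝕜] A.cl 𝕜 (b :: v))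
  | _, _ => 0

/-- The sum over all pairs of distinct cuts of a cyclic word, that is of all chord crossings counted
algebraically. The cuts are those after the letters with index `i < j`. -/
noncomputable def cutSum (L : List E) : V 𝕜 n ⊗[𝕜] V 𝕜 n :=
  ∑ j ∈ Finset.range L.length, ∑ i ∈ Finset.range j,
    (A.cutTerm 𝕜 ((L.drop (i + 1)).take (j - i)) (L.drop (j + 1) ++ L.take (i + 1)) +
      A.cutTerm 𝕜 (L.drop (j + 1) ++ L.take (i + 1)) ((L.drop (i + 1)).take (j - i)))

/-- Both contributions of a pair of cuts, in terms of the letters `p, t` around the first cut and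
`p', t'` around the second one. -/
noncomputable def pairTerm (p t p' t' : E) (u v : List E) : V 𝕜 n ⊗[𝕜] V 𝕜 n :=
  crossing A.lt (A.bar p) t (A.bar p') t' • (A.cl 𝕜 u ⊗ₜ[𝕜] A.cl 𝕜 v) +
    crossing A.lt (A.bar p') t' (A.bar p) t • (A.cl 𝕜 v ⊗ₜ[𝕜] A.cl 𝕜 u)

variable {𝕜}

theorem cl_append_comm (u v : List E) : A.cl 𝕜 (u ++ v) = A.cl 𝕜 (v ++ u) := by
  simp only [cl, List.map_append]
  exact cls_append_comm _ _

@[simp] theorem cl_nil : A.cl 𝕜 [] = 0 := by simp [cl]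

theorem cutTerm_eq {u v : List E} {a b p q : E} (ha : u.head? = some a)
    (hp : u.getLast? = some p) (hb : v.head? = some b) (hq : v.getLast? = some q) :
    A.cutTerm 𝕜 u v = crossing A.lt (A.bar q) a (A.bar p) b • (A.cl 𝕜 u ⊗ₜ[𝕜] A.cl 𝕜 v) := by
  rcases u with _ | ⟨a', u⟩
  · simp at ha
  rcases v with _ | ⟨b', v⟩
  · simp at hb
  rw [List.getLast?_eq_some_getLast (List.cons_ne_nil _ _), Option.some.injEq] at hp hq
  simp only [List.head?_cons, Option.some.injEq] at ha hb
  subst ha hb hp hq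
  rfl

theorem cutTerm_add_cutTerm {u v : List E} {t t' p p' : E} (ha : u.head? = some t)
    (hp : u.getLast? = some p') (hb : v.head? = some t') (hq : v.getLast? = some p) :
    A.cutTerm 𝕜 u v + A.cutTerm 𝕜 v u = A.pairTerm 𝕜 p t p' t' u v := by
  rw [A.cutTerm_eq ha hp hb hq, A.cutTerm_eq hb hq ha hp, pairTerm]

/-- The sum over pairs of cuts of the word `x a ⋯ x (b - 1)`; the letter after the last cut is
`x a`. -/
theorem cutSum_seg (x : ℕ → E) (a b : ℕ) :
    A.cutSum 𝕜 (seg x a b) = ∑ l ∈ Finset.Ico a b, ∑ k ∈ Finset.Ico a l,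
      A.pairTerm 𝕜 (x k) (x (k + 1)) (x l) (if l + 1 < b then x (l + 1) else x a)
        (seg x (k + 1) (l + 1)) (seg x (l + 1) b ++ seg x a (k + 1)) := by
  rw [cutSum, length_seg, Finset.sum_Ico_eq_sum_range]
  refine Finset.sum_congr rfl fun j hj => ?_
  rw [Finset.sum_Ico_eq_sum_range, Nat.add_sub_cancel_left]
  refine Finset.sum_congr rfl fun i hi => ?_
  rw [Finset.mem_range] at hi hj
  have e1 : (List.drop (i + 1) (seg x a b)).take (j - i) = seg x (a + i + 1) (a + j + 1) := by
    rw [drop_seg, take_seg _ (by omega)]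
    congr 1
    omega
  have e2 : List.drop (j + 1) (seg x a b) ++ List.take (i + 1) (seg x a b) =
      seg x (a + j + 1) b ++ seg x a (a + i + 1) := by
    rw [drop_seg, take_seg _ (by omega)]
    rfl
  rw [e1, e2]
  apply cutTerm_add_cutTerm
  · exact head?_seg _ (by omega)
  · exact getLast?_seg _ (by omega)
  · split_ifs with h
    · rw [List.head?_append, head?_seg _ h]; rfl
    · rw [show b = a + j + 1 by omega, seg_self, List.nil_append, head?_seg _ (by omega)]
  · rw [List.getLast?_append, getLast?_seg _ (by omega)]; rfl

end Alphabet

theorem sum_zmod {M : Type*} [AddCommMonoid M] (m : ℕ) [NeZero m] (F : ZMod m → M) :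
    ∑ i, F i = ∑ i ∈ Finset.range m, F i := by
  obtain ⟨k, rfl⟩ := Nat.exists_eq_succ_of_ne_zero (NeZero.ne m)
  rw [← Fin.sum_univ_eq_sum_range (fun i => F (i : ZMod (k + 1))) (k + 1)]
  refine Fintype.sum_congr _ _ fun i => ?_
  congr 1
  exact (Fin.cast_val_eq_self i).symm

theorem sum_range_product_eq {M : Type*} [AddCommMonoid M] (m : ℕ) (F : ℕ → ℕ → M)
    (h : ∀ i, F i i = 0) : ∑ i ∈ Finset.range m, ∑ j ∈ Finset.range m, F i j =
      ∑ j ∈ Finset.range m, ∑ i ∈ Finset.range j, (F i j + F j i) := by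
  induction m with
  | zero => simp
  | succ m ih =>
    rw [Finset.sum_range_succ,
      Finset.sum_range_succ (n := m) (f := fun j => ∑ i ∈ Finset.range j, _), ← ih]
    simp only [Finset.sum_range_succ, Finset.sum_add_distrib, h, add_zero]
    rw [add_assoc]

/-! ### Positions on the circle -/

section Circle
variable {E : Type*} {m : ℕ} (x : ZMod m → E)

/-- The word of the `k` letters after the position `i`. -/
def run (i : ZMod m) (k : ℕ) : List E := (List.range k).map fun t : ℕ => x (i + 1 + t)

@[simp] theorem length_run (i : ZMod m) (k : ℕ) : (run x i k).length = k := by simp [run]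

@[simp] theorem run_zero (i : ZMod m) : run x i 0 = [] := rfl

theorem run_succ (i : ZMod m) (k : ℕ) : run x i (k + 1) = run x i k ++ [x (i + 1 + k)] := by
  simp [run, List.range_succ]

theorem run_succ' (i : ZMod m) (k : ℕ) : run x i (k + 1) = x (i + 1) :: run x (i + 1) k := by
  simp only [run, List.range_succ_eq_map, List.map_cons, List.map_map, Nat.cast_zero, add_zero]
  congr 1
  refine List.map_congr_left fun t _ => ?_
  simp only [Function.comp_apply, Nat.cast_succ]
  congr 1
  ring

/-- The word from the cut after position `i` to the cut after position `j`; empty for `i = j`. -/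
def piece (i j : ZMod m) : List E := run x i (j - i).val

theorem run_natCast (a k : ℕ) :
    run x (a : ZMod m) k = seg (fun t : ℕ => x t) (a + 1) (a + 1 + k) := by
  simp [run, seg]

@[simp] theorem piece_self (i : ZMod m) : piece x i i = [] := by simp [piece]

theorem piece_natCast_of_lt [NeZero m] {i j : ℕ} (h : i < j) (hj : j < m) :
    piece x (i : ZMod m) j = seg (fun t : ℕ => x t) (i + 1) (j + 1) := by
  have : ((j : ZMod m) - i).val = j - i := by
    rw [← Nat.cast_sub h.le, ZMod.val_natCast_of_lt (by omega)]
  rw [piece, this, run_natCast]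
  congr 1
  omega

theorem piece_natCast_of_gt [NeZero m] {i j : ℕ} (h : i < j) (hj : j < m) :
    piece x (j : ZMod m) i = seg (fun t : ℕ => x t) (j + 1) (m + i + 1) := by
  have : ((i : ZMod m) - j).val = m + i - j := by
    have e : (i : ZMod m) - j = ((m + i - j : ℕ) : ZMod m) := by
      rw [Nat.cast_sub (by omega)]; simp
    rw [e, ZMod.val_natCast_of_lt (by omega)]
  rw [piece, this, run_natCast]
  congr 1
  omega

variable {n : ℕ} (A : Alphabet n E) (𝕜 : Type*) [Field 𝕜]

/-- The tensor of the two pieces into which the cuts `i` and `j` divide a cyclic word. -/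
noncomputable def pieces (i j : ZMod m) : V 𝕜 n ⊗[𝕜] V 𝕜 n :=
  A.cl 𝕜 (piece x i j) ⊗ₜ[𝕜] A.cl 𝕜 (piece x j i)

/-- The intersection number of the chords at the cuts `i` and `j`. -/
def cutCrossing (i j : ZMod m) : ℤ :=
  crossing A.lt (A.bar (x i)) (x (i + 1)) (A.bar (x j)) (x (j + 1))

variable {𝕜}

theorem pieces_self (i : ZMod m) : pieces x A 𝕜 i i = 0 := by simp [pieces]

/-- The sum over pairs of cuts, taken over ordered pairs of positions on the circle. -/
theorem Alphabet.cutSum_eq_sum_zmod [NeZero m] :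
    A.cutSum 𝕜 (seg (fun t : ℕ => x t) 0 m) =
      ∑ i : ZMod m, ∑ j : ZMod m, cutCrossing x A i j • pieces x A 𝕜 i j := by
  have hper : ∀ t : ℕ, (fun t : ℕ => x t) (m + t) = (fun t : ℕ => x t) t := fun t => by simp
  rw [sum_zmod]
  simp_rw [sum_zmod]
  rw [sum_range_product_eq m (fun i j => cutCrossing x A i j • pieces x A 𝕜 i j)
    (fun i => by rw [pieces_self, smul_zero]), A.cutSum_seg, Finset.range_eq_Ico]
  refine Finset.sum_congr rfl fun j hj => ?_
  rw [Finset.range_eq_Ico]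
  refine Finset.sum_congr rfl fun i hi => ?_
  rw [Finset.mem_Ico] at hi hj
  have e1 : (if j + 1 < m then x ((j + 1 : ℕ) : ZMod m) else x ((0 : ℕ) : ZMod m)) = x (j + 1) := by
    split_ifs with h
    · simp
    · have : m = j + 1 := by omega
      have h2 : ((j : ZMod m) + 1) = ((j + 1 : ℕ) : ZMod m) := by simp
      rw [h2, ← this]; simp
  have e2 : seg (fun t : ℕ => x t) (j + 1) m ++ seg (fun t : ℕ => x t) 0 (i + 1) =
      seg (fun t : ℕ => x t) (j + 1) (m + i + 1) := by
    rw [← seg_append (fun t : ℕ => x t) (a := j + 1) (b := m) (c := m + i + 1)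
      (by omega) (by omega)]
    congr 1
    exact (seg_add_left (fun t : ℕ => x t) hper 0 (i + 1)).symm
  rw [e1, e2]
  simp only [Alphabet.pairTerm, cutCrossing, pieces, piece_natCast_of_lt x hi.2 hj.2,
    piece_natCast_of_gt x hi.2 hj.2, Nat.cast_succ]

/-- The pieces do not change, up to rotation, when both cuts move past equal letters. -/
theorem pieces_add_one [NeZero m] {i j : ZMod m}
    (h : A.letter (x (i + 1)) = A.letter (x (j + 1))) :
    pieces x A 𝕜 (i + 1) (j + 1) = pieces x A 𝕜 i j := by
  have key : ∀ i j : ZMod m, A.letter (x (i + 1)) = A.letter (x (j + 1)) →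
      A.cl 𝕜 (piece x (i + 1) (j + 1)) = A.cl 𝕜 (piece x i j) := by
    intro i j h
    have e : j + 1 - (i + 1) = j - i := by ring
    rw [piece, piece, e]
    rcases hk : (j - i).val with _ | k
    · rfl
    have hj : j = i + (k + 1 : ℕ) := by
      rw [← hk, ZMod.natCast_zmod_val]; ring
    rw [run_succ x (i + 1), run_succ' x i]
    have : (i + 1 + 1 + k : ZMod m) = j + 1 := by rw [hj]; push_cast; ring
    rw [this]
    simp only [Alphabet.cl, List.map_append, List.map_cons, List.map_nil, ← h]
    exact (cls_cons _ _).symm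
  rw [pieces, pieces, key i j h, key j i h.symm]

/-- Letters that are inverse to each other at the two ends of a piece can be stripped off. For
`i = j` this would fail, as an empty piece would become one of length `m - 2`. -/
theorem cl_piece_strip [NeZero m] {i j : ZMod m} (hij : i ≠ j)
    (h : A.letter (x (i + 1)) = (A.letter (x j)).bar) :
    A.cl 𝕜 (piece x (i + 1) (j - 1)) = A.cl 𝕜 (piece x i j) := by
  have hj : j = i + ((j - i).val : ℕ) := by
    rw [ZMod.natCast_zmod_val]; ring
  have hv : (j - i).val ≠ 0 := by
    rw [Ne, ZMod.val_eq_zero, sub_eq_zero]; exact hij.symm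
  have hv1 : (j - i).val ≠ 1 := by
    intro h1
    rw [h1, Nat.cast_one] at hj
    rw [← hj] at h
    exact Letter.bar_ne _ h.symm
  obtain ⟨k, hk⟩ : ∃ k, (j - i).val = k + 2 := ⟨(j - i).val - 2, by omega⟩
  have hlt := ZMod.val_lt (j - i)
  have hk' : (j - 1 - (i + 1)).val = k := by
    have : j - 1 - (i + 1) = (k : ZMod m) := by
      rw [hj, hk]; push_cast; ring
    rw [this, ZMod.val_natCast_of_lt (by omega)]
  rw [piece, piece, hk, hk', run_succ', run_succ]
  have : (i + 1 + 1 + k : ZMod m) = j := by rw [hj, hk]; push_cast; ring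
  rw [this]
  simp only [Alphabet.cl, List.map_append, List.map_cons, List.map_nil, h]
  have := cls_conj (𝕜 := 𝕜) ((run x (i + 1) k).map A.letter) (A.letter (x j)).bar
  rw [Letter.bar_bar] at this
  exact this.symm

/-- The pieces do not change, up to free reduction, when the cuts move towards each other past
inverse letters. -/
theorem pieces_strip [NeZero m] {i j : ZMod m}
    (h : A.letter (x (i + 1)) = (A.letter (x j)).bar) :
    pieces x A 𝕜 (i + 1) (j - 1) = pieces x A 𝕜 i j := by
  have h' : A.letter (x ((j - 1) + 1)) = (A.letter (x (i + 1))).bar := by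
    rw [sub_add_cancel, h, Letter.bar_bar]
  have key' : i + 1 ≠ j - 1 → A.cl 𝕜 (piece x j i) = A.cl 𝕜 (piece x (j - 1) (i + 1)) := by
    intro hij
    have := cl_piece_strip (𝕜 := 𝕜) x A hij.symm h'
    rwa [sub_add_cancel, add_sub_cancel_right] at this
  -- If one of the two pairs of cuts coincides, both sides vanish.
  by_cases h1 : i = j
  · subst h1
    rw [pieces_self]
    by_cases h2 : i + 1 = i - 1
    · rw [h2, pieces_self]
    · rw [pieces, ← key' h2, piece_self, Alphabet.cl_nil, TensorProduct.tmul_zero]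
  · by_cases h2 : i + 1 = j - 1
    · rw [pieces, pieces, ← cl_piece_strip x A h1 h, h2, piece_self, Alphabet.cl_nil,
        TensorProduct.zero_tmul, TensorProduct.zero_tmul]
    · rw [pieces, pieces, cl_piece_strip x A h1 h, key' h2]

end Circle

/-! ### Independence of the values on ties -/

section Circle
variable {E : Type*} {m : ℕ}

/-- The word on a circle, cut open at the position `0`. -/
theorem eq_seg_of_getElem? {L : List E} (hm : L.length = m) {x : ZMod m → E}
    (hx : ∀ t : ℕ, L[t % m]? = some (x t)) : L = seg (fun t : ℕ => x t) 0 m := by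
  apply List.ext_getElem?
  intro i
  rw [getElem?_seg]
  split_ifs with h
  · have := hx i
    rw [Nat.mod_eq_of_lt (by omega)] at this
    rw [this, Nat.zero_add]
  · exact List.getElem?_eq_none (by omega)

theorem exists_circle [NeZero m] (L : List E) (hm : L.length = m) :
    ∃ x : ZMod m → E, ∀ t : ℕ, L[t % m]? = some (x t) := by
  have hpos : 0 < m := Nat.pos_of_ne_zero (NeZero.ne m)
  refine ⟨fun z => L[z.val]'(hm ▸ ZMod.val_lt z), fun t => ?_⟩
  have := Nat.mod_lt t hpos
  rw [List.getElem?_eq_getElem (by omega)]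
  simp [ZMod.val_natCast]

theorem sum_shift {M : Type*} [AddCommMonoid M] [NeZero m] (F : ZMod m → ZMod m → M)
    (c d : ZMod m) : ∑ i, ∑ j, F (i + c) (j + d) = ∑ i, ∑ j, F i j := by
  rw [← Equiv.sum_comp (Equiv.addRight c) (fun i => ∑ j, F i j)]
  exact Fintype.sum_congr _ _ fun i => Equiv.sum_comp (Equiv.addRight d) (F (i + c))

variable {n : ℕ} (A : Alphabet n E) {𝕜 : Type*} [Field 𝕜]

/-- The contributions of a function of the ends which is supported on ties and odd under passing to
the other copy of a side cancel: a tie contributes at the two ends of the common side, and the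
weights `P` (the pairs of pieces) are the same there. -/
theorem sum_crossing_smul_eq_zero {M : Type*} [AddCommGroup M] [NeZero m] (x : ZMod m → E)
    (η : E → E → ℤ) (P : ZMod m → ZMod m → M) (hP : ∀ i, P i i = 0)
    (hP1 : ∀ i j, A.letter (x (i + 1)) = A.letter (x (j + 1)) → P (i + 1) (j + 1) = P i j)
    (hP2 : ∀ i j, A.letter (x (i + 1)) = (A.letter (x j)).bar → P (i + 1) (j - 1) = P i j)
    (h1 : ∀ p q, η p q ≠ 0 → A.letter p = A.letter q)
    (h2 : ∀ i j, i ≠ j → η (A.bar (x i)) (A.bar (x j)) = -η (x i) (x j))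
    (h3 : ∀ i j, η (A.bar (x i)) (x j) = -η (x i) (A.bar (x j))) :
    ∑ i, ∑ j, crossing η (A.bar (x i)) (x (i + 1)) (A.bar (x j)) (x (j + 1)) • P i j = 0 := by
  have e1 : ∑ i, ∑ j, η (x (i + 1)) (x (j + 1)) • P i j = ∑ i, ∑ j, η (x i) (x j) • P i j := by
    rw [← sum_shift (fun i j => η (x i) (x j) • P i j) 1 1]
    refine Fintype.sum_congr _ _ fun i => Fintype.sum_congr _ _ fun j => ?_
    by_cases h : η (x (i + 1)) (x (j + 1)) = 0
    · rw [h, zero_smul, zero_smul]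
    · rw [hP1 _ _ (h1 _ _ h)]
  have e2 : ∑ i, ∑ j, η (x (i + 1)) (A.bar (x j)) • P i j =
      ∑ i, ∑ j, η (x i) (A.bar (x (j + 1))) • P i j := by
    rw [← sum_shift (fun i j => η (x i) (A.bar (x (j + 1))) • P i j) 1 (-1)]
    refine Fintype.sum_congr _ _ fun i => Fintype.sum_congr _ _ fun j => ?_
    rw [← sub_eq_add_neg, sub_add_cancel]
    by_cases h : η (x (i + 1)) (A.bar (x j)) = 0
    · rw [h, zero_smul, zero_smul]
    · rw [hP2 _ _ ((h1 _ _ h).trans (A.letter_bar _))]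
  have e3 : ∑ i, ∑ j, η (A.bar (x i)) (A.bar (x j)) • P i j =
      -∑ i, ∑ j, η (x i) (x j) • P i j := by
    simp only [← Finset.sum_neg_distrib]
    refine Fintype.sum_congr _ _ fun i => Fintype.sum_congr _ _ fun j => ?_
    by_cases h : i = j
    · rw [h, hP, smul_zero, smul_zero, neg_zero]
    · rw [h2 i j h, neg_smul]
  have e4 : ∑ i, ∑ j, η (A.bar (x i)) (x (j + 1)) • P i j =
      -∑ i, ∑ j, η (x i) (A.bar (x (j + 1))) • P i j := by
    simp only [h3, neg_smul, Finset.sum_neg_distrib]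
  simp only [crossing, add_smul, sub_smul, Finset.sum_add_distrib, Finset.sum_sub_distrib]
  rw [e1, e2, e3, e4]
  abel

/-- Two indicator functions that differ only on ties give the same sum of crossings. -/
theorem sum_crossing_smul_congr {M : Type*} [AddCommGroup M] [NeZero m] (x : ZMod m → E)
    (lt lt' : E → E → ℤ) (P : ZMod m → ZMod m → M) (hP : ∀ i, P i i = 0)
    (hP1 : ∀ i j, A.letter (x (i + 1)) = A.letter (x (j + 1)) → P (i + 1) (j + 1) = P i j)
    (hP2 : ∀ i j, A.letter (x (i + 1)) = (A.letter (x j)).bar → P (i + 1) (j - 1) = P i j)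
    (h1 : ∀ p q, A.letter p ≠ A.letter q → lt p q = lt' p q)
    (h2 : ∀ i j, i ≠ j → lt (A.bar (x i)) (A.bar (x j)) + lt (x i) (x j) =
      lt' (A.bar (x i)) (A.bar (x j)) + lt' (x i) (x j))
    (h3 : ∀ i j, lt (A.bar (x i)) (x j) + lt (x i) (A.bar (x j)) =
      lt' (A.bar (x i)) (x j) + lt' (x i) (A.bar (x j))) :
    ∑ i, ∑ j, crossing lt (A.bar (x i)) (x (i + 1)) (A.bar (x j)) (x (j + 1)) • P i j =
      ∑ i, ∑ j, crossing lt' (A.bar (x i)) (x (i + 1)) (A.bar (x j)) (x (j + 1)) • P i j := by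
  have key := sum_crossing_smul_eq_zero A x (fun p q => lt p q - lt' p q) P hP hP1 hP2
    (fun p q h => by_contra fun hc => h (by rw [h1 p q hc, sub_self]))
    (fun i j h => by linarith [h2 i j h]) (fun i j => by linarith [h3 i j])
  rw [← sub_eq_zero, ← key]
  simp only [← Finset.sum_sub_distrib, ← sub_smul]
  refine Fintype.sum_congr _ _ fun i => Fintype.sum_congr _ _ fun j => ?_
  congr 1
  simp only [crossing]
  ring

end Circle

section Alphabets
variable {n : ℕ} (pos : Letter n → ℕ)

/-- The indicator function of the order of the sides of the polygon. On the diagonal it is chosen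
such that the two values at a letter and at its inverse add up to `1`, so that the total of the
contributions of the two ends of a common side is that of a strict order. -/
def letterLt (a b : Letter n) : ℤ :=
  if a = b then (if a.2 then 1 else 0) else if pos a < pos b then 1 else 0

/-- The letters themselves as an alphabet. -/
def letterAlphabet : Alphabet n (Letter n) where
  bar := Letter.bar
  lt := letterLt pos
  letter := id
  letter_bar _ := rfl

/-- Letters with an integer label. Ends on the same side are ordered by their labels, in opposite
directions on the two copies of a side. -/
def labelledAlphabet : Alphabet n (Letter n × ℤ) where
  bar e := (e.1.bar, -e.2)
  lt e e' := if e.1 = e'.1 then (if e.2 < e'.2 then 1 else 0) else letterLt pos e.1 e'.1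
  letter := Prod.fst
  letter_bar _ := rfl

theorem letterLt_self_add (a : Letter n) : letterLt pos a a + letterLt pos a.bar a.bar = 1 := by
  obtain ⟨i, b⟩ := a
  cases b <;> simp [letterLt, Letter.bar]

/-- The labels of a word that describe a curve in general position: distinct and positive. -/
def GoodLabels (L : List (Letter n × ℤ)) : Prop :=
  (L.map Prod.snd).Nodup ∧ ∀ e ∈ L, 0 < e.2

variable {pos} {𝕜 : Type*} [Field 𝕜]

/-- The sum over pairs of cuts does not depend on how ties are resolved: ordering the ends on a side
by labels gives the same sum as the values of `letterLt` on the diagonal. -/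
theorem cutSum_labelled {L : List (Letter n × ℤ)} (hL : GoodLabels L) :
    (labelledAlphabet pos).cutSum 𝕜 L = (letterAlphabet pos).cutSum 𝕜 (L.map Prod.fst) := by
  rcases List.eq_nil_or_concat' L with rfl | ⟨L₀, e₀, hL₀⟩
  · simp [Alphabet.cutSum]
  have hpos : L.length ≠ 0 := by rw [hL₀]; simp
  clear hL₀
  obtain ⟨m, hm⟩ : ∃ m, L.length = m := ⟨_, rfl⟩
  have : NeZero m := ⟨hm ▸ hpos⟩
  obtain ⟨x, hx⟩ := exists_circle L hm
  have hx' : ∀ t : ℕ, (L.map Prod.fst)[t % m]? = some ((fun z => (x z).1) t) := fun t => by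
    rw [List.getElem?_map, hx]; rfl
  rw [eq_seg_of_getElem? (L := L.map Prod.fst) (x := fun z => (x z).1) (by simpa using hm) hx',
    eq_seg_of_getElem? (L := L) hm hx, Alphabet.cutSum_eq_sum_zmod,
    Alphabet.cutSum_eq_sum_zmod (fun z => (x z).1)]
  have hp : ∀ i j, pieces (fun z => (x z).1) (letterAlphabet pos) 𝕜 i j =
      pieces x (labelledAlphabet pos) 𝕜 i j := fun i j => by
    simp [pieces, piece, run, Alphabet.cl, letterAlphabet, labelledAlphabet, Function.comp_def]
  have hv : ∀ i : ZMod m, L[i.val]? = some (x i) := fun i => by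
    have := hx i.val
    rwa [Nat.mod_eq_of_lt (ZMod.val_lt i), ZMod.natCast_zmod_val] at this
  have hpos : ∀ i, 0 < (x i).2 := fun i => hL.2 _ (List.mem_of_getElem? (hv i))
  have hne : ∀ i j, i ≠ j → (x i).2 ≠ (x j).2 := by
    intro i j hij h
    refine hij (ZMod.val_injective m ?_)
    refine (List.getElem?_inj (by simpa [hm] using ZMod.val_lt i) hL.1).1 ?_
    rw [List.getElem?_map, List.getElem?_map, hv, hv, Option.map_some, Option.map_some, h]
  simp only [hp]
  refine sum_crossing_smul_congr (labelledAlphabet pos) x (labelledAlphabet pos).lt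
    (fun p q => letterLt pos p.1 q.1) (pieces x (labelledAlphabet pos) 𝕜) (pieces_self x _)
    (fun _ _ h => pieces_add_one x _ h) (fun _ _ h => pieces_strip x _ h) ?_ ?_ ?_
  · intro p q h
    exact if_neg h
  · intro i j hij
    have := hne i j hij
    have h2 := letterLt_self_add pos (x i).1
    simp only [labelledAlphabet, Letter.bar_inj]
    split_ifs with h h3 h4 h4
    · omega
    · rw [← h]; linarith
    · rw [← h]; linarith
    · omega
    · rfl
  · intro i j
    have hi := hpos i
    have hj := hpos j
    have h2 := letterLt_self_add pos (x i).1
    simp only [labelledAlphabet, ← Letter.bar_eq_iff]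
    split_ifs with h h3 h4 h4
    · omega
    · rw [← h, Letter.bar_bar]; linarith
    · omega
    · omega
    · rfl

end Alphabets

/-! ### Invariance under rotation and free reduction -/

section Invariance
variable {n : ℕ} {E : Type*} (A : Alphabet n E) {𝕜 : Type*} [Field 𝕜]

theorem cutSum_rotate (L : List E) (r : ℕ) : A.cutSum 𝕜 (L.rotate r) = A.cutSum 𝕜 L := by
  rcases eq_or_ne L [] with rfl | hL
  · simp
  obtain ⟨m, hm⟩ : ∃ m, L.length = m := ⟨_, rfl⟩
  have : NeZero m := ⟨by rw [← hm]; exact (List.length_pos_iff.2 hL).ne'⟩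
  have hpos : 0 < m := Nat.pos_of_ne_zero (NeZero.ne m)
  obtain ⟨x, hx⟩ := exists_circle L hm
  have hx' : ∀ t : ℕ, (L.rotate r)[t % m]? = some ((fun z : ZMod m => x (z + r)) t) := fun t => by
    rw [List.getElem?_rotate (by rw [hm]; exact Nat.mod_lt _ hpos), hm, Nat.mod_add_mod, hx]
    simp
  rw [eq_seg_of_getElem? (L := L.rotate r) (x := fun z : ZMod m => x (z + r))
      (by simpa using hm) hx',
    eq_seg_of_getElem? (L := L) hm hx,
    Alphabet.cutSum_eq_sum_zmod (fun z : ZMod m => x (z + r)), Alphabet.cutSum_eq_sum_zmod,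
    ← sum_shift (fun i j => cutCrossing x A i j • pieces x A 𝕜 i j) r r]
  refine Fintype.sum_congr _ _ fun i => Fintype.sum_congr _ _ fun j => ?_
  have e : ∀ i : ZMod m, i + 1 + r = i + r + 1 := fun i => by ring
  have e' : ∀ i t : ZMod m, i + 1 + t + r = i + r + 1 + t := fun i t => by ring
  simp only [cutCrossing, pieces, piece, run, e, e', add_sub_add_right_eq_sub]

theorem crossing_self_left (lt : E → E → ℤ) (s s' t' : E) : crossing lt s s s' t' = 0 := by
  simp [crossing]

theorem crossing_self_right (lt : E → E → ℤ) (s t s' : E) : crossing lt s t s' s' = 0 := by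
  simp [crossing]

/-- The chord between `a` and `a.bar` returns to its own side, and the chords before and after these
two letters add up to one chord of the shorter word. -/
theorem cutSum_concat_cancel (pos : Letter n → ℕ) (L : Word n) (a : Letter n) :
    (letterAlphabet pos).cutSum 𝕜 (L ++ [a, a.bar]) = (letterAlphabet pos).cutSum 𝕜 L := by
  have hcl : ∀ u v : Word n, (letterAlphabet pos).cl 𝕜 (u ++ [a, a.bar] ++ v) =
      (letterAlphabet pos).cl 𝕜 (u ++ v) := fun u v => by
    simpa [Alphabet.cl, letterAlphabet] using cls_cancel (𝕜 := 𝕜) u v a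
  have hcl0 : (letterAlphabet pos).cl 𝕜 [a, a.bar] = 0 := by
    have := hcl [] []
    simpa using this
  have : Nonempty (Letter n) := ⟨a⟩
  obtain ⟨y, hy⟩ := exists_eq_seg (L ++ [a, a.bar])
  rw [List.length_append] at hy
  change _ = seg y 0 (L.length + 2) at hy
  obtain ⟨m, hm⟩ : ∃ m, L.length = m := ⟨_, rfl⟩
  rw [hm] at hy
  have hL : L = seg y 0 m := by
    have := congrArg (List.take m) hy
    rwa [List.take_left' hm, take_seg y (by omega), Nat.zero_add] at this
  have h2 : [a, a.bar] = seg y m (m + 2) := by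
    have := congrArg (List.drop m) hy
    rwa [List.drop_left' hm, drop_seg y, Nat.zero_add] at this
  have ha : y m = a := by
    have := congrArg List.head? h2
    rw [head?_seg y (by omega)] at this
    simpa using this.symm
  have ha' : y (m + 1) = a.bar := by
    have := congrArg (fun l => l[1]?) h2
    simp only [getElem?_seg] at this
    simpa using this.symm
  rw [hy, hL, Alphabet.cutSum_seg, Alphabet.cutSum_seg]
  have hb : (letterAlphabet pos).bar = Letter.bar := rfl
  rcases m with _ | k
  · rw [Finset.sum_Ico_succ_top (by omega), Finset.sum_Ico_succ_top (by omega)]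
    simp only [zero_add] at ha'
    simp [Alphabet.pairTerm, hb, ha', Letter.bar_bar, ha, crossing_self_left, crossing_self_right]
  rw [Finset.sum_Ico_succ_top (b := k + 1 + 1) (by omega),
    Finset.sum_Ico_succ_top (b := k + 1) (by omega)]
  -- The chord from `a.bar` to `a.bar`, between the two cancelling letters, crosses nothing.
  have z1 : ∑ i ∈ Finset.Ico 0 (k + 1), (letterAlphabet pos).pairTerm 𝕜 (y i) (y (i + 1))
      (y (k + 1)) (if k + 1 + 1 < k + 1 + 2 then y (k + 1 + 1) else y 0)
      (seg y (i + 1) (k + 1 + 1)) (seg y (k + 1 + 1) (k + 1 + 2) ++ seg y 0 (i + 1)) = 0 := by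
    refine Finset.sum_eq_zero fun i _ => ?_
    rw [if_pos (by omega), ha', ha]
    simp [Alphabet.pairTerm, hb, crossing_self_left, crossing_self_right]
  rw [z1, add_zero, Finset.sum_Ico_succ_top (b := k) (by omega),
    Finset.sum_Ico_succ_top (b := k) (by omega), add_assoc]
  congr 1
  · refine Finset.sum_congr rfl fun l hl => Finset.sum_congr rfl fun i hi => ?_
    rw [Finset.mem_Ico] at hl hi
    rw [if_pos (by omega), if_pos (by omega),
      ← seg_append y (a := l + 1) (b := k + 1) (c := k + 1 + 2) (by omega) (by omega), ← h2]
    simp only [Alphabet.pairTerm, hcl]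
  · rw [Finset.sum_Ico_succ_top (b := k + 1) (by omega),
      Finset.sum_Ico_succ_top (b := k) (by omega),
      ← add_assoc, ← add_assoc, ← Finset.sum_add_distrib]
    have z2 : (letterAlphabet pos).pairTerm 𝕜 (y (k + 1)) (y (k + 1 + 1)) (y (k + 1 + 1))
        (if k + 1 + 1 + 1 < k + 1 + 2 then y (k + 1 + 1 + 1) else y 0)
        (seg y (k + 1 + 1) (k + 1 + 1 + 1))
        (seg y (k + 1 + 1 + 1) (k + 1 + 2) ++ seg y 0 (k + 1 + 1)) = 0 := by
      rw [ha', ha]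
      simp [Alphabet.pairTerm, hb, crossing_self_left, crossing_self_right]
    -- Here one of the two pieces is `[a, a.bar]`, which is trivial in the free group.
    have z3 : (letterAlphabet pos).pairTerm 𝕜 (y k) (y (k + 1)) (y (k + 1 + 1))
        (if k + 1 + 1 + 1 < k + 1 + 2 then y (k + 1 + 1 + 1) else y 0)
        (seg y (k + 1) (k + 1 + 1 + 1))
        (seg y (k + 1 + 1 + 1) (k + 1 + 2) ++ seg y 0 (k + 1)) = 0 := by
      rw [show seg y (k + 1) (k + 1 + 1 + 1) = [a, a.bar] from h2.symm, Alphabet.pairTerm, hcl0]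
      simp
    rw [z2, z3, add_zero, add_zero]
    -- The chords ending at `a` and starting at `a` combine to the chord of the shorter word.
    refine Finset.sum_congr rfl fun i hi => ?_
    rw [Finset.mem_Ico] at hi
    rw [if_pos (by omega), if_neg (by omega), if_neg (by omega), ha, ha',
      ← seg_append y (a := i + 1) (b := k + 1) (c := k + 1 + 1 + 1) (by omega) (by omega),
      show seg y (k + 1) (k + 1 + 1 + 1) = [a, a.bar] from h2.symm,
      show seg y (k + 1 + 1 + 1) (k + 1 + 2) = [] from seg_self y _, seg_self y (k + 1)]
    have e1 := hcl (seg y (i + 1) (k + 1)) []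
    have e2 := hcl [] (seg y 0 (i + 1))
    simp only [List.append_nil, List.nil_append] at e1 e2 ⊢
    simp only [Alphabet.pairTerm, hb, Letter.bar_bar, e1, e2]
    rw [add_add_add_comm, ← add_smul, ← add_smul]
    congr 2 <;> simp only [crossing] <;> ring

end Invariance

/-! ### Reindexing of sums over cuts -/

section Reindex
variable {M : Type*} [AddCommMonoid M] (m : ℕ)

/-- Increasing triples below `m`. -/
def triples : Finset (ℕ × ℕ × ℕ) :=
  (Finset.range m ×ˢ Finset.range m ×ˢ Finset.range m).filter fun x => x.1 < x.2.1 ∧ x.2.1 < x.2.2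

/-- Increasing quadruples below `m`. -/
def quadruples : Finset (ℕ × ℕ × ℕ × ℕ) :=
  (Finset.range m ×ˢ Finset.range m ×ˢ Finset.range m ×ˢ Finset.range m).filter
    fun x => x.1 < x.2.1 ∧ x.2.1 < x.2.2.1 ∧ x.2.2.1 < x.2.2.2

variable {m}

theorem mem_triples {p q r : ℕ} : (p, q, r) ∈ triples m ↔ p < q ∧ q < r ∧ r < m := by
  simp only [triples, Finset.mem_filter, Finset.mem_product, Finset.mem_range]
  omega

theorem mem_quadruples {p q r s : ℕ} :
    (p, q, r, s) ∈ quadruples m ↔ p < q ∧ q < r ∧ r < s ∧ s < m := by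
  simp only [quadruples, Finset.mem_filter, Finset.mem_product, Finset.mem_range]
  omega

theorem sum_triples_right (f : ℕ → ℕ → ℕ → M) :
    ∑ j ∈ Finset.range m, ∑ i ∈ Finset.range j, ∑ k ∈ Finset.Ico (j + 1) m, f i j k =
      ∑ x ∈ triples m, f x.1 x.2.1 x.2.2 := by
  rw [Finset.sum_sigma', Finset.sum_sigma']
  refine Finset.sum_nbij' (fun x => (x.1.2, x.1.1, x.2)) (fun y => ⟨⟨y.2.1, y.1⟩, y.2.2⟩)
    ?_ ?_ ?_ ?_ ?_
  · rintro ⟨⟨j, i⟩, k⟩ h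
    simp only [Finset.mem_sigma, Finset.mem_range, Finset.mem_Ico] at h
    simp only [mem_triples]
    omega
  · rintro ⟨i, j, k⟩ h
    rw [mem_triples] at h
    simp only [Finset.mem_sigma, Finset.mem_range, Finset.mem_Ico]
    omega
  all_goals intros; rfl

theorem sum_triples_left (f : ℕ → ℕ → ℕ → M) :
    ∑ j ∈ Finset.range m, ∑ i ∈ Finset.range j, ∑ k ∈ Finset.range i, f k i j =
      ∑ x ∈ triples m, f x.1 x.2.1 x.2.2 := by
  rw [Finset.sum_sigma', Finset.sum_sigma']
  refine Finset.sum_nbij' (fun x => (x.2, x.1.2, x.1.1)) (fun y => ⟨⟨y.2.2, y.2.1⟩, y.1⟩)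
    ?_ ?_ ?_ ?_ ?_
  · rintro ⟨⟨j, i⟩, k⟩ h
    simp only [Finset.mem_sigma, Finset.mem_range] at h
    simp only [mem_triples]
    omega
  · rintro ⟨i, j, k⟩ h
    rw [mem_triples] at h
    simp only [Finset.mem_sigma, Finset.mem_range]
    omega
  all_goals intros; rfl

theorem sum_triples_mid (f : ℕ → ℕ → ℕ → M) :
    ∑ j ∈ Finset.range m, ∑ i ∈ Finset.range j, ∑ k ∈ Finset.Ico (i + 1) j, f i k j =
      ∑ x ∈ triples m, f x.1 x.2.1 x.2.2 := by
  rw [Finset.sum_sigma', Finset.sum_sigma']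
  refine Finset.sum_nbij' (fun x => (x.1.2, x.2, x.1.1)) (fun y => ⟨⟨y.2.2, y.1⟩, y.2.1⟩)
    ?_ ?_ ?_ ?_ ?_
  · rintro ⟨⟨j, i⟩, k⟩ h
    simp only [Finset.mem_sigma, Finset.mem_range, Finset.mem_Ico] at h
    simp only [mem_triples]
    omega
  · rintro ⟨i, j, k⟩ h
    rw [mem_triples] at h
    simp only [Finset.mem_sigma, Finset.mem_range, Finset.mem_Ico]
    omega
  all_goals intros; rfl

theorem sum_quadruples_right (f : ℕ → ℕ → ℕ → ℕ → M) :
    ∑ j ∈ Finset.range m, ∑ i ∈ Finset.range j, ∑ l ∈ Finset.Ico (j + 1) m,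
      ∑ k ∈ Finset.Ico (j + 1) l, f i j k l =
      ∑ x ∈ quadruples m, f x.1 x.2.1 x.2.2.1 x.2.2.2 := by
  rw [Finset.sum_sigma', Finset.sum_sigma', Finset.sum_sigma']
  refine Finset.sum_nbij' (fun x => (x.1.1.2, x.1.1.1, x.2, x.1.2))
    (fun y => ⟨⟨⟨y.2.1, y.1⟩, y.2.2.2⟩, y.2.2.1⟩) ?_ ?_ ?_ ?_ ?_
  · rintro ⟨⟨⟨j, i⟩, l⟩, k⟩ h
    simp only [Finset.mem_sigma, Finset.mem_range, Finset.mem_Ico] at h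
    simp only [mem_quadruples]
    omega
  · rintro ⟨i, j, k, l⟩ h
    rw [mem_quadruples] at h
    simp only [Finset.mem_sigma, Finset.mem_range, Finset.mem_Ico]
    omega
  all_goals intros; rfl

theorem sum_quadruples_left (f : ℕ → ℕ → ℕ → ℕ → M) :
    ∑ j ∈ Finset.range m, ∑ i ∈ Finset.range j, ∑ l ∈ Finset.range i,
      ∑ k ∈ Finset.range l, f k l i j =
      ∑ x ∈ quadruples m, f x.1 x.2.1 x.2.2.1 x.2.2.2 := by
  rw [Finset.sum_sigma', Finset.sum_sigma', Finset.sum_sigma']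
  refine Finset.sum_nbij' (fun x => (x.2, x.1.2, x.1.1.2, x.1.1.1))
    (fun y => ⟨⟨⟨y.2.2.2, y.2.2.1⟩, y.2.1⟩, y.1⟩) ?_ ?_ ?_ ?_ ?_
  · rintro ⟨⟨⟨j, i⟩, l⟩, k⟩ h
    simp only [Finset.mem_sigma, Finset.mem_range] at h
    simp only [mem_quadruples]
    omega
  · rintro ⟨i, j, k, l⟩ h
    rw [mem_quadruples] at h
    simp only [Finset.mem_sigma, Finset.mem_range]
    omega
  all_goals intros; rfl

theorem sum_quadruples_outer (f : ℕ → ℕ → ℕ → ℕ → M) :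
    ∑ j ∈ Finset.range m, ∑ i ∈ Finset.range j, ∑ l ∈ Finset.range i,
      ∑ k ∈ Finset.Ico (j + 1) m, f l i j k =
      ∑ x ∈ quadruples m, f x.1 x.2.1 x.2.2.1 x.2.2.2 := by
  rw [Finset.sum_sigma', Finset.sum_sigma', Finset.sum_sigma']
  refine Finset.sum_nbij' (fun x => (x.1.2, x.1.1.2, x.1.1.1, x.2))
    (fun y => ⟨⟨⟨y.2.2.1, y.2.1⟩, y.1⟩, y.2.2.2⟩) ?_ ?_ ?_ ?_ ?_
  · rintro ⟨⟨⟨j, i⟩, l⟩, k⟩ h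
    simp only [Finset.mem_sigma, Finset.mem_range, Finset.mem_Ico] at h
    simp only [mem_quadruples]
    omega
  · rintro ⟨i, j, k, l⟩ h
    rw [mem_quadruples] at h
    simp only [Finset.mem_sigma, Finset.mem_range, Finset.mem_Ico]
    omega
  all_goals intros; rfl

theorem sum_quadruples_inner (f : ℕ → ℕ → ℕ → ℕ → M) :
    ∑ j ∈ Finset.range m, ∑ i ∈ Finset.range j, ∑ l ∈ Finset.Ico (i + 1) j,
      ∑ k ∈ Finset.Ico (i + 1) l, f i k l j =
      ∑ x ∈ quadruples m, f x.1 x.2.1 x.2.2.1 x.2.2.2 := by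
  rw [Finset.sum_sigma', Finset.sum_sigma', Finset.sum_sigma']
  refine Finset.sum_nbij' (fun x => (x.1.1.2, x.2, x.1.2, x.1.1.1))
    (fun y => ⟨⟨⟨y.2.2.2, y.1⟩, y.2.2.1⟩, y.2.1⟩) ?_ ?_ ?_ ?_ ?_
  · rintro ⟨⟨⟨j, i⟩, l⟩, k⟩ h
    simp only [Finset.mem_sigma, Finset.mem_range, Finset.mem_Ico] at h
    simp only [mem_quadruples]
    omega
  · rintro ⟨i, j, k, l⟩ h
    rw [mem_quadruples] at h
    simp only [Finset.mem_sigma, Finset.mem_range, Finset.mem_Ico]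
    omega
  all_goals intros; rfl

end Reindex

/-! ### Crossing numbers in a linear order -/

section Order
variable {E κ : Type*} [LinearOrder κ] (K : E → κ) {lt : E → E → ℤ}

theorem lt_eq_one_sub (hlt : ∀ p q, lt p q = if K p < K q then 1 else 0) {p q : E} (h : K p ≠ K q) :
    lt p q = 1 - lt q p := by
  rw [hlt, hlt]
  rcases lt_or_gt_of_ne h with h | h
  · rw [if_pos h, if_neg h.not_gt]; rfl
  · rw [if_neg h.not_gt, if_pos h]; rfl

/-- With `σ = 2 lt - 1` the sign of a comparison, `σ(p,q) σ(q,r) + σ(q,r) σ(r,p) + σ(r,p) σ(p,q)`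
equals `-1` for distinct points. -/
theorem sign_identity (hlt : ∀ p q, lt p q = if K p < K q then 1 else 0) {p q r : E}
    (h1 : K p ≠ K q) (h2 : K q ≠ K r) (h3 : K r ≠ K p) :
    (2 * lt p q - 1) * (2 * lt q r - 1) + (2 * lt q r - 1) * (2 * lt r p - 1) +
      (2 * lt r p - 1) * (2 * lt p q - 1) = -1 := by
  simp only [hlt]
  split_ifs with a b c c b c c
  · exact absurd (a.trans b) c.not_gt
  · norm_num
  · norm_num
  · norm_num
  · norm_num
  · norm_num
  · norm_num
  · exact absurd ((lt_of_le_of_ne (not_lt.1 a) h1.symm).trans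
      (lt_of_le_of_ne (not_lt.1 c) h3.symm)) (lt_of_le_of_ne (not_lt.1 b) h2.symm).not_gt

theorem crossing_swap (hlt : ∀ p q, lt p q = if K p < K q then 1 else 0) {s t s' t' : E}
    (h1 : K s ≠ K s') (h2 : K s ≠ K t') (h3 : K t ≠ K s') (h4 : K t ≠ K t') :
    crossing lt s' t' s t = -crossing lt s t s' t' := by
  simp only [crossing]
  rw [lt_eq_one_sub K hlt h1, lt_eq_one_sub K hlt h2, lt_eq_one_sub K hlt h3,
    lt_eq_one_sub K hlt h4]
  ring

/-- The identity behind the Jacobi identity: smoothing one of the crossings of three chords in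
general position, and then a crossing of the third chord with one of the two smoothed chords. -/
theorem crossing_identity (hlt : ∀ p q, lt p q = if K p < K q then 1 else 0)
    {s₁ t₁ s₂ t₂ s₃ t₃ : E}
    (a1 : K s₁ ≠ K s₂) (a2 : K s₁ ≠ K t₂) (a3 : K t₁ ≠ K s₂) (a4 : K t₁ ≠ K t₂)
    (b1 : K s₂ ≠ K s₃) (b2 : K s₂ ≠ K t₃) (b3 : K t₂ ≠ K s₃) (b4 : K t₂ ≠ K t₃)
    (c1 : K s₃ ≠ K s₁) (c2 : K s₃ ≠ K t₁) (c3 : K t₃ ≠ K s₁) (c4 : K t₃ ≠ K t₁) :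
    crossing lt s₁ t₁ s₂ t₂ * crossing lt s₃ t₃ s₁ t₂ +
      crossing lt s₂ t₂ s₃ t₃ * crossing lt s₁ t₁ s₂ t₃ +
      crossing lt s₃ t₃ s₁ t₁ * crossing lt s₂ t₂ s₃ t₁ = 0 := by
  have h1 := sign_identity K hlt a1 b1 c1
  have h2 := sign_identity K hlt a1 b2 c3
  have h3 := sign_identity K hlt a2 b3 c1
  have h4 := sign_identity K hlt a2 b4 c3
  have h5 := sign_identity K hlt a3 b1 c2
  have h6 := sign_identity K hlt a3 b2 c4
  have h7 := sign_identity K hlt a4 b3 c2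
  have h8 := sign_identity K hlt a4 b4 c4
  simp only [crossing]
  -- Four times the sum is an alternating sum of the relation between signs, over the eight triples
  -- formed by one end of each chord.
  rw [lt_eq_one_sub K hlt b4.symm, lt_eq_one_sub K hlt b3.symm, lt_eq_one_sub K hlt c4.symm,
    lt_eq_one_sub K hlt c3.symm, lt_eq_one_sub K hlt a4.symm, lt_eq_one_sub K hlt a3.symm]
  refine mul_left_cancel₀ (four_ne_zero (α := ℤ)) ?_
  linear_combination h1 - h2 - h3 + h4 - h5 + h6 + h7 - h8

end Order

/-! ### The Jacobi identity for chord diagrams -/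

section Jacobi
variable {n : ℕ} {E : Type*} (A : Alphabet n E) (x : ℕ → E) {M : Type*} [AddCommGroup M]

/-- The crossing number of the chords at the cuts `i` and `j`. -/
def chordCrossing (i j : ℕ) : ℤ :=
  crossing A.lt (A.bar (x i)) (x (i + 1)) (A.bar (x j)) (x (j + 1))

/-- The crossing number of the chord at the cut `k` with the smoothed chord that starts like the one
at the cut `i` and ends like the one at the cut `j`. -/
def smoothedCrossing (k i j : ℕ) : ℤ :=
  crossing A.lt (A.bar (x k)) (x (k + 1)) (A.bar (x i)) (x (j + 1))

/-- The sum over pairs of cuts of the word `x a ⋯ x (b - 1)`, with values in a function `alt` of the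
word `u` and of the two pieces. -/
def altSum (alt : List E → List E → List E → M) (u : List E) (a b : ℕ) : M :=
  ∑ l ∈ Finset.Ico a b, ∑ k ∈ Finset.Ico a l,
    crossing A.lt (A.bar (x k)) (x (k + 1)) (A.bar (x l)) (if l + 1 < b then x (l + 1) else x a) •
      alt u (seg x (k + 1) (l + 1)) (seg x (l + 1) b ++ seg x a (k + 1))

variable (alt : List E → List E → List E → M)

/-- The sum for the piece between the cuts `i < j`; the cut at its own end carries the chord that
results from smoothing. -/
theorem altSum_inner (u : List E) {i j : ℕ} (hij : i < j) :
    altSum A x alt u (i + 1) (j + 1) =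
      ∑ l ∈ Finset.Ico (i + 1) j, ∑ k ∈ Finset.Ico (i + 1) l, chordCrossing A x k l •
        alt u (seg x (k + 1) (l + 1)) (seg x (l + 1) (j + 1) ++ seg x (i + 1) (k + 1)) +
      ∑ k ∈ Finset.Ico (i + 1) j, smoothedCrossing A x k j i •
        alt u (seg x (k + 1) (j + 1)) (seg x (i + 1) (k + 1)) := by
  rw [altSum, Finset.sum_Ico_succ_top (by omega)]
  congr 1
  · refine Finset.sum_congr rfl fun l hl => Finset.sum_congr rfl fun k hk => ?_
    rw [Finset.mem_Ico] at hl
    rw [if_pos (by omega), chordCrossing]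
  · refine Finset.sum_congr rfl fun k hk => ?_
    rw [if_neg (by omega), seg_self, List.nil_append, smoothedCrossing]

variable {x} {m : ℕ}

/-- The sum for the piece outside the cuts `i < j`, with all positions reduced below `m`. -/
theorem altSum_outer (hx : ∀ t, x (m + t) = x t) (u : List E) {i j : ℕ}
    (hj : j < m) :
    altSum A x alt u (j + 1) (m + i + 1) =
      ((∑ l ∈ Finset.Ico (j + 1) m, ∑ k ∈ Finset.Ico (j + 1) l, chordCrossing A x k l •
        alt u (seg x (k + 1) (l + 1)) (seg x (l + 1) (m + i + 1) ++ seg x (j + 1) (k + 1)) +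
      (∑ l ∈ Finset.range i, ∑ k ∈ Finset.Ico (j + 1) m, chordCrossing A x k l •
        alt u (seg x (k + 1) (m + l + 1)) (seg x (l + 1) (i + 1) ++ seg x (j + 1) (k + 1)) +
      ∑ l ∈ Finset.range i, ∑ k ∈ Finset.range l, chordCrossing A x k l •
        alt u (seg x (k + 1) (l + 1)) (seg x (l + 1) (i + 1) ++ seg x (j + 1) (m + k + 1)))) +
      (∑ k ∈ Finset.Ico (j + 1) m, smoothedCrossing A x k i j •
        alt u (seg x (k + 1) (m + i + 1)) (seg x (j + 1) (k + 1)) +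
      ∑ k ∈ Finset.range i, smoothedCrossing A x k i j •
        alt u (seg x (k + 1) (i + 1)) (seg x (j + 1) (m + k + 1)))) := by
  have hx1 : ∀ t, x (m + t + 1) = x (t + 1) := fun t => by rw [Nat.add_assoc, hx]
  have hs : ∀ a b, seg x (m + a + 1) (m + b + 1) = seg x (a + 1) (b + 1) := fun a b => by
    rw [Nat.add_assoc, Nat.add_assoc, seg_add_left x hx]
  rw [altSum, Finset.sum_Ico_succ_top (by omega)]
  congr 1
  · rw [← Finset.sum_Ico_consecutive _ (n := m) (by omega) (by omega), ← Finset.sum_add_distrib]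
    congr 1
    · refine Finset.sum_congr rfl fun l hl => Finset.sum_congr rfl fun k hk => ?_
      rw [Finset.mem_Ico] at hl
      rw [if_pos (by omega), chordCrossing]
    · rw [Finset.sum_Ico_eq_sum_range, Nat.add_sub_cancel_left]
      refine Finset.sum_congr rfl fun l hl => ?_
      rw [Finset.mem_range] at hl
      rw [← Finset.sum_Ico_consecutive _ (n := m) (by omega) (by omega)]
      congr 1
      · refine Finset.sum_congr rfl fun k hk => ?_
        rw [if_pos (by omega), chordCrossing, hx, hx1, hs]
      · rw [Finset.sum_Ico_eq_sum_range, Nat.add_sub_cancel_left]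
        refine Finset.sum_congr rfl fun k hk => ?_
        rw [if_pos (by omega), chordCrossing, hx, hx1, hx, hx1, hs, hs]
  · rw [← Finset.sum_Ico_consecutive _ (n := m) (by omega) (by omega)]
    congr 1
    · refine Finset.sum_congr rfl fun k hk => ?_
      rw [if_neg (by omega), hx, seg_self, List.nil_append, smoothedCrossing]
    · rw [Finset.sum_Ico_eq_sum_range, Nat.add_sub_cancel_left]
      refine Finset.sum_congr rfl fun k hk => ?_
      rw [if_neg (by omega), hx, hx, hx1, seg_self, List.nil_append, hs, smoothedCrossing]

/-- The chords of the word `x 0 ⋯ x (m - 1)` are in general position: all their ends are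
distinct. -/
structure GeneralPosition {κ : Type*} (K : E → κ) (x : ℕ → E) (m : ℕ) : Prop where
  source : ∀ i j, ¬ i ≡ j [MOD m] → K (A.bar (x i)) ≠ K (A.bar (x j))
  target : ∀ i j, ¬ i ≡ j [MOD m] → K (x (i + 1)) ≠ K (x (j + 1))
  source_target : ∀ i j, K (A.bar (x i)) ≠ K (x j)

variable {A} {κ : Type*} [LinearOrder κ] {K : E → κ}

theorem not_modEq_of_lt {i j : ℕ} (hi : i < m) (hj : j < m) (hij : i ≠ j) : ¬ i ≡ j [MOD m] :=
  fun h => hij (Nat.ModEq.eq_of_lt_of_lt h hi hj)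

theorem chordCrossing_swap (hlt : ∀ p q, A.lt p q = if K p < K q then 1 else 0)
    (hg : GeneralPosition A K x m) {i j : ℕ} (hi : i < m) (hj : j < m)
    (hij : i ≠ j) : chordCrossing A x j i = -chordCrossing A x i j :=
  crossing_swap K hlt (hg.source i j (not_modEq_of_lt hi hj hij)) (hg.source_target i _)
    (hg.source_target j _).symm (hg.target i j (not_modEq_of_lt hi hj hij))

theorem smoothedCrossing_identity (hlt : ∀ p q, A.lt p q = if K p < K q then 1 else 0)
    (hg : GeneralPosition A K x m) {p q r : ℕ} (hp : p < q) (hq : q < r) (hr : r < m) :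
    chordCrossing A x p q * smoothedCrossing A x r p q +
      chordCrossing A x q r * smoothedCrossing A x p q r +
      chordCrossing A x r p * smoothedCrossing A x q r p = 0 := by
  have h1 : ¬ p ≡ q [MOD m] := not_modEq_of_lt (by omega) (by omega) (by omega)
  have h2 : ¬ q ≡ r [MOD m] := not_modEq_of_lt (by omega) (by omega) (by omega)
  have h3 : ¬ r ≡ p [MOD m] := not_modEq_of_lt (by omega) (by omega) (by omega)
  exact crossing_identity K hlt
    (hg.source p q h1) (hg.source_target _ _) (hg.source_target _ _).symm (hg.target p q h1)
    (hg.source q r h2) (hg.source_target _ _) (hg.source_target _ _).symm (hg.target q r h2)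
    (hg.source r p h3) (hg.source_target _ _) (hg.source_target _ _).symm (hg.target r p h3)

/-- The Jacobi identity. Four distinct cuts arise in two orders, with opposite signs; three cuts
arise in three orders, for which the coefficients add up to zero. -/
theorem sum_altSum_eq_zero (hlt : ∀ p q, A.lt p q = if K p < K q then 1 else 0)
    (hx : ∀ t, x (m + t) = x t) (hg : GeneralPosition A K x m)
    (h12 : ∀ u v w, alt u v w = -alt v u w) (h23 : ∀ u v w, alt u v w = -alt u w v)
    (hrot : ∀ u v w w', alt u v (w ++ w') = alt u v (w' ++ w)) :
    ∑ j ∈ Finset.range m, ∑ i ∈ Finset.range j, chordCrossing A x i j •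
      (altSum A x alt (seg x (i + 1) (j + 1)) (j + 1) (m + i + 1) -
        altSum A x alt (seg x (j + 1) (m + i + 1)) (i + 1) (j + 1)) = 0 := by
  set X := chordCrossing A x with hX
  set Y := smoothedCrossing A x with hY
  have expand : ∀ j ∈ Finset.range m, ∀ i ∈ Finset.range j, X i j •
      (altSum A x alt (seg x (i + 1) (j + 1)) (j + 1) (m + i + 1) -
        altSum A x alt (seg x (j + 1) (m + i + 1)) (i + 1) (j + 1)) =
      ∑ l ∈ Finset.Ico (j + 1) m, ∑ k ∈ Finset.Ico (j + 1) l, (X i j * X k l) •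
        alt (seg x (i + 1) (j + 1)) (seg x (k + 1) (l + 1))
          (seg x (l + 1) (m + i + 1) ++ seg x (j + 1) (k + 1)) +
      ∑ l ∈ Finset.range i, ∑ k ∈ Finset.Ico (j + 1) m, (X i j * X k l) •
        alt (seg x (i + 1) (j + 1)) (seg x (k + 1) (m + l + 1))
          (seg x (l + 1) (i + 1) ++ seg x (j + 1) (k + 1)) +
      ∑ l ∈ Finset.range i, ∑ k ∈ Finset.range l, (X i j * X k l) •
        alt (seg x (i + 1) (j + 1)) (seg x (k + 1) (l + 1))
          (seg x (l + 1) (i + 1) ++ seg x (j + 1) (m + k + 1)) +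
      ∑ k ∈ Finset.Ico (j + 1) m, (X i j * Y k i j) •
        alt (seg x (i + 1) (j + 1)) (seg x (k + 1) (m + i + 1)) (seg x (j + 1) (k + 1)) +
      ∑ k ∈ Finset.range i, (X i j * Y k i j) •
        alt (seg x (i + 1) (j + 1)) (seg x (k + 1) (i + 1)) (seg x (j + 1) (m + k + 1)) +
      ∑ l ∈ Finset.Ico (i + 1) j, ∑ k ∈ Finset.Ico (i + 1) l, (-(X i j * X k l)) •
        alt (seg x (j + 1) (m + i + 1)) (seg x (k + 1) (l + 1))
          (seg x (l + 1) (j + 1) ++ seg x (i + 1) (k + 1)) +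
      ∑ k ∈ Finset.Ico (i + 1) j, (-(X i j * Y k j i)) •
        alt (seg x (j + 1) (m + i + 1)) (seg x (k + 1) (j + 1)) (seg x (i + 1) (k + 1)) := by
    intro j hj i hi
    rw [Finset.mem_range] at hi hj
    rw [altSum_outer A alt hx _ hj, altSum_inner A x alt _ hi]
    simp only [smul_sub, smul_add, Finset.smul_sum, mul_smul, neg_smul, Finset.sum_neg_distrib,
      ← hX, ← hY]
    abel
  rw [Finset.sum_congr rfl fun j hj => Finset.sum_congr rfl (expand j hj)]
  simp only [Finset.sum_add_distrib]
  rw [sum_quadruples_right (fun i j k l => (X i j * X k l) •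
        alt (seg x (i + 1) (j + 1)) (seg x (k + 1) (l + 1))
          (seg x (l + 1) (m + i + 1) ++ seg x (j + 1) (k + 1))),
    sum_quadruples_outer (fun l i j k => (X i j * X k l) •
        alt (seg x (i + 1) (j + 1)) (seg x (k + 1) (m + l + 1))
          (seg x (l + 1) (i + 1) ++ seg x (j + 1) (k + 1))),
    sum_quadruples_left (fun k l i j => (X i j * X k l) •
        alt (seg x (i + 1) (j + 1)) (seg x (k + 1) (l + 1))
          (seg x (l + 1) (i + 1) ++ seg x (j + 1) (m + k + 1))),
    sum_triples_right (fun i j k => (X i j * Y k i j) •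
        alt (seg x (i + 1) (j + 1)) (seg x (k + 1) (m + i + 1)) (seg x (j + 1) (k + 1))),
    sum_triples_left (fun k i j => (X i j * Y k i j) •
        alt (seg x (i + 1) (j + 1)) (seg x (k + 1) (i + 1)) (seg x (j + 1) (m + k + 1))),
    sum_quadruples_inner (fun i k l j => (-(X i j * X k l)) •
        alt (seg x (j + 1) (m + i + 1)) (seg x (k + 1) (l + 1))
          (seg x (l + 1) (j + 1) ++ seg x (i + 1) (k + 1))),
    sum_triples_mid (fun i k j => (-(X i j * Y k j i)) •
        alt (seg x (j + 1) (m + i + 1)) (seg x (k + 1) (j + 1)) (seg x (i + 1) (k + 1)))]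
  -- The four-fold sums cancel in pairs, the three triple sums cancel each other.
  have z4 : ∀ {a b c d e f g : M}, a + c = 0 → b + f = 0 → d + e + g = 0 →
      a + b + c + d + e + f + g = 0 := by
    intro a b c d e f g h1 h2 h3
    have : a + b + c + d + e + f + g = (a + c) + (b + f) + (d + e + g) := by abel
    rw [this, h1, h2, h3, add_zero, add_zero]
  apply z4
  · rw [← Finset.sum_add_distrib]
    refine Finset.sum_eq_zero ?_
    rintro ⟨p, q, r, s⟩ h
    dsimp only
    rw [h12 (seg x (r + 1) (s + 1)), hrot _ _ (seg x (q + 1) (r + 1)), mul_comm (X r s), smul_neg,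
      add_neg_cancel]
  · rw [← Finset.sum_add_distrib]
    refine Finset.sum_eq_zero ?_
    rintro ⟨p, q, r, s⟩ h
    rw [mem_quadruples] at h
    dsimp only
    rw [h12 (seg x (s + 1) (m + p + 1)), hrot _ _ (seg x (r + 1) (s + 1)), hX,
      chordCrossing_swap hlt hg (i := p) (j := s) (by omega) (by omega) (by omega), smul_neg,
      ← neg_smul, ← add_smul]
    convert zero_smul ℤ _
    ring
  · rw [← Finset.sum_add_distrib, ← Finset.sum_add_distrib]
    refine Finset.sum_eq_zero ?_
    rintro ⟨p, q, r⟩ h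
    rw [mem_triples] at h
    dsimp only
    have key := smoothedCrossing_identity hlt hg h.1 h.2.1 h.2.2
    rw [chordCrossing_swap hlt hg (i := p) (j := r) (by omega) (by omega) (by omega), ← hX, ← hY]
      at key
    rw [h23 (seg x (p + 1) (q + 1)), h12 (seg x (q + 1) (r + 1)),
      h12 (seg x (r + 1) (m + p + 1)), h23 (seg x (q + 1) (r + 1)),
      h12 (seg x (q + 1) (r + 1)), smul_neg, smul_neg, smul_neg, smul_neg, smul_neg,
      ← neg_smul, ← neg_smul, ← neg_smul, neg_neg, ← add_smul, ← add_smul]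
    convert zero_smul ℤ _
    linarith

end Jacobi

/-! ### The Lie coalgebra axioms -/

section Tensor
variable (𝕜 : Type*) [Field 𝕜] (A : Type*) [AddCommGroup A] [Module 𝕜 A]

/-- The operator `1 + ε + ε²`. -/
noncomputable def cycSum : A ⊗[𝕜] (A ⊗[𝕜] A) →ₗ[𝕜] A ⊗[𝕜] (A ⊗[𝕜] A) :=
  LinearMap.id + cyc 𝕜 A + cyc 𝕜 A ∘ₗ cyc 𝕜 A

variable {A}

theorem cycSum_tmul (x y z : A) : cycSum 𝕜 A (x ⊗ₜ[𝕜] (y ⊗ₜ[𝕜] z)) =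
    x ⊗ₜ[𝕜] (y ⊗ₜ[𝕜] z) + z ⊗ₜ[𝕜] (x ⊗ₜ[𝕜] y) + y ⊗ₜ[𝕜] (z ⊗ₜ[𝕜] x) := by
  simp [cycSum, cyc_tmul]

/-- The complete antisymmetrization of `x ⊗ y ⊗ z`. -/
noncomputable def antisymm (x y z : A) : A ⊗[𝕜] (A ⊗[𝕜] A) :=
  cycSum 𝕜 A (x ⊗ₜ[𝕜] (y ⊗ₜ[𝕜] z)) - cycSum 𝕜 A (x ⊗ₜ[𝕜] (z ⊗ₜ[𝕜] y))

theorem antisymm_swap_left (x y z : A) : antisymm 𝕜 x y z = -antisymm 𝕜 y x z := by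
  simp only [antisymm, cycSum_tmul]
  abel

theorem antisymm_swap_right (x y z : A) : antisymm 𝕜 x y z = -antisymm 𝕜 x z y := by
  simp only [antisymm, cycSum_tmul]
  abel

end Tensor

section Pieces
variable {n : ℕ} {E : Type*} {A : Alphabet n E} {x : ℕ → E} {m : ℕ} {𝕜 : Type*} [Field 𝕜]
  {κ : Type*} [LinearOrder κ] {K : E → κ}

theorem pairTerm_eq {p t p' t' : E}
    (h : crossing A.lt (A.bar p') t' (A.bar p) t = -crossing A.lt (A.bar p) t (A.bar p') t')
    (u v : List E) : A.pairTerm 𝕜 p t p' t' u v = crossing A.lt (A.bar p) t (A.bar p') t' •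
      (A.cl 𝕜 u ⊗ₜ[𝕜] A.cl 𝕜 v - A.cl 𝕜 v ⊗ₜ[𝕜] A.cl 𝕜 u) := by
  rw [Alphabet.pairTerm, h, smul_sub, neg_smul, sub_eq_add_neg]

/-- In general position the two orders of a pair of cuts contribute with opposite signs. -/
theorem cutSum_eq (hlt : ∀ p q, A.lt p q = if K p < K q then 1 else 0)
    (hx : ∀ t, x (m + t) = x t) (hg : GeneralPosition A K x m) :
    A.cutSum 𝕜 (seg x 0 m) = ∑ j ∈ Finset.range m, ∑ i ∈ Finset.range j, chordCrossing A x i j •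
      (A.cl 𝕜 (seg x (i + 1) (j + 1)) ⊗ₜ[𝕜] A.cl 𝕜 (seg x (j + 1) (m + i + 1)) -
        A.cl 𝕜 (seg x (j + 1) (m + i + 1)) ⊗ₜ[𝕜] A.cl 𝕜 (seg x (i + 1) (j + 1))) := by
  rw [A.cutSum_seg, ← Finset.range_eq_Ico]
  refine Finset.sum_congr rfl fun j hj => ?_
  rw [← Finset.range_eq_Ico]
  refine Finset.sum_congr rfl fun i hi => ?_
  rw [Finset.mem_range] at hi hj
  have e : (if j + 1 < m then x (j + 1) else x 0) = x (j + 1) := by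
    split_ifs with h
    · rfl
    · rw [← hx 0, show m + 0 = j + 1 by omega]
  have e2 : seg x (j + 1) m ++ seg x 0 (i + 1) = seg x (j + 1) (m + i + 1) := by
    rw [← seg_append x (a := j + 1) (b := m) (c := m + i + 1) (by omega) (by omega)]
    congr 1
    exact (seg_add_left x hx 0 (i + 1)).symm
  rw [e, e2, pairTerm_eq (chordCrossing_swap hlt hg (by omega) (by omega) (by omega)),
    chordCrossing]

/-- The operator `1 + ε + ε²`, applied to the second iteration of the cobracket on one piece. -/
theorem map_cutSum_seg (hlt : ∀ p q, A.lt p q = if K p < K q then 1 else 0)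
    (hg : GeneralPosition A K x m) {c b : ℕ} (hb : b ≤ c + m) (z : V 𝕜 n) :
    cycSum 𝕜 (V 𝕜 n) (z ⊗ₜ[𝕜] A.cutSum 𝕜 (seg x (c + 1) b)) =
      ∑ l ∈ Finset.Ico (c + 1) b, ∑ k ∈ Finset.Ico (c + 1) l,
        crossing A.lt (A.bar (x k)) (x (k + 1)) (A.bar (x l))
          (if l + 1 < b then x (l + 1) else x (c + 1)) •
        antisymm 𝕜 z (A.cl 𝕜 (seg x (k + 1) (l + 1)))
          (A.cl 𝕜 (seg x (l + 1) b ++ seg x (c + 1) (k + 1))) := by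
  have h0 : ∀ t, cycSum 𝕜 (V 𝕜 n) (z ⊗ₜ[𝕜] t) =
      (cycSum 𝕜 (V 𝕜 n) ∘ₗ TensorProduct.mk 𝕜 (V 𝕜 n) (V 𝕜 n ⊗[𝕜] V 𝕜 n) z) t := fun _ => rfl
  have hmod : ∀ i j, i < j → j < i + m → ¬ i ≡ j [MOD m] := fun i j h1 h2 h => by
    have := (Nat.modEq_iff_dvd' h1.le).1 h
    have := Nat.le_of_dvd (by omega) this
    omega
  rw [h0, A.cutSum_seg, map_sum]
  refine Finset.sum_congr rfl fun l hl => ?_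
  rw [map_sum]
  refine Finset.sum_congr rfl fun k hk => ?_
  rw [Finset.mem_Ico] at hk hl
  obtain ⟨d, hd, hkd⟩ : ∃ d, (if l + 1 < b then x (l + 1) else x (c + 1)) = x (d + 1) ∧
      ¬ k ≡ d [MOD m] := by
    split_ifs with h
    · exact ⟨l, rfl, hmod k l (by omega) (by omega)⟩
    · exact ⟨c, rfl, fun h => hmod c k (by omega) (by omega) h.symm⟩
  rw [hd, pairTerm_eq, map_zsmul, map_sub]
  · rfl
  · exact crossing_swap K hlt (hg.source k l (hmod k l (by omega) (by omega)))
      (hg.source_target _ _) (hg.source_target _ _).symm (hg.target k d hkd)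

end Pieces

section Axioms
variable {n : ℕ} {pos : Letter n → ℕ} {𝕜 : Type*} [Field 𝕜]

/-- The order of the ends of chords labelled by letters and integers. -/
def labelKey (pos : Letter n → ℕ) (e : Letter n × ℤ) : ℕ ×ₗ ℤ := toLex (pos e.1, e.2)

theorem labelKey_injective (hpos : Function.Injective pos) :
    Function.Injective (labelKey pos) := by
  rintro ⟨a, r⟩ ⟨b, s⟩ h
  have := Prod.ext_iff.1 (toLex.injective h)
  exact Prod.ext (hpos this.1) this.2

theorem labelledAlphabet_lt (hpos : Function.Injective pos) (p q : Letter n × ℤ) :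
    (labelledAlphabet pos).lt p q = if labelKey pos p < labelKey pos q then 1 else 0 := by
  obtain ⟨a, r⟩ := p
  obtain ⟨b, s⟩ := q
  simp only [labelledAlphabet, labelKey, Prod.Lex.toLex_lt_toLex, letterLt]
  by_cases h : a = b
  · subst h; simp
  · simp [h, hpos.eq_iff]

/-- A word labelled by its positions, as a periodic sequence in general position. -/
theorem exists_labelling (hpos : Function.Injective pos) (L : Word n) (hL : L ≠ []) :
    ∃ x : ℕ → Letter n × ℤ, (∀ t, x (L.length + t) = x t) ∧
      GeneralPosition (labelledAlphabet pos) (labelKey pos) x L.length ∧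
      (seg x 0 L.length).map Prod.fst = L ∧
      ∀ a b, b ≤ a + L.length → GoodLabels (seg x a b) := by
  obtain ⟨m, hm⟩ : ∃ m, L.length = m := ⟨_, rfl⟩
  have hp : 0 < m := hm ▸ List.length_pos_iff.2 hL
  have : NeZero m := ⟨hp.ne'⟩
  obtain ⟨y, hy⟩ := exists_circle L hm
  rw [hm]
  have hinj : ∀ i j : ℕ, ((i % m : ℕ) : ℤ) + 1 = ((j % m : ℕ) : ℤ) + 1 → i ≡ j [MOD m] := by
    intro i j h
    have : i % m = j % m := by omega
    exact this
  refine ⟨fun t => (y t, ((t % m : ℕ) : ℤ) + 1), fun t => by simp, ⟨?_, ?_, ?_⟩, ?_, ?_⟩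
  · intro i j hij h
    have := congrArg Prod.snd (labelKey_injective hpos h)
    simp only [labelledAlphabet, neg_inj] at this
    exact hij (hinj _ _ this)
  · intro i j hij h
    have := congrArg Prod.snd (labelKey_injective hpos h)
    exact hij (Nat.ModEq.add_right_cancel' 1 (hinj _ _ this))
  · intro i j h
    have := congrArg Prod.snd (labelKey_injective hpos h)
    simp only [labelledAlphabet] at this
    omega
  · rw [seg, List.map_map]
    exact (eq_seg_of_getElem? hm hy).symm
  · intro a b hab
    constructor
    · rw [seg, List.map_map]
      refine List.Nodup.map_on ?_ List.nodup_range
      intro i hi j hj h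
      rw [List.mem_range] at hi hj
      have := Nat.ModEq.add_left_cancel' a (hinj _ _ h)
      exact Nat.ModEq.eq_of_lt_of_lt this (by omega) (by omega)
    · intro e he
      rw [seg, List.mem_map] at he
      obtain ⟨t, -, rfl⟩ := he
      dsimp only
      omega

variable {O : Cycle (Letter n)}

/-- The cobracket of the class of an arbitrary word, reduced or not, is given by the sum over its
pairs of cuts. -/
theorem cobracket_cls
    (ha : ∀ L : Word n, IsReducedCyclic (L : Cycle (Letter n)) →
      cobracketSum 𝕜 O L = (letterAlphabet pos).cutSum 𝕜 L) (L : Word n) :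
    cobracket 𝕜 O (cls 𝕜 L) = (letterAlphabet pos).cutSum 𝕜 L := by
  obtain ⟨k, hk⟩ : ∃ k, L.length = k := ⟨_, rfl⟩
  induction k using Nat.strong_induction_on generalizing L with
  | _ k ih =>
  rcases eq_or_ne L [] with rfl | h0
  · rw [cls_nil, map_zero]; rfl
  by_cases h : IsReducedCyclic (L : Cycle (Letter n))
  · rw [cls_of_isReducedCyclic h, ← ha L h, vec, dif_pos h, cobracket_single]
    rfl
  · obtain ⟨u, a, r, hr⟩ := exists_rotation_cancel h0 h
    have h1 : cls 𝕜 L = cls 𝕜 u := by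
      have := cls_cancel (𝕜 := 𝕜) u [] a
      rw [List.append_nil] at this
      rw [← this, ← hr, List.rotate_eq_drop_append_take_mod, cls_append_comm,
        List.take_append_drop]
    rw [h1, ← cutSum_rotate _ L r, hr, cutSum_concat_cancel]
    refine ih u.length ?_ u rfl
    have := congrArg List.length hr
    simp at this
    omega

/-- Linear maps on `𝕍` agree if they agree on the classes of the labelled words in general
position. -/
theorem hom_ext_labelled (hpos : Function.Injective pos) {B : Type*} [AddCommMonoid B] [Module 𝕜 B]
    (φ ψ : V 𝕜 n →ₗ[𝕜] B)
    (h : ∀ (x : ℕ → Letter n × ℤ) (m : ℕ), (∀ t, x (m + t) = x t) →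
      GeneralPosition (labelledAlphabet pos) (labelKey pos) x m →
      (∀ a b, b ≤ a + m → GoodLabels (seg x a b)) →
      φ ((labelledAlphabet pos).cl 𝕜 (seg x 0 m)) =
        ψ ((labelledAlphabet pos).cl 𝕜 (seg x 0 m))) : φ = ψ := by
  refine Finsupp.lhom_ext' fun W => LinearMap.ext_ring ?_
  obtain ⟨W, hW⟩ := W
  obtain ⟨L, rfl⟩ : ∃ L : Word n, W = (L : Cycle (Letter n)) :=
    ⟨_, (Quotient.exists_rep W).choose_spec.symm⟩
  have hL : L ≠ [] := ((isReducedCyclic_iff L).1 hW).1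
  obtain ⟨x, h1, h2, h3, h4⟩ := exists_labelling hpos L hL
  have key := h x L.length h1 h2 h4
  have e : (labelledAlphabet pos).cl 𝕜 (seg x 0 L.length) = Finsupp.single ⟨_, hW⟩ 1 := by
    change cls 𝕜 ((seg x 0 L.length).map Prod.fst) = _
    rw [h3, cls_of_isReducedCyclic hW, vec, dif_pos hW]
  rw [e] at key
  exact key

theorem IsLieCoalgebra.of_comm_add {A : Type*} [AddCommGroup A] [Module 𝕜 A]
    {δ : A →ₗ[𝕜] A ⊗[𝕜] A} (h : (TensorProduct.comm 𝕜 A A).toLinearMap ∘ₗ δ + δ = 0)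
    (h' : (LinearMap.id + cyc 𝕜 A + cyc 𝕜 A ∘ₗ cyc 𝕜 A) ∘ₗ
      (TensorProduct.map LinearMap.id δ) ∘ₗ δ = 0) : IsLieCoalgebra 𝕜 δ :=
  ⟨eq_neg_of_add_eq_zero_left h, h'⟩

/-- If the cobracket of every reduced word is the sum over its pairs of cuts, it defines a Lie
coalgebra: both axioms can be checked on a curve in general position. -/
theorem isLieCoalgebra_of_eq_cutSum (hpos : Function.Injective pos)
    (ha : ∀ L : Word n, IsReducedCyclic (L : Cycle (Letter n)) →
      cobracketSum 𝕜 O L = (letterAlphabet pos).cutSum 𝕜 L) :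
    IsLieCoalgebra 𝕜 (cobracket 𝕜 O) := by
  have hlt := labelledAlphabet_lt hpos
  have hδ : ∀ (x : ℕ → Letter n × ℤ) (a b : ℕ), GoodLabels (seg x a b) →
      cobracket 𝕜 O ((labelledAlphabet pos).cl 𝕜 (seg x a b)) =
        (labelledAlphabet pos).cutSum 𝕜 (seg x a b) := fun x a b h => by
    rw [cutSum_labelled h]
    exact cobracket_cls ha _
  refine .of_comm_add (hom_ext_labelled hpos _ _ ?_) (hom_ext_labelled hpos _ _ ?_)
  · intro x m hx hg hl
    change TensorProduct.comm 𝕜 (V 𝕜 n) (V 𝕜 n) (cobracket 𝕜 O _) + cobracket 𝕜 O _ = 0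
    rw [hδ x 0 m (hl 0 m (by omega))]
    rw [cutSum_eq hlt hx hg, map_sum]
    rw [← Finset.sum_add_distrib]
    refine Finset.sum_eq_zero fun j _ => ?_
    rw [map_sum, ← Finset.sum_add_distrib]
    refine Finset.sum_eq_zero fun i _ => ?_
    rw [map_zsmul, map_sub, TensorProduct.comm_tmul, TensorProduct.comm_tmul, ← smul_add,
      sub_add_sub_cancel, sub_self, smul_zero]
  · intro x m hx hg hl
    change cycSum 𝕜 _ (TensorProduct.map LinearMap.id _ (cobracket 𝕜 O _)) = 0
    rw [hδ x 0 m (hl 0 m (by omega)), cutSum_eq hlt hx hg, map_sum, map_sum]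
    rw [← sum_altSum_eq_zero (A := labelledAlphabet pos) (x := x) (m := m)
      (fun u v w => antisymm 𝕜 ((labelledAlphabet pos).cl 𝕜 u) ((labelledAlphabet pos).cl 𝕜 v)
        ((labelledAlphabet pos).cl 𝕜 w)) hlt hx hg (fun _ _ _ => antisymm_swap_left 𝕜 _ _ _)
      (fun _ _ _ => antisymm_swap_right 𝕜 _ _ _)
      (fun _ _ w w' => by rw [Alphabet.cl_append_comm])]
    refine Finset.sum_congr rfl fun j hj => ?_
    rw [map_sum, map_sum]
    refine Finset.sum_congr rfl fun i hi => ?_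
    rw [Finset.mem_range] at hi hj
    rw [map_zsmul, map_zsmul, map_sub, map_sub, TensorProduct.map_tmul, TensorProduct.map_tmul,
      LinearMap.id_apply, LinearMap.id_apply, hδ _ _ _ (hl _ _ (by omega)),
      hδ _ _ _ (hl _ _ (by omega)), map_cutSum_seg hlt hg (by omega),
      map_cutSum_seg hlt hg (by omega)]
    rfl

end Axioms

/-! ### Orientations in terms of the linear order of a representative -/

section Orientation

variable {n : ℕ} {R : Word n}

theorem sublist_iff_pairwise_idxOf (hR : R.Nodup) (hmem : ∀ x, x ∈ R) (l : Word n) :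
    l.Sublist R ↔ l.Pairwise (fun a b => R.idxOf a < R.idxOf b) := by
  have hRp : R.Pairwise (fun a b => R.idxOf a < R.idxOf b) := by
    rw [List.pairwise_iff_getElem]
    intro i j hi hj hij
    rwa [hR.idxOf_getElem, hR.idxOf_getElem]
  refine ⟨fun h => hRp.sublist h, fun h => ?_⟩
  have hl : l.Nodup := h.imp fun {a b} hab hne => by subst hne; exact lt_irrefl _ hab
  have hp : l.Perm (R.filter (· ∈ l)) := by
    rw [List.perm_ext_iff_of_nodup hl (hR.filter _)]
    intro a
    simp [hmem a]
  have : l = R.filter (· ∈ l) :=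
    hp.eq_of_pairwise (fun a b _ _ h1 h2 => absurd h1 (lt_asymm h2)) h (hRp.filter _)
  rw [this]
  exact List.filter_sublist

/-- A cyclic word embeds in the surface symbol if one of its linear representatives meets the
letters of a fixed representative of the symbol in increasing order. -/
theorem embedsIn_iff (hR : R.Nodup) (hmem : ∀ x, x ∈ R) (l : Word n) :
    EmbedsIn (l : Cycle (Letter n)) (R : Cycle (Letter n)) ↔
      ∃ k ≤ l.length, (l.rotate k).Pairwise (fun a b => R.idxOf a < R.idxOf b) := by
  constructor
  · rintro ⟨l', R', hl, hR', hs⟩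
    obtain ⟨r, rfl⟩ := Cycle.coe_eq_coe.1 hR'.symm
    rw [List.rotate_eq_drop_append_take_mod, List.sublist_append_iff] at hs
    obtain ⟨a, b, rfl, ha, hb⟩ := hs
    have h : l ~r (b ++ a) := (Cycle.coe_eq_coe.1 hl.symm).trans List.isRotated_append
    obtain ⟨k, hk, hk'⟩ := List.isRotated_iff_mod.1 h
    refine ⟨k, hk, ?_⟩
    rw [hk', ← sublist_iff_pairwise_idxOf hR hmem,
      ← List.take_append_drop (r % R.length) R]
    exact hb.append ha
  · rintro ⟨k, -, h⟩
    exact ⟨_, R, Cycle.coe_eq_coe.2 (List.IsRotated.symm ⟨k, rfl⟩), rfl,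
      (sublist_iff_pairwise_idxOf hR hmem _).2 h⟩

theorem embedsIn_three (hR : R.Nodup) (hmem : ∀ x, x ∈ R) (a b c : Letter n) :
    EmbedsIn ([a, b, c] : Cycle (Letter n)) (R : Cycle (Letter n)) ↔
      (R.idxOf a < R.idxOf b ∧ R.idxOf b < R.idxOf c) ∨
      (R.idxOf b < R.idxOf c ∧ R.idxOf c < R.idxOf a) ∨
      (R.idxOf c < R.idxOf a ∧ R.idxOf a < R.idxOf b) := by
  rw [embedsIn_iff hR hmem]
  constructor
  · rintro ⟨k, hk, h⟩
    simp only [List.length_cons, List.length_nil] at hk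
    interval_cases k <;> simp at h <;> omega
  · rintro (h | h | h)
    · exact ⟨0, by simp, by simp; omega⟩
    · exact ⟨1, by simp, by simp; omega⟩
    · exact ⟨2, by simp, by simp; omega⟩

theorem embedsIn_four (hR : R.Nodup) (hmem : ∀ x, x ∈ R) (a b c d : Letter n) :
    EmbedsIn ([a, b, c, d] : Cycle (Letter n)) (R : Cycle (Letter n)) ↔
      (R.idxOf a < R.idxOf b ∧ R.idxOf b < R.idxOf c ∧ R.idxOf c < R.idxOf d) ∨
      (R.idxOf b < R.idxOf c ∧ R.idxOf c < R.idxOf d ∧ R.idxOf d < R.idxOf a) ∨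
      (R.idxOf c < R.idxOf d ∧ R.idxOf d < R.idxOf a ∧ R.idxOf a < R.idxOf b) ∨
      (R.idxOf d < R.idxOf a ∧ R.idxOf a < R.idxOf b ∧ R.idxOf b < R.idxOf c) := by
  rw [embedsIn_iff hR hmem]
  constructor
  · rintro ⟨k, hk, h⟩
    simp only [List.length_cons, List.length_nil] at hk
    interval_cases k <;> simp at h <;> omega
  · rintro (h | h | h | h)
    · exact ⟨0, by simp, by simp; omega⟩
    · exact ⟨1, by simp, by simp; omega⟩
    · exact ⟨2, by simp, by simp; omega⟩
    · exact ⟨3, by simp, by simp; omega⟩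

theorem idxOf_injective (hmem : ∀ x, x ∈ R) : Function.Injective (fun x : Letter n => R.idxOf x) :=
  fun x _ h => (List.idxOf_inj (hmem x)).1 h

/-- For distinct letters, the cyclic sum of the order indicator is `2` or `1`, according to the
orientation. -/
theorem orient_three (hR : R.Nodup) (hmem : ∀ x, x ∈ R) {a b c : Letter n} (hab : a ≠ b)
    (hbc : b ≠ c) (hca : c ≠ a) :
    orient (R : Cycle (Letter n)) [a, b, c] =
      2 * (letterLt (fun x => R.idxOf x) a b + letterLt (fun x => R.idxOf x) b c +
        letterLt (fun x => R.idxOf x) c a) - 3 := by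
  have h1 := (idxOf_injective hmem).ne hab
  have h2 := (idxOf_injective hmem).ne hbc
  have h3 := (idxOf_injective hmem).ne hca
  have e : ([a, b, c] : Cycle (Letter n)).reverse = ([c, b, a] : Cycle (Letter n)) := by
    rw [Cycle.reverse_coe]; rfl
  simp only [orient, e, embedsIn_three hR hmem, letterLt, if_neg hab, if_neg hbc, if_neg hca]
    at h1 h2 h3 ⊢
  split_ifs <;> omega

theorem orient_four (hR : R.Nodup) (hmem : ∀ x, x ∈ R) {s s' t t' : Letter n}
    (h : [s, s', t, t'].Nodup) :
    orient (R : Cycle (Letter n)) [s, s', t, t'] =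
      crossing (letterLt fun x => R.idxOf x) s t s' t' := by
  simp only [List.nodup_cons, List.mem_cons, List.not_mem_nil, or_false, not_or] at h
  obtain ⟨⟨h1, h2, h3⟩, ⟨h4, h5⟩, h6, -⟩ := h
  have i1 := (idxOf_injective hmem).ne h1
  have i2 := (idxOf_injective hmem).ne h2
  have i3 := (idxOf_injective hmem).ne h3
  have i4 := (idxOf_injective hmem).ne h4
  have i5 := (idxOf_injective hmem).ne h5
  have i6 := (idxOf_injective hmem).ne h6
  have e : ([s, s', t, t'] : Cycle (Letter n)).reverse =
      ([t', t, s', s] : Cycle (Letter n)) := by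
    rw [Cycle.reverse_coe]; rfl
  simp only [orient, e, embedsIn_four hR hmem, crossing, letterLt, if_neg h1, if_neg h3,
    if_neg (Ne.symm h4), if_neg h6] at i1 i2 i3 i4 i5 i6 ⊢
  rcases lt_or_gt_of_ne i1 with i1 | i1 <;> rcases lt_or_gt_of_ne i3 with i3 | i3 <;>
    rcases lt_or_gt_of_ne i4 with i4 | i4 <;> rcases lt_or_gt_of_ne i6 with i6 | i6 <;>
    simp only [i1, i3, i4, i6, i1.not_gt, i3.not_gt, i4.not_gt, i6.not_gt, if_true, if_false,
      and_true, and_false, or_false, false_or] <;>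
    (try split_ifs) <;> omega

end Orientation

/-! ### Maximal chains of a permutation -/

section Chain

variable {X M : Type*} [AddCommMonoid M] (φ : Equiv.Perm X) (T : X → Prop)

/-- A maximal chain of `k ≥ 1` consecutive points `p, φ p, …` of the set `T`. -/
def IsMaxChain (p : X) (k : ℕ) : Prop :=
  1 ≤ k ∧ (∀ t < k, T ((φ ^ t) p)) ∧ ¬ T ((φ ^ k) p) ∧ ¬ T (φ⁻¹ p)

variable {φ T}

theorem IsMaxChain.eq {p : X} {k l : ℕ} (hk : IsMaxChain φ T p k) (hl : IsMaxChain φ T p l) :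
    k = l := by
  rcases lt_trichotomy k l with h | h | h
  · exact absurd (hl.2.1 k h) hk.2.2.1
  · exact h
  · exact absurd (hk.2.1 l h) hl.2.2.1

theorem IsMaxChain.eq_of_end {q : X} {k l : ℕ} (hk : IsMaxChain φ T ((φ ^ k)⁻¹ q) k)
    (hl : IsMaxChain φ T ((φ ^ l)⁻¹ q) l) : k = l := by
  have key : ∀ k l : ℕ, k < l → IsMaxChain φ T ((φ ^ k)⁻¹ q) k →
      ¬ IsMaxChain φ T ((φ ^ l)⁻¹ q) l := by
    intro k l h hk hl
    have := hl.2.1 (l - (k + 1)) (by omega)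
    rw [← Equiv.Perm.mul_apply] at this
    refine hk.2.2.2 ?_
    rw [← Equiv.Perm.mul_apply]
    have e : φ⁻¹ * (φ ^ k)⁻¹ = φ ^ (l - (k + 1)) * (φ ^ l)⁻¹ := by
      obtain ⟨d, rfl⟩ := Nat.exists_eq_add_of_lt h
      rw [show k + d + 1 - (k + 1) = d by omega, show k + d + 1 = d + (k + 1) by omega, pow_add φ d,
        mul_inv_rev, pow_succ, mul_inv_rev]
      have := (Commute.refl φ).pow_pow d k
      have h2 := (Commute.refl φ).pow_right d
      have e1 : Commute (φ ^ d) ((φ ^ k)⁻¹) := this.inv_right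
      have e2 : Commute (φ ^ d) φ⁻¹ := h2.symm.inv_right
      rw [← mul_assoc, ← mul_assoc, e2.eq, mul_assoc φ⁻¹, e1.eq, mul_assoc, mul_assoc,
        mul_inv_cancel, mul_one]
    rwa [e]
  rcases lt_trichotomy k l with h | h | h
  · exact absurd hl (key k l h hk)
  · exact h
  · exact absurd hk (key l k h hl)

theorem exists_isMaxChain {B : ℕ}
    (hB : ∀ p, T p → ¬ T (φ⁻¹ p) → ∃ k < B, ¬ T ((φ ^ k) p)) {p : X} (h : T p)
    (h' : ¬ T (φ⁻¹ p)) : ∃ k < B, IsMaxChain φ T p k := by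
  classical
  have hex : ∃ k, ¬ T ((φ ^ k) p) := (hB p h h').imp fun _ hk => hk.2
  obtain ⟨k, hk, hk'⟩ := hB p h h'
  refine ⟨Nat.find hex, (Nat.find_min' hex hk').trans_lt hk, ?_, fun t ht => ?_,
    Nat.find_spec hex, h'⟩
  · rw [Nat.one_le_iff_ne_zero]
    intro h0
    have := Nat.find_spec hex
    rw [h0] at this
    exact this h
  · exact not_not.1 (Nat.find_min hex ht)

theorem exists_isMaxChain_end [Finite X] {B : ℕ}
    (hB : ∀ p, T p → ¬ T (φ⁻¹ p) → ∃ k < B, ¬ T ((φ ^ k) p)) {q : X} (h : ¬ T q)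
    (h' : T (φ⁻¹ q)) : ∃ k < B, IsMaxChain φ T ((φ ^ k)⁻¹ q) k := by
  classical
  -- Going backwards, the chain breaks off, since `φ` has finite order and `q` is not in `T`.
  have hex : ∃ k, ¬ T ((φ ^ (k + 1))⁻¹ q) := by
    refine ⟨orderOf φ - 1, ?_⟩
    rw [Nat.sub_add_cancel (orderOf_pos φ), pow_orderOf_eq_one]
    exact h
  set k := Nat.find hex with hk
  have hs : ¬ T ((φ ^ (k + 1))⁻¹ q) := Nat.find_spec hex
  have hm : ∀ t, t < k → T ((φ ^ (t + 1))⁻¹ q) := fun t ht => not_not.1 (Nat.find_min hex ht)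
  have hk1 : 1 ≤ k := by
    rw [Nat.one_le_iff_ne_zero]
    intro h0
    rw [h0] at hs
    exact hs (by simpa using h')
  have e : ∀ t K : ℕ, t ≤ K → (φ ^ t) ((φ ^ K)⁻¹ q) = (φ ^ (K - t))⁻¹ q := by
    intro t K ht
    obtain ⟨d, rfl⟩ := Nat.exists_eq_add_of_le ht
    rw [show t + d - t = d by omega, Nat.add_comm, pow_add, mul_inv_rev, ← Equiv.Perm.mul_apply,
      mul_inv_cancel_left]
  have hchain : IsMaxChain φ T ((φ ^ k)⁻¹ q) k := by
    refine ⟨hk1, fun t ht => ?_, ?_, ?_⟩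
    · rw [e t k ht.le]
      have := hm (k - t - 1) (by omega)
      rwa [show k - t - 1 + 1 = k - t by omega] at this
    · rw [e k k le_rfl]
      simpa using h
    · rwa [← Equiv.Perm.mul_apply, ← mul_inv_rev, ← pow_succ]
  obtain ⟨l, hl, hl'⟩ := exists_isMaxChain hB (by simpa using hchain.2.1 0 hk1) hchain.2.2.2
  rw [hl'.eq hchain] at hl
  exact ⟨k, hl, hchain⟩

open Classical in
theorem sum_ite_eq_of_unique {B : ℕ} {P : Prop} [Decidable P] {Q : ℕ → Prop} (c : M)
    (h : P → ∃ k < B, Q k) (hQ : ∀ k, Q k → P) (hu : ∀ k l, Q k → Q l → k = l) :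
    (if P then c else 0) = ∑ k ∈ Finset.range B, if Q k then c else 0 := by
  split_ifs with hP
  · obtain ⟨k, hk, hk'⟩ := h hP
    rw [Finset.sum_eq_single_of_mem k (Finset.mem_range.2 hk)
      (fun l _ hl => if_neg fun h' => hl (hu _ _ h' hk')), if_pos hk']
  · exact (Finset.sum_eq_zero fun k _ => if_neg fun h' => hP (hQ k h')).symm

open Classical in
/-- A sum over the points where the set `T` is entered is a sum over the maximal chains in `T`. -/
theorem sum_chain_start [Fintype X] {B : ℕ}
    (hB : ∀ p, T p → ¬ T (φ⁻¹ p) → ∃ k < B, ¬ T ((φ ^ k) p)) (F : X → M) :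
    ∑ p, (if T p ∧ ¬ T (φ⁻¹ p) then F p else 0) =
      ∑ p, ∑ k ∈ Finset.range B, if IsMaxChain φ T p k then F p else 0 := by
  refine Fintype.sum_congr _ _ fun p => sum_ite_eq_of_unique _ ?_ ?_ fun k l => IsMaxChain.eq
  · exact fun h => exists_isMaxChain hB h.1 h.2
  · exact fun k h => ⟨by simpa using h.2.1 0 h.1, h.2.2.2⟩

open Classical in
/-- A sum over the points where the set `T` is left is a sum over the maximal chains in `T`. -/
theorem sum_chain_end [Fintype X] {B : ℕ}
    (hB : ∀ p, T p → ¬ T (φ⁻¹ p) → ∃ k < B, ¬ T ((φ ^ k) p)) (F : X → M) :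
    ∑ q, (if ¬ T q ∧ T (φ⁻¹ q) then F q else 0) =
      ∑ p, ∑ k ∈ Finset.range B, if IsMaxChain φ T p k then F ((φ ^ k) p) else 0 := by
  rw [Finset.sum_comm]
  have : ∀ k : ℕ, ∑ p, (if IsMaxChain φ T p k then F ((φ ^ k) p) else 0) =
      ∑ q, if IsMaxChain φ T ((φ ^ k)⁻¹ q) k then F q else 0 := by
    intro k
    rw [← Equiv.sum_comp (φ ^ k) fun q => if IsMaxChain φ T ((φ ^ k)⁻¹ q) k then F q else 0]
    simp
  simp only [this]
  rw [Finset.sum_comm]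
  refine Fintype.sum_congr _ _ fun q => sum_ite_eq_of_unique _ ?_ ?_ fun k l => IsMaxChain.eq_of_end
  · exact fun h => exists_isMaxChain_end hB h.1 h.2
  · intro k h
    refine ⟨by simpa using h.2.2.1, ?_⟩
    have h1 := h.1
    have := h.2.1 (k - 1) (by omega)
    rw [← Equiv.Perm.mul_apply] at this
    have e : φ ^ (k - 1) * (φ ^ k)⁻¹ = φ⁻¹ := by
      obtain ⟨d, rfl⟩ := Nat.exists_eq_add_of_le' h1
      rw [Nat.add_sub_cancel, pow_succ', mul_inv_rev, mul_inv_cancel_left]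
    rwa [e] at this

end Chain

/-! ### Ties between the ends of two chords -/

section Ties

variable {n : ℕ} {R : Word n}

theorem letterLt_add_letterLt {pos : Letter n → ℕ} (hpos : Function.Injective pos) {a b : Letter n}
    (h : a ≠ b) : letterLt pos a b + letterLt pos b a = 1 := by
  have := hpos.ne h
  simp only [letterLt, if_neg h, if_neg h.symm]
  split_ifs <;> omega

/-- The intersection number of two chords with possible ties among their ends, in terms of
orientations. The first summand belongs to chords without ties, the next four to chords with exactly
one tie, and the last four collect values at ties. -/
theorem crossing_letterLt (hR : R.Nodup) (hmem : ∀ x, x ∈ R) {s t s' t' : Letter n} (h : s ≠ t)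
    (h' : s' ≠ t') :
    crossing (letterLt fun x => R.idxOf x) s t s' t' =
      orient (R : Cycle (Letter n)) [s, s', t, t'] +
      (if t = t' ∧ s ≠ s' then (orient (R : Cycle (Letter n)) [s, s', t] - 1) / 2 else 0) +
      (if t ≠ t' ∧ s = s' then (orient (R : Cycle (Letter n)) [t, t', s] + 1) / 2 else 0) +
      (if t = s' ∧ s ≠ t' then (orient (R : Cycle (Letter n)) [t', s, t] + 1) / 2 else 0) +
      (if t ≠ s' ∧ s = t' then (orient (R : Cycle (Letter n)) [s', t, s] - 1) / 2 else 0) +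
      ((if t = t' then letterLt (fun x => R.idxOf x) t t else 0) -
      (if s = s' then 1 - letterLt (fun x => R.idxOf x) s s else 0) -
      (if t = s' then letterLt (fun x => R.idxOf x) t t else 0) +
      (if s = t' then 1 - letterLt (fun x => R.idxOf x) s s else 0)) := by
  have hO : IsSurfaceSymbol (R : Cycle (Letter n)) := ⟨Cycle.nodup_coe_iff.2 hR, fun x => hmem x⟩
  have key : ∀ {a b : Letter n}, a ≠ b → letterLt (fun x => R.idxOf x) a b +
      letterLt (fun x => R.idxOf x) b a = 1 := letterLt_add_letterLt (idxOf_injective hmem)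
  have h4 : ¬ [s, s', t, t'].Nodup → orient (R : Cycle (Letter n)) [s, s', t, t'] = 0 := fun hn =>
    by_contra fun hne => hn (nodup_of_orient_ne_zero hO hne)
  have kst := key h
  by_cases e1 : t = t'
  · subst e1
    have e3 : t ≠ s' := h'.symm
    rw [h4 (by simp)]
    by_cases e2 : s = s'
    · subst e2
      simp only [crossing, h, e3, ne_eq, not_true_eq_false, and_false, false_and, if_true, if_false]
      linarith
    · simp only [crossing, h, e2, e3, ne_eq, not_true_eq_false, not_false_eq_true, and_false,
        and_true, and_self, if_true, if_false,
        orient_three hR hmem e2 h' h.symm]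
      have := key h'
      omega
  · by_cases e2 : s = s'
    · subst e2
      rw [h4 (by simp)]
      simp only [crossing, e1, h', h.symm, ne_eq, not_true_eq_false, not_false_eq_true, and_false,
        and_true, and_self, if_true, if_false,
        orient_three hR hmem e1 h'.symm h]
      have := key h'
      omega
    · by_cases e3 : t = s'
      · subst e3
        rw [h4 (by simp)]
        by_cases e4 : s = t'
        · subst e4
          simp only [crossing, e1, h, ne_eq, not_true_eq_false, not_false_eq_true, and_false,
            and_true, if_true, if_false]
          omega
        · simp only [crossing, e1, h, e4, ne_eq, not_true_eq_false, not_false_eq_true, and_false,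
            and_true, and_self, if_true, if_false,
            orient_three hR hmem (Ne.symm e4) h h']
          have := key e4
          omega
      · by_cases e4 : s = t'
        · subst e4
          rw [h4 (by simp)]
          simp only [crossing, e1, e2, e3, ne_eq, not_true_eq_false, not_false_eq_true, and_false,
            and_true, and_self, if_true, if_false,
            orient_three hR hmem (Ne.symm e3) h.symm (Ne.symm h')]
          have := key e2
          have := key e3
          omega
        · rw [orient_four hR hmem (by simp [*, Ne.symm e3])]
          simp [e1, e2, e3, e4]

variable {m : ℕ} [NeZero m]

theorem sum_smul_shift {M : Type*} [AddCommGroup M] (P : ZMod m → ZMod m → M)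
    (g : ZMod m → ZMod m → ℤ) (c d : ZMod m)
    (h : ∀ i j, g (i + c) (j + d) ≠ 0 → P (i + c) (j + d) = P i j) :
    ∑ i, ∑ j, g (i + c) (j + d) • P i j = ∑ i, ∑ j, g i j • P i j := by
  rw [← sum_shift (fun i j => g i j • P i j) c d]
  refine Fintype.sum_congr _ _ fun i => Fintype.sum_congr _ _ fun j => ?_
  by_cases h0 : g (i + c) (j + d) = 0
  · simp only [h0, zero_smul]
  · simp only [h i j h0]

/-- The values on ties contribute nothing, as every tie occurs at both ends of a common side. -/
theorem sum_ties_smul_eq_zero {M : Type*} [AddCommGroup M] (x : ZMod m → Letter n)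
    (κ : Letter n → ℤ) (P : ZMod m → ZMod m → M)
    (hP1 : ∀ i j, x (i + 1) = x (j + 1) → P (i + 1) (j + 1) = P i j)
    (hP2 : ∀ i j, x (i + 1) = (x j).bar → P (i + 1) (j - 1) = P i j) :
    ∑ i, ∑ j, ((if x (i + 1) = x (j + 1) then κ (x (i + 1)) else 0) -
      (if x i = x j then κ (x i) else 0) -
      (if x (i + 1) = (x j).bar then κ (x (i + 1)) else 0) +
      (if x i = (x (j + 1)).bar then κ (x i) else 0)) • P i j = 0 := by
  have e1 := sum_smul_shift P (fun i j => if x i = x j then κ (x i) else 0) 1 1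
    fun i j h => hP1 i j (by by_contra h'; exact h (if_neg h'))
  have e2 := sum_smul_shift P (fun i j => if x i = (x (j + 1)).bar then κ (x i) else 0) 1 (-1)
    fun i j h => by
      rw [← sub_eq_add_neg j]
      exact hP2 i j (by by_contra h'; refine h (if_neg ?_); rwa [neg_add_cancel_right])
  simp only [neg_add_cancel_right] at e2
  simp only [add_smul, sub_smul, Finset.sum_add_distrib, Finset.sum_sub_distrib, e1, e2]
  abel

end Ties

/-! ### Chains of ties on the circle -/

section CircleChains

variable {n m : ℕ}

/-- Moving both cuts forward. -/
def shiftSame (m : ℕ) : Equiv.Perm (ZMod m × ZMod m) :=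
  (Equiv.addRight 1).prodCongr (Equiv.addRight 1)

/-- Moving the first cut forward and the second one backward. -/
def shiftOpposite (m : ℕ) : Equiv.Perm (ZMod m × ZMod m) :=
  (Equiv.addRight 1).prodCongr (Equiv.subRight 1)

theorem shiftSame_pow (p : ZMod m × ZMod m) (k : ℕ) :
    (shiftSame m ^ k) p = (p.1 + k, p.2 + k) := by
  induction k with
  | zero => simp
  | succ k ih =>
    rw [pow_succ', Equiv.Perm.mul_apply, ih]
    simp [shiftSame, add_assoc]

theorem shiftOpposite_pow (p : ZMod m × ZMod m) (k : ℕ) :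
    (shiftOpposite m ^ k) p = (p.1 + k, p.2 - k) := by
  induction k with
  | zero => simp
  | succ k ih =>
    rw [pow_succ', Equiv.Perm.mul_apply, ih]
    simp [shiftOpposite, add_assoc, sub_sub]

theorem shiftSame_inv (p : ZMod m × ZMod m) : (shiftSame m)⁻¹ p = (p.1 - 1, p.2 - 1) := by
  rw [Equiv.Perm.inv_eq_iff_eq]
  simp [shiftSame]

theorem shiftOpposite_inv (p : ZMod m × ZMod m) :
    (shiftOpposite m)⁻¹ p = (p.1 - 1, p.2 + 1) := by
  rw [Equiv.Perm.inv_eq_iff_eq]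
  simp [shiftOpposite]

variable (x : ZMod m → Letter n)

/-- The letters after the two cuts agree. -/
def TieSame (p : ZMod m × ZMod m) : Prop := x (p.1 + 1) = x (p.2 + 1)

/-- The letter after the first cut is inverse to the letter before the second one. -/
def TieOpposite (p : ZMod m × ZMod m) : Prop := x (p.1 + 1) = (x p.2).bar

theorem isMaxChain_same {p : ZMod m × ZMod m} {k : ℕ} :
    IsMaxChain (shiftSame m) (TieSame x) p k ↔
      1 ≤ k ∧ (∀ t < k, x (p.1 + t + 1) = x (p.2 + t + 1)) ∧
        x (p.1 + k + 1) ≠ x (p.2 + k + 1) ∧ x p.1 ≠ x p.2 := by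
  simp [IsMaxChain, TieSame, shiftSame_pow, shiftSame_inv]

theorem isMaxChain_opposite {p : ZMod m × ZMod m} {k : ℕ} :
    IsMaxChain (shiftOpposite m) (TieOpposite x) p k ↔
      1 ≤ k ∧ (∀ t < k, x (p.1 + t + 1) = (x (p.2 - t)).bar) ∧
        x (p.1 + k + 1) ≠ (x (p.2 - k)).bar ∧ x p.1 ≠ (x (p.2 + 1)).bar := by
  simp [IsMaxChain, TieOpposite, shiftOpposite_pow, shiftOpposite_inv]

theorem tieOpposite_ne {x : ZMod m → Letter n} (hred : ∀ i, x (i + 1) ≠ (x i).bar)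
    {p : ZMod m × ZMod m} (h : TieOpposite x p) : p.1 ≠ p.2 := by
  intro e
  rw [TieOpposite, e] at h
  exact hred _ h

variable {x}

/-- If all but one of the letters agreed with their translates, all of them would, because the
number of occurrences of a letter is invariant under translation. -/
theorem exists_not_tieSame [NeZero m] (p : ZMod m × ZMod m)
    (h' : ¬ TieSame x ((shiftSame m)⁻¹ p)) : ∃ k < m - 1, ¬ TieSame x ((shiftSame m ^ k) p) := by
  classical
  obtain ⟨i, j⟩ := p
  simp only [TieSame, shiftSame_pow, shiftSame_inv, sub_add_cancel] at h' ⊢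
  by_contra! hc
  have key : ∀ u, u ≠ i → x u = x (u + (j - i)) := by
    intro u hu
    have hv : u - i ≠ 0 := sub_ne_zero.2 hu
    have h1 : (u - i).val ≠ 0 := by rwa [Ne, ZMod.val_eq_zero]
    have h2 := ZMod.val_lt (u - i)
    have := hc ((u - i).val - 1) (by omega)
    have e : (((u - i).val - 1 : ℕ) : ZMod m) = u - i - 1 := by
      rw [Nat.cast_sub (by omega), ZMod.natCast_zmod_val, Nat.cast_one]
    rw [e] at this
    convert this using 2 <;> ring
  have hs := Equiv.sum_comp (Equiv.addRight (j - i)) fun u => if x u = x i then (1 : ℤ) else 0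
  rw [← Finset.add_sum_erase _ _ (Finset.mem_univ i),
    ← Finset.add_sum_erase (Finset.univ : Finset (ZMod m))
      (fun u => if x u = x i then (1 : ℤ) else 0) (Finset.mem_univ i),
    Finset.sum_congr rfl fun u hu => by
      rw [Equiv.coe_addRight, ← key u (Finset.ne_of_mem_erase hu)]] at hs
  rw [add_left_inj, Equiv.coe_addRight] at hs
  simp only [add_sub_cancel, if_true] at hs
  split_ifs at hs with h
  · exact h' h.symm
  · exact zero_ne_one hs

theorem exists_not_tieOpposite [NeZero m] (hred : ∀ i, x (i + 1) ≠ (x i).bar) (p : ZMod m × ZMod m)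
    (h : TieOpposite x p) : ∃ k < m - 1, ¬ TieOpposite x ((shiftOpposite m ^ k) p) := by
  obtain ⟨i, j⟩ := p
  obtain ⟨g, hg, hj⟩ : ∃ g < m, j = i + (g : ℕ) :=
    ⟨(j - i).val, ZMod.val_lt _, by rw [ZMod.natCast_zmod_val]; ring⟩
  -- Going inwards from both sides, the two positions meet in the middle.
  have key : ¬ TieOpposite x ((shiftOpposite m ^ (g / 2)) (i, j)) := by
    rw [shiftOpposite_pow, TieOpposite]
    intro h
    dsimp only at h
    rcases Nat.even_or_odd' g with ⟨c, rfl | rfl⟩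
    · rw [show 2 * c / 2 = c by omega, show j - (c : ZMod m) = i + c by
        rw [hj]; push_cast; ring] at h
      exact hred _ h
    · rw [show (2 * c + 1) / 2 = c by omega, show j - (c : ZMod m) = i + c + 1 by
        rw [hj]; push_cast; ring] at h
      exact Letter.bar_ne _ h.symm
  have hne : g / 2 ≠ 0 := by
    intro h0
    rw [h0] at key
    exact key (by simpa using h)
  exact ⟨g / 2, by omega, key⟩

theorem apply_shiftSame_pow {x : ZMod m → Letter n} {α : Type*} {F : ZMod m → ZMod m → α}
    (hF : ∀ i j, x (i + 1) = x (j + 1) → F (i + 1) (j + 1) = F i j) {p : ZMod m × ZMod m} {k : ℕ}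
    (h : ∀ t < k, x (p.1 + t + 1) = x (p.2 + t + 1)) : F (p.1 + k) (p.2 + k) = F p.1 p.2 := by
  induction k with
  | zero => simp
  | succ k ih =>
    rw [← ih fun t ht => h t (by omega), ← hF _ _ (h k (by omega))]
    push_cast
    simp only [add_assoc]

theorem apply_shiftOpposite_pow {x : ZMod m → Letter n} {α : Type*} {F : ZMod m → ZMod m → α}
    (hF : ∀ i j, x (i + 1) = (x j).bar → F (i + 1) (j - 1) = F i j) {p : ZMod m × ZMod m} {k : ℕ}
    (h : ∀ t < k, x (p.1 + t + 1) = (x (p.2 - t)).bar) : F (p.1 + k) (p.2 - k) = F p.1 p.2 := by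
  induction k with
  | zero => simp
  | succ k ih =>
    rw [← ih fun t ht => h t (by omega), ← hF _ _ (h k (by omega))]
    push_cast
    simp only [add_assoc, sub_sub]

end CircleChains

/-! ### The sum over pairs of cuts of a reduced word -/

section CutSum

variable {n m : ℕ} [NeZero m] {R : Word n} {x : ZMod m → Letter n}

theorem orient_mem (O : Cycle (Letter n)) (L : Word n) :
    orient O L = 1 ∨ orient O L = -1 ∨ orient O L = 0 := by
  unfold orient
  split_ifs <;> simp

theorem orient_three_eq (hR : R.Nodup) (hmem : ∀ x, x ∈ R) {a b c : Letter n} (hab : a ≠ b)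
    (hbc : b ≠ c) (hca : c ≠ a) :
    orient (R : Cycle (Letter n)) [a, b, c] = 1 ∨ orient (R : Cycle (Letter n)) [a, b, c] = -1 := by
  have h1 := orient_mem (R : Cycle (Letter n)) [a, b, c]
  have h2 := orient_three hR hmem hab hbc hca
  omega

open Classical in
/-- The sum over pairs of cuts of a reduced cyclic word, in terms of orientations: pairs of cuts
without ties, and maximal common subwords of the word with itself or with its inverse. -/
theorem sum_cutCrossing_eq (hR : R.Nodup) (hmem : ∀ x, x ∈ R)
    (hred : ∀ i, x (i + 1) ≠ (x i).bar) {M : Type*} [AddCommGroup M] (P : ZMod m → ZMod m → M)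
    (hP1 : ∀ i j, x (i + 1) = x (j + 1) → P (i + 1) (j + 1) = P i j)
    (hP2 : ∀ i j, x (i + 1) = (x j).bar → P (i + 1) (j - 1) = P i j) :
    ∑ i, ∑ j, cutCrossing x (letterAlphabet fun a => R.idxOf a) i j • P i j =
      ∑ p : ZMod m × ZMod m, orient (R : Cycle (Letter n))
        [(x p.1).bar, (x p.2).bar, x (p.1 + 1), x (p.2 + 1)] • P p.1 p.2 +
      ∑ p : ZMod m × ZMod m, ∑ k ∈ Finset.range (m - 1),
        (if IsMaxChain (shiftSame m) (TieSame x) p k ∧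
            orient (R : Cycle (Letter n)) [(x p.1).bar, (x p.2).bar, x (p.1 + 1)] =
            orient (R : Cycle (Letter n)) [x (p.1 + k + 1), x (p.2 + k + 1), (x (p.1 + k)).bar]
          then orient (R : Cycle (Letter n)) [(x p.1).bar, (x p.2).bar, x (p.1 + 1)] • P p.1 p.2
          else 0) +
      ∑ p : ZMod m × ZMod m, ∑ k ∈ Finset.range (m - 1),
        (if IsMaxChain (shiftOpposite m) (TieOpposite x) p k ∧
            orient (R : Cycle (Letter n)) [x (p.2 + 1), (x p.1).bar, x (p.1 + 1)] =
            orient (R : Cycle (Letter n)) [(x (p.2 - k)).bar, x (p.1 + k + 1), (x (p.1 + k)).bar]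
          then orient (R : Cycle (Letter n)) [x (p.2 + 1), (x p.1).bar, x (p.1 + 1)] • P p.1 p.2
          else 0) := by
  have hred' : ∀ i, (x i).bar ≠ x (i + 1) := fun i => (hred i).symm
  set o : Word n → ℤ := orient (R : Cycle (Letter n)) with ho
  have ho3 : ∀ {a b c : Letter n}, a ≠ b → b ≠ c → c ≠ a → o [a, b, c] = 1 ∨ o [a, b, c] = -1 :=
    fun h1 h2 h3 => orient_three_eq hR hmem h1 h2 h3
  have hz := sum_ties_smul_eq_zero x (fun a => letterLt (fun a => R.idxOf a) a a) P hP1 hP2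
  rw [← Fintype.sum_prod_type'] at hz ⊢
  have hpt : ∀ p : ZMod m × ZMod m, cutCrossing x (letterAlphabet fun a => R.idxOf a) p.1 p.2 =
      o [(x p.1).bar, (x p.2).bar, x (p.1 + 1), x (p.2 + 1)] +
      (if TieSame x p ∧ ¬ TieSame x ((shiftSame m)⁻¹ p) then
        (o [(x p.1).bar, (x p.2).bar, x (p.1 + 1)] - 1) / 2 else 0) +
      (if ¬ TieSame x p ∧ TieSame x ((shiftSame m)⁻¹ p) then
        (o [x (p.1 + 1), x (p.2 + 1), (x p.1).bar] + 1) / 2 else 0) +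
      (if TieOpposite x p ∧ ¬ TieOpposite x ((shiftOpposite m)⁻¹ p) then
        (o [x (p.2 + 1), (x p.1).bar, x (p.1 + 1)] + 1) / 2 else 0) +
      (if ¬ TieOpposite x p ∧ TieOpposite x ((shiftOpposite m)⁻¹ p) then
        (o [(x p.2).bar, x (p.1 + 1), (x p.1).bar] - 1) / 2 else 0) +
      ((if x (p.1 + 1) = x (p.2 + 1) then letterLt (fun a => R.idxOf a) (x (p.1 + 1)) (x (p.1 + 1))
          else 0) -
        (if x p.1 = x p.2 then letterLt (fun a => R.idxOf a) (x p.1) (x p.1) else 0) -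
        (if x (p.1 + 1) = (x p.2).bar then
          letterLt (fun a => R.idxOf a) (x (p.1 + 1)) (x (p.1 + 1)) else 0) +
        (if x p.1 = (x (p.2 + 1)).bar then letterLt (fun a => R.idxOf a) (x p.1) (x p.1)
          else 0)) := by
    intro p
    have h1 : 1 - letterLt (fun a => R.idxOf a) (x p.1).bar (x p.1).bar =
        letterLt (fun a => R.idxOf a) (x p.1) (x p.1) := by
      have := letterLt_self_add (fun a : Letter n => R.idxOf a) (x p.1)
      omega
    refine (crossing_letterLt hR hmem (hred' p.1) (hred' p.2)).trans ?_
    simp only [h1, ne_eq, Letter.bar_inj, TieSame, TieOpposite, shiftSame_inv, shiftOpposite_inv,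
      sub_add_cancel, Letter.bar_eq_iff (x := x p.1) (y := x (p.2 + 1)), ho]
  have hsplit : ∀ (u a b c d e : ZMod m × ZMod m → ℤ), ∑ p, (u p + a p + b p + c p + d p + e p) •
      P p.1 p.2 = ∑ p, u p • P p.1 p.2 + (∑ p, a p • P p.1 p.2 + ∑ p, b p • P p.1 p.2) +
      (∑ p, c p • P p.1 p.2 + ∑ p, d p • P p.1 p.2) + ∑ p, e p • P p.1 p.2 := by
    intro u a b c d e
    simp only [add_smul, Finset.sum_add_distrib]
    abel
  simp only [hpt, hsplit, hz, add_zero, ite_smul, zero_smul]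
  rw [sum_chain_start (fun p _ => exists_not_tieSame p),
    sum_chain_end (fun p _ => exists_not_tieSame p),
    sum_chain_start (fun p h _ => exists_not_tieOpposite hred p h),
    sum_chain_end (fun p h _ => exists_not_tieOpposite hred p h)]
  have hsame := fun p k => apply_shiftSame_pow (k := k) (p := p) hP1
  have hopp := fun p k => apply_shiftOpposite_pow (k := k) (p := p) hP2
  -- The two ends of a chain together contribute the mean value of the two orientations.
  have hcomb : ∀ {a b : ℤ} (y : M), (a = 1 ∨ a = -1) → (b = 1 ∨ b = -1) →
      ((a - 1) / 2) • y + ((b + 1) / 2) • y = if a = b then a • y else 0 := by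
    rintro a b y (rfl | rfl) (rfl | rfl) <;> simp
  have hcomb' : ∀ {a b : ℤ} (y : M), (a = 1 ∨ a = -1) → (b = 1 ∨ b = -1) →
      ((a + 1) / 2) • y + ((b - 1) / 2) • y = if a = b then a • y else 0 := by
    rintro a b y (rfl | rfl) (rfl | rfl) <;> simp
  congr 1
  · congr 1
    rw [← Finset.sum_add_distrib]
    refine Fintype.sum_congr _ _ fun p => ?_
    rw [← Finset.sum_add_distrib]
    refine Finset.sum_congr rfl fun k _ => ?_
    by_cases h : IsMaxChain (shiftSame m) (TieSame x) p k
    · obtain ⟨h1, h2, h3, h4⟩ := (isMaxChain_same x).1 h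
      obtain ⟨l, rfl⟩ := Nat.exists_eq_add_of_le' h1
      have h20 := h2 0 (by omega)
      have h2l := h2 l (by omega)
      rw [Nat.cast_zero, add_zero, add_zero] at h20
      simp only [h, true_and, if_true, shiftSame_pow, hsame p _ h2]
      push_cast at h3 ⊢
      simp only [← add_assoc] at h3 ⊢
      refine hcomb _ (ho3 (Letter.bar_inj.not.2 h4) ?_ ?_) (ho3 h3 ?_ ?_)
      · rw [h20]; exact hred' _
      · exact hred _
      · rw [h2l]; exact hred _
      · exact hred' _
    · rw [if_neg h, if_neg h, if_neg fun h' => h h'.1, add_zero]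
  · rw [← Finset.sum_add_distrib]
    refine Fintype.sum_congr _ _ fun p => ?_
    rw [← Finset.sum_add_distrib]
    refine Finset.sum_congr rfl fun k _ => ?_
    by_cases h : IsMaxChain (shiftOpposite m) (TieOpposite x) p k
    · obtain ⟨h1, h2, h3, h4⟩ := (isMaxChain_opposite x).1 h
      obtain ⟨l, rfl⟩ := Nat.exists_eq_add_of_le' h1
      have h20 := h2 0 (by omega)
      have h2l := h2 l (by omega)
      rw [Nat.cast_zero, add_zero, sub_zero] at h20
      simp only [h, true_and, if_true, shiftOpposite_pow, hopp p _ h2]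
      push_cast at h3 ⊢
      simp only [← add_assoc, ← sub_sub] at h3 ⊢
      refine hcomb' _ (ho3 ?_ (hred' _) ?_) (ho3 ?_ (hred _) ?_)
      · intro e
        exact h4 (by rw [e, Letter.bar_bar])
      · rw [h20]; exact hred' _
      · exact h3.symm
      · rw [h2l, Letter.bar_bar]
        have := hred (p.2 - l - 1)
        rwa [sub_add_cancel] at this
    · rw [if_neg h, if_neg h, if_neg fun h' => h h'.1, add_zero]

end CutSum

/-! ### Linked pairs of words -/

section LinkedWords

variable {n : ℕ} {O : Cycle (Letter n)} {p₁ p₂ q₁ q₂ : Letter n} {Y Z : Word n}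

theorem cons_append_singleton_inj {α : Type*} {a b a' b' : α} {l l' : List α} :
    a :: (l ++ [b]) = a' :: (l' ++ [b']) ↔ a = a' ∧ l = l' ∧ b = b' := by
  rw [List.cons.injEq]
  refine and_congr_right fun _ => ⟨fun h => ?_, fun h => by rw [h.1, h.2]⟩
  obtain ⟨h1, h2⟩ := List.append_inj' h rfl
  exact ⟨h1, List.singleton_inj.1 h2⟩

theorem linkedOne_iff : LinkedOne O (p₁ :: (Y ++ [p₂])) (q₁ :: (Z ++ [q₂])) ↔
    Y = [] ∧ Z = [] ∧ orient O [p₁.bar, q₁.bar, p₂, q₂] ≠ 0 := by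
  constructor
  · rintro ⟨a₁, a₂, b₁, b₂, hP, hQ, h⟩
    obtain ⟨rfl, rfl, rfl⟩ := cons_append_singleton_inj.1 (hP.trans (rfl : _ = a₁ :: ([] ++ [a₂])))
    obtain ⟨rfl, rfl, rfl⟩ := cons_append_singleton_inj.1 (hQ.trans (rfl : _ = b₁ :: ([] ++ [b₂])))
    exact ⟨rfl, rfl, h⟩
  · rintro ⟨rfl, rfl, h⟩
    exact ⟨_, _, _, _, rfl, rfl, h⟩

theorem linkedTwo_iff : LinkedTwo O (p₁ :: (Y ++ [p₂])) (q₁ :: (Z ++ [q₂])) ↔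
    Y = Z ∧ p₁ ≠ q₁ ∧ p₂ ≠ q₂ ∧ ∃ hY : Y ≠ [],
      orient O [p₁.bar, q₁.bar, Y.head hY] = orient O [p₂, q₂, (Y.getLast hY).bar] := by
  constructor
  · rintro ⟨a₁, a₂, b₁, b₂, X, hX, hP, hQ, h1, h2, h⟩
    obtain ⟨rfl, rfl, rfl⟩ := cons_append_singleton_inj.1 hP
    obtain ⟨rfl, rfl, rfl⟩ := cons_append_singleton_inj.1 hQ
    exact ⟨rfl, h1, h2, hX, h⟩
  · rintro ⟨rfl, h1, h2, hX, h⟩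
    exact ⟨_, _, _, _, _, hX, rfl, rfl, h1, h2, h⟩

theorem linkedThree_iff : LinkedThree O (p₁ :: (Y ++ [p₂])) (q₁ :: (Z ++ [q₂])) ↔
    Z = Word.bar Y ∧ p₁ ≠ q₂.bar ∧ p₂ ≠ q₁.bar ∧ ∃ hY : Y ≠ [],
      orient O [q₂, p₁.bar, Y.head hY] = orient O [q₁.bar, p₂, (Y.getLast hY).bar] := by
  constructor
  · rintro ⟨a₁, a₂, b₁, b₂, X, hX, hP, hQ, h1, h2, h⟩
    obtain ⟨rfl, rfl, rfl⟩ := cons_append_singleton_inj.1 hP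
    obtain ⟨rfl, rfl, rfl⟩ := cons_append_singleton_inj.1 hQ
    exact ⟨rfl, h1, h2, hX, h⟩
  · rintro ⟨rfl, h1, h2, hX, h⟩
    exact ⟨_, _, _, _, _, hX, rfl, rfl, h1, h2, h⟩

/-- A freely reduced word is not its own inverse: its middle letter, or its two middle letters,
would be inverse to each other. -/
theorem ne_bar_of_freelyReduced (hY : FreelyReduced Y) (h0 : Y ≠ []) : Y ≠ Word.bar Y := by
  intro h
  have hl : 0 < Y.length := List.length_pos_iff.2 h0
  have key : ∀ t (ht : t < Y.length), Y[t] = (Y[Y.length - 1 - t]'(by omega)).bar := by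
    intro t ht
    have h1 : Y[t]? = (Word.bar Y)[t]? := by rw [← h]
    rw [Word.bar, List.getElem?_reverse (by simpa using ht), List.getElem?_map, List.length_map,
      List.getElem?_eq_getElem ht, List.getElem?_eq_getElem (by omega)] at h1
    simpa using h1
  rw [FreelyReduced, List.isChain_iff_getElem] at hY
  rcases Nat.even_or_odd' Y.length with ⟨c, hc | hc⟩
  · refine hY (c - 1) (by omega) ?_
    rw [key (c - 1) (by omega)]
    congr 2
    omega
  · have := key c (by omega)
    simp only [show Y.length - 1 - c = c by omega] at this
    exact Letter.bar_ne _ this.symm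

theorem LinkedOne.sign (h : LinkedOne O [p₁, p₂] [q₁, q₂]) :
    CyclicWords.sign O [p₁, p₂] [q₁, q₂] = orient O [p₁.bar, q₁.bar, p₂, q₂] := by
  simp [CyclicWords.sign, h]

theorem LinkedTwo.sign (hY : Y ≠ []) (h : LinkedTwo O (p₁ :: (Y ++ [p₂])) (q₁ :: (Y ++ [q₂]))) :
    CyclicWords.sign O (p₁ :: (Y ++ [p₂])) (q₁ :: (Y ++ [q₂])) =
      orient O [p₁.bar, q₁.bar, Y.head hY] := by
  have h1 : ¬ LinkedOne O (p₁ :: (Y ++ [p₂])) (q₁ :: (Y ++ [q₂])) := fun h' =>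
    hY (linkedOne_iff.1 h').1
  obtain ⟨y, Y, rfl⟩ := List.exists_cons_of_ne_nil hY
  simp only [List.cons_append] at h h1 ⊢
  simp [CyclicWords.sign, h, h1]

theorem LinkedThree.not_two (hY : FreelyReduced Y)
    (h : LinkedThree O (p₁ :: (Y ++ [p₂])) (q₁ :: (Z ++ [q₂]))) :
    ¬ LinkedTwo O (p₁ :: (Y ++ [p₂])) (q₁ :: (Z ++ [q₂])) := fun h' => by
  obtain ⟨h1, -, -, h0, -⟩ := linkedThree_iff.1 h
  exact ne_bar_of_freelyReduced hY h0 ((linkedTwo_iff.1 h').1.trans h1)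

theorem LinkedThree.sign (hY : Y ≠ []) (hr : FreelyReduced Y)
    (h : LinkedThree O (p₁ :: (Y ++ [p₂])) (q₁ :: (Z ++ [q₂]))) :
    CyclicWords.sign O (p₁ :: (Y ++ [p₂])) (q₁ :: (Z ++ [q₂])) =
      orient O [q₂, p₁.bar, Y.head hY] := by
  have h1 : ¬ LinkedOne O (p₁ :: (Y ++ [p₂])) (q₁ :: (Z ++ [q₂])) := fun h' =>
    hY (linkedOne_iff.1 h').1
  have h2 := h.not_two hr
  have hZ : Z ≠ [] := by
    rw [(linkedThree_iff.1 h).1]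
    simpa [Word.bar] using hY
  obtain ⟨y, Y, rfl⟩ := List.exists_cons_of_ne_nil hY
  obtain ⟨z, Z, rfl⟩ := List.exists_cons_of_ne_nil hZ
  simp only [List.cons_append] at h h1 h2 ⊢
  simp [CyclicWords.sign, h, h1, h2]

end LinkedWords

/-! ### Occurrences of linked pairs on the circle -/

section Occurrences

variable {n m : ℕ} {x : ZMod m → Letter n}

theorem run_inj {i j : ZMod m} {a b : ℕ} :
    run x i a = run x j b ↔ a = b ∧ ∀ t < a, x (i + t + 1) = x (j + t + 1) := by
  have e : ∀ (i : ZMod m) (t : ℕ), i + t + 1 = i + 1 + t := fun i t => add_right_comm _ _ _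
  constructor
  · intro h
    have hl := congrArg List.length h
    rw [length_run, length_run] at hl
    subst hl
    refine ⟨rfl, fun t ht => ?_⟩
    rw [e, e]
    exact List.map_inj_left.1 h t (List.mem_range.2 ht)
  · rintro ⟨rfl, h⟩
    refine List.map_congr_left fun t ht => ?_
    rw [← e, ← e]
    exact h t (List.mem_range.1 ht)

theorem getElem_bar_run (i : ZMod m) (k t : ℕ) (h : t < (Word.bar (run x i k)).length) :
    (Word.bar (run x i k))[t] = (x (i + k - t)).bar := by
  have hk : t < k := by simpa [Word.bar] using h
  simp only [Word.bar, run, List.getElem_reverse, List.getElem_map, List.getElem_range,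
    List.length_map, List.length_range]
  congr 2
  rw [show k - 1 - t = k - (t + 1) by omega, Nat.cast_sub (by omega)]
  push_cast
  ring

theorem run_eq_bar_run {i j : ZMod m} {a b : ℕ} :
    run x j b = Word.bar (run x i a) ↔
      a = b ∧ ∀ t < a, x (i + t + 1) = (x (j + b - t)).bar := by
  -- Reading the second word backwards exchanges `t` and `a - 1 - t`.
  have e : ∀ t < a, ((a - 1 - t : ℕ) : ZMod m) = a - 1 - t := fun t ht => by
    rw [show a - 1 - t = a - (t + 1) by omega, Nat.cast_sub (by omega)]
    push_cast
    ring
  constructor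
  · intro h
    have hl := congrArg List.length h
    simp only [Word.bar, List.length_reverse, List.length_map, length_run] at hl
    subst hl
    refine ⟨rfl, fun t ht => ?_⟩
    have h1 : (run x j b)[b - 1 - t]'(by simp; omega) = x (j + b - t) := by
      simp only [run, List.getElem_map, List.getElem_range, e t ht]
      congr 1
      ring
    rw [← h1]
    simp only [h, getElem_bar_run, e t ht, Letter.bar_bar]
    congr 1
    ring
  · rintro ⟨rfl, h⟩
    refine List.ext_getElem (by simp [Word.bar]) fun t h1 h2 => ?_
    rw [length_run] at h1
    have := h (a - 1 - t) (by omega)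
    rw [getElem_bar_run, show i + a - t = i + (a - 1 - t : ℕ) + 1 by rw [e t h1]; ring, this,
      Letter.bar_bar, e t h1]
    simp only [run, List.getElem_map, List.getElem_range]
    congr 1
    ring

theorem head_run (i : ZMod m) {k : ℕ} (h : run x i k ≠ []) : (run x i k).head h = x (i + 1) := by
  obtain ⟨l, rfl⟩ := Nat.exists_eq_succ_of_ne_zero (n := k) (by rintro rfl; exact h rfl)
  simp [run_succ']

theorem getLast_run (i : ZMod m) {k : ℕ} (h : run x i k ≠ []) :
    (run x i k).getLast h = x (i + k) := by
  obtain ⟨l, rfl⟩ := Nat.exists_eq_succ_of_ne_zero (n := k) (by rintro rfl; exact h rfl)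
  simp [run_succ, add_comm, add_left_comm]

theorem run_ne_nil {i : ZMod m} {k : ℕ} : run x i k ≠ [] ↔ 1 ≤ k := by
  rw [← List.length_pos_iff, length_run, Nat.succ_le_iff]

theorem freelyReduced_run (hred : ∀ i, x (i + 1) ≠ (x i).bar) (i : ZMod m) (k : ℕ) :
    FreelyReduced (run x i k) := by
  rw [FreelyReduced, List.isChain_iff_getElem]
  intro t ht h
  simp only [run, List.getElem_map, List.getElem_range] at h
  refine hred (i + 1 + t) ?_
  rw [h, Letter.bar_bar]
  push_cast
  rw [add_assoc (i + 1)]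

/-- The word of `k + 2` letters from the position `i` on, as `p Y q` with letters `p`, `q`. -/
def framedRun (x : ZMod m → Letter n) (i : ZMod m) (k : ℕ) : Word n :=
  x i :: (run x i k ++ [x (i + k + 1)])

theorem framedRun_eq_run (i : ZMod m) (k : ℕ) : framedRun x i k = run x (i - 1) (k + 2) := by
  rw [run_succ', run_succ, sub_add_cancel, framedRun, add_right_comm]

variable {O : Cycle (Letter n)}

theorem linkedOne_framedRun {i j : ZMod m} {a b : ℕ} :
    LinkedOne O (framedRun x i a) (framedRun x j b) ↔
      a = 0 ∧ b = 0 ∧ orient O [(x i).bar, (x j).bar, x (i + 1), x (j + 1)] ≠ 0 := by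
  rw [framedRun, framedRun, linkedOne_iff, ← List.length_eq_zero_iff, ← List.length_eq_zero_iff,
    length_run, length_run]
  refine and_congr_right fun ha => and_congr_right fun hb => ?_
  subst ha hb
  simp

theorem linkedTwo_framedRun {i j : ZMod m} {a b : ℕ} :
    LinkedTwo O (framedRun x i a) (framedRun x j b) ↔
      a = b ∧ IsMaxChain (shiftSame m) (TieSame x) (i, j) a ∧
        orient O [(x i).bar, (x j).bar, x (i + 1)] =
          orient O [x (i + a + 1), x (j + a + 1), (x (i + a)).bar] := by
  rw [framedRun, framedRun, linkedTwo_iff, run_inj, isMaxChain_same]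
  simp only [head_run, getLast_run, exists_prop, run_ne_nil]
  constructor
  · rintro ⟨⟨rfl, h⟩, h1, h2, h3, h4⟩
    exact ⟨rfl, ⟨h3, h, h2, h1⟩, h4⟩
  · rintro ⟨rfl, ⟨h3, h, h2, h1⟩, h4⟩
    exact ⟨⟨rfl, h⟩, h1, h2, h3, h4⟩

theorem linkedThree_framedRun {i j : ZMod m} {a b : ℕ} :
    LinkedThree O (framedRun x i a) (framedRun x j b) ↔
      a = b ∧ IsMaxChain (shiftOpposite m) (TieOpposite x) (i, j + a) a ∧
        orient O [x (j + a + 1), (x i).bar, x (i + 1)] =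
          orient O [(x j).bar, x (i + a + 1), (x (i + a)).bar] := by
  rw [framedRun, framedRun, linkedThree_iff, run_eq_bar_run, isMaxChain_opposite]
  simp only [head_run, getLast_run, exists_prop, run_ne_nil, add_sub_cancel_right]
  constructor
  · rintro ⟨⟨rfl, h⟩, h1, h2, h3, h4⟩
    exact ⟨rfl, ⟨h3, h, h2, h1⟩, h4⟩
  · rintro ⟨rfl, ⟨h3, h, h2, h1⟩, h4⟩
    exact ⟨⟨rfl, h⟩, h1, h2, h3, h4⟩

/-- The circle `x : ZMod m → Letter n` carries the cyclic word of `L`. -/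
structure IsCircle (L : Word n) (x : ZMod m → Letter n) : Prop where
  length_eq : L.length = m
  getElem?_eq : ∀ t : ℕ, L[t % m]? = some (x t)

variable {L : Word n}

theorem IsCircle.arc_eq (h : IsCircle L x) (a : ℕ) {k : ℕ} (hk : k ≤ m) :
    arc L a k = run x (a - 1) k := by
  have hl : k ≤ L.length := h.length_eq ▸ hk
  refine List.ext_getElem? fun j => ?_
  rcases lt_or_ge j k with hj | hj
  · rw [arc_getElem? L a k j hj hl, h.length_eq, h.getElem?_eq]
    simp [run, hj]
  · rw [List.getElem?_eq_none (by rwa [length_arc L a k hl]),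
      List.getElem?_eq_none (by rwa [length_run])]

theorem IsCircle.gap_eq [NeZero m] (h : IsCircle L x) (a b : ℕ) :
    gap L a b = ((b : ZMod m) - a).val := by
  have := ZMod.val_intCast (n := m) ((b : ℤ) - a)
  push_cast at this
  rw [gap, h.length_eq, ← this, Int.toNat_natCast]

theorem IsCircle.word_eq (h : IsCircle L x) {A : Occ} {k : ℕ} (hk : A.len = k + 2)
    (hm : A.len ≤ m) : A.word L = framedRun x A.start k := by
  rw [Occ.word, h.arc_eq _ hm, hk, framedRun_eq_run]

theorem IsCircle.reduced [NeZero m] (h : IsCircle L x)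
    (hL : IsReducedCyclic (L : Cycle (Letter n))) (i : ZMod m) : x (i + 1) ≠ (x i).bar := by
  have := ((isReducedCyclic_iff L).1 hL).2 i.val (x i) (x (i + 1))
  rw [h.length_eq, h.getElem?_eq, h.getElem?_eq] at this
  push_cast at this
  rw [ZMod.natCast_zmod_val] at this
  intro e
  exact this rfl rfl (by rw [e, Letter.bar_bar])

end Occurrences

section SignFramed

variable {n m : ℕ} {x : ZMod m → Letter n} {O : Cycle (Letter n)} {i j : ZMod m} {a b : ℕ}

theorem LinkedOne.sign_framedRun (h : LinkedOne O (framedRun x i 0) (framedRun x j 0)) :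
    CyclicWords.sign O (framedRun x i 0) (framedRun x j 0) =
      orient O [(x i).bar, (x j).bar, x (i + 1), x (j + 1)] := by
  have e : ∀ i : ZMod m, framedRun x i 0 = [x i, x (i + 1)] := fun i => by simp [framedRun]
  rw [e, e] at h ⊢
  exact h.sign

theorem LinkedTwo.sign_framedRun (h : LinkedTwo O (framedRun x i a) (framedRun x j b)) :
    CyclicWords.sign O (framedRun x i a) (framedRun x j b) =
      orient O [(x i).bar, (x j).bar, x (i + 1)] := by
  obtain ⟨rfl, hc, -⟩ := linkedTwo_framedRun.1 h
  have hr : run x i a = run x j a := run_inj.2 ⟨rfl, ((isMaxChain_same x).1 hc).2.1⟩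
  rw [framedRun, framedRun, ← hr] at h ⊢
  rw [LinkedTwo.sign (run_ne_nil.2 hc.1) h, head_run]

theorem LinkedThree.sign_framedRun (hred : ∀ i, x (i + 1) ≠ (x i).bar)
    (h : LinkedThree O (framedRun x i a) (framedRun x j b)) :
    CyclicWords.sign O (framedRun x i a) (framedRun x j b) =
      orient O [x (j + b + 1), (x i).bar, x (i + 1)] := by
  have hc := (linkedThree_framedRun.1 h).2.1
  rw [framedRun, framedRun] at h ⊢
  rw [LinkedThree.sign (run_ne_nil.2 hc.1) (freelyReduced_run hred _ _) h, head_run]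

end SignFramed

/-! ### Comparison with the sum over linked pairs -/

section Terms

variable {n m : ℕ} {R : Word n} {L : Word n} {x : ZMod m → Letter n}
  {O : Cycle (Letter n)} {𝕜 : Type*} [Field 𝕜] {A B : Occ} {k : ℕ}

theorem Occ.last_cast (hk : A.len = k + 2) : (A.last : ZMod m) = (A.start + k : ZMod m) + 1 := by
  rw [Occ.last, hk, show A.start + (k + 2) - 1 = A.start + k + 1 by omega]
  push_cast
  rfl

theorem IsCircle.exists_framedRun (h : IsCircle L x) (hA : A ∈ occs L)
    (h2 : 2 ≤ (A.word L).length) :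
    ∃ a, A.len = a + 2 ∧ A.len ≤ m ∧ A.start < m ∧ A.word L = framedRun x A.start a := by
  have h3 := Occ.two_le_len h2
  have h4 := (mem_occs L A).1 hA
  rw [h.length_eq] at h4
  obtain ⟨a, ha⟩ := Nat.exists_eq_add_of_le' h3
  exact ⟨a, ha, h4.2, h4.1, h.word_eq ha h4.2⟩

theorem IsCircle.exists_of_mem_LP₁ (h : IsCircle L x) {z : Occ × Occ} (hz : z ∈ LP₁ O L) :
    ∃ (i j : ZMod m) (a b : ℕ), a + 2 ≤ m ∧ b + 2 ≤ m ∧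
      z = (⟨i.val, a + 2⟩, ⟨j.val, b + 2⟩) := by
  obtain ⟨⟨s, l⟩, ⟨s', l'⟩⟩ := z
  obtain ⟨hA, hB, hl⟩ := (mem_LP₁ O L _).1 hz
  obtain ⟨a, ha, ham, hs, -⟩ := h.exists_framedRun hA hl.2.2.1
  obtain ⟨b, hb, hbm, hs', -⟩ := h.exists_framedRun hB hl.2.2.2.1
  dsimp only at *
  exact ⟨s, s', a, b, ha ▸ ham, hb ▸ hbm, by
    rw [ZMod.val_natCast_of_lt hs, ZMod.val_natCast_of_lt hs', ha, hb]⟩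

variable [NeZero m]

theorem IsCircle.arc_gap_eq_piece (h : IsCircle L x) {a b : ℕ} {u v : ZMod m}
    (ha : (a : ZMod m) = u + 1) (hb : (b : ZMod m) = v + 1) :
    arc L a (gap L a b) = piece x u v := by
  rw [h.gap_eq, h.arc_eq _ (ZMod.val_lt _).le, piece, ha, hb, add_sub_cancel_right,
    add_sub_add_right_eq_sub]

theorem IsCircle.arc_gap_succ_eq_piece (h : IsCircle L x) {a b : ℕ} {u v : ZMod m}
    (ha : (a : ZMod m) = u + 1) (hb : (b : ZMod m) = v) (huv : u ≠ v) :
    arc L a (gap L a b + 1) = piece x u v := by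
  have e : (v - (u + 1)).val + 1 = (v - u).val := by
    have h0 : (v - u).val ≠ 0 := by rw [Ne, ZMod.val_eq_zero, sub_eq_zero]; exact huv.symm
    have h1 := ZMod.val_lt (v - u)
    have : v - (u + 1) = (((v - u).val - 1 : ℕ) : ZMod m) := by
      rw [Nat.cast_sub (by omega), ZMod.natCast_zmod_val]
      push_cast
      ring
    rw [this, ZMod.val_natCast_of_lt (by omega)]
    omega
  rw [h.gap_eq, h.arc_eq _ (ZMod.val_lt _), piece, ha, hb, add_sub_cancel_right,
    Nat.succ_eq_add_one, e]

theorem IsCircle.cut_eq (h : IsCircle L x) (hA : A.len = k + 2) (hB : B.len = k + 2)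
    (h3 : ¬ LinkedThree O (A.word L) (B.word L)) :
    cut₁ O L A B = piece x (A.start + k) (B.start + k) ∧
      cut₂ O L A B = piece x (B.start + k) (A.start + k) := by
  rw [cut₁, cut₂, if_neg h3, if_neg h3]
  exact ⟨h.arc_gap_eq_piece (Occ.last_cast hA) (Occ.last_cast hB),
    h.arc_gap_eq_piece (Occ.last_cast hB) (Occ.last_cast hA)⟩

theorem IsCircle.cut_eq_of_three (h : IsCircle L x) (hA : A.len = k + 2) (hB : B.len = k + 2)
    (h3 : LinkedThree O (A.word L) (B.word L)) (h1 : (A.start + k : ZMod m) ≠ B.start)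
    (h2 : (B.start + k : ZMod m) ≠ A.start) :
    cut₁ O L A B = piece x (A.start + k) B.start ∧
      cut₂ O L A B = piece x (B.start + k) A.start := by
  rw [cut₁, cut₂, if_pos h3, if_pos h3]
  exact ⟨h.arc_gap_succ_eq_piece (Occ.last_cast hA) rfl h1,
    h.arc_gap_succ_eq_piece (Occ.last_cast hB) rfl h2⟩

theorem letterAlphabet_cl (pos : Letter n → ℕ) (W : Word n) :
    (letterAlphabet pos).cl 𝕜 W = cls 𝕜 W := by
  change cls 𝕜 (W.map id) = _
  rw [List.map_id]

theorem cobracketTerm_eq (hO : IsSurfaceSymbol O) (hL : IsReducedCyclic (L : Cycle (Letter n)))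
    (pos : Letter n → ℕ) (h : (A, B) ∈ LP₁ O L) :
    cobracketTerm 𝕜 O L A B = sign O (A.word L) (B.word L) •
      ((letterAlphabet pos).cl 𝕜 (cut₁ O L A B) ⊗ₜ[𝕜]
        (letterAlphabet pos).cl 𝕜 (cut₂ O L A B)) := by
  obtain ⟨h1, h2⟩ := isReducedCyclic_cut hO L hL A B h
  rw [cobracketTerm, letterAlphabet_cl, letterAlphabet_cl, cls_of_isReducedCyclic h1,
    cls_of_isReducedCyclic h2]

theorem IsCircle.term_one (h : IsCircle L x) (hO : IsSurfaceSymbol O)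
    (hL : IsReducedCyclic (L : Cycle (Letter n))) (pos : Letter n → ℕ) (hAB : (A, B) ∈ LP₁ O L)
    (h1 : LinkedOne O (A.word L) (B.word L)) :
    cobracketTerm 𝕜 O L A B =
      orient O [(x A.start).bar, (x B.start).bar, x (A.start + 1), x (B.start + 1)] •
        pieces x (letterAlphabet pos) 𝕜 A.start B.start := by
  obtain ⟨hA, hB, hl⟩ := (mem_LP₁ O L _).1 hAB
  obtain ⟨a, ha, ham, -, hwa⟩ := h.exists_framedRun hA hl.2.2.1
  obtain ⟨b, hb, hbm, -, hwb⟩ := h.exists_framedRun hB hl.2.2.2.1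
  dsimp only at *
  rw [cobracketTerm_eq hO hL pos hAB]
  rw [hwa, hwb] at h1
  obtain ⟨rfl, rfl, h0⟩ := linkedOne_framedRun.1 h1
  have h3 : ¬ LinkedThree O (A.word L) (B.word L) := by
    rw [hwa, hwb]
    intro h3
    have := (linkedThree_framedRun.1 h3).2.1.1
    omega
  obtain ⟨c1, c2⟩ := h.cut_eq ha hb h3
  rw [c1, c2, hwa, hwb, h1.sign_framedRun]
  simp [pieces]

theorem IsCircle.term_two (h : IsCircle L x) (hO : IsSurfaceSymbol O)
    (hL : IsReducedCyclic (L : Cycle (Letter n))) (pos : Letter n → ℕ) (hAB : (A, B) ∈ LP₁ O L)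
    (h2 : LinkedTwo O (A.word L) (B.word L)) :
    cobracketTerm 𝕜 O L A B =
      orient O [(x A.start).bar, (x B.start).bar, x (A.start + 1)] •
        pieces x (letterAlphabet pos) 𝕜 A.start B.start := by
  obtain ⟨hA, hB, hl⟩ := (mem_LP₁ O L _).1 hAB
  obtain ⟨a, ha, ham, -, hwa⟩ := h.exists_framedRun hA hl.2.2.1
  obtain ⟨b, hb, hbm, -, hwb⟩ := h.exists_framedRun hB hl.2.2.2.1
  dsimp only at *
  rw [cobracketTerm_eq hO hL pos hAB]
  have hred := h.reduced hL
  have h3 : ¬ LinkedThree O (A.word L) (B.word L) := by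
    rw [hwa, hwb] at h2 ⊢
    exact fun h3 => h3.not_two (freelyReduced_run hred _ _) h2
  rw [hwa, hwb] at h2
  obtain ⟨rfl, hc, -⟩ := linkedTwo_framedRun.1 h2
  have hc' := (isMaxChain_same x).1 hc
  obtain ⟨c1, c2⟩ := h.cut_eq ha hb h3
  rw [c1, c2, hwa, hwb, h2.sign_framedRun]
  have := apply_shiftSame_pow (F := pieces x (letterAlphabet pos) 𝕜)
    (fun i j h => pieces_add_one x (letterAlphabet pos) h) hc'.2.1
  rw [← this]
  rfl

theorem IsCircle.term_three (h : IsCircle L x) (hO : IsSurfaceSymbol O)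
    (hL : IsReducedCyclic (L : Cycle (Letter n))) (pos : Letter n → ℕ) (hAB : (A, B) ∈ LP₁ O L)
    (h3 : LinkedThree O (A.word L) (B.word L)) (hk : A.len = k + 2) :
    cobracketTerm 𝕜 O L A B =
      orient O [x (B.start + k + 1), (x A.start).bar, x (A.start + 1)] •
        pieces x (letterAlphabet pos) 𝕜 A.start (B.start + k) := by
  obtain ⟨hA, hB, hl⟩ := (mem_LP₁ O L _).1 hAB
  obtain ⟨a, ha, ham, -, hwa⟩ := h.exists_framedRun hA hl.2.2.1
  obtain ⟨b, hb, hbm, -, hwb⟩ := h.exists_framedRun hB hl.2.2.2.1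
  dsimp only at *
  obtain rfl : a = k := by omega
  rw [cobracketTerm_eq hO hL pos hAB]
  have hred := h.reduced hL
  have h3' := h3
  rw [hwa, hwb] at h3
  obtain ⟨rfl, hc, -⟩ := linkedThree_framedRun.1 h3
  have hc' := (isMaxChain_opposite x).1 hc
  have hd1 : (A.start + a : ZMod m) ≠ B.start := by
    obtain ⟨l, rfl⟩ := Nat.exists_eq_add_of_le' hc.1
    intro e
    have := hc'.2.1 l (by omega)
    push_cast at this e
    rw [add_assoc, e, show (B.start + (l + 1) - l : ZMod m) = B.start + 1 by ring] at this
    refine hred B.start ?_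
    rw [this, Letter.bar_bar]
  have hd2 : (B.start + a : ZMod m) ≠ A.start := by
    have := hc'.2.1 0 (by have := hc.1; omega)
    intro e
    rw [e, Nat.cast_zero, add_zero, sub_zero] at this
    exact hred _ this
  obtain ⟨c1, c2⟩ := h.cut_eq_of_three ha hb h3' hd1 hd2
  rw [c1, c2, hwa, hwb, h3.sign_framedRun hred]
  have := apply_shiftOpposite_pow (F := fun i j => (letterAlphabet pos).cl 𝕜 (piece x i j))
    (fun i j h => cl_piece_strip x (letterAlphabet pos) (tieOpposite_ne hred (p := (i, j)) h) h)
    hc'.2.1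
  dsimp only at this
  rw [add_sub_cancel_right] at this
  rw [this]
  rfl

theorem IsCircle.word_mk (h : IsCircle L x) (i : ZMod m) {a : ℕ} (ha : a + 2 ≤ m) :
    (⟨i.val, a + 2⟩ : Occ).word L = framedRun x i a := by
  rw [h.word_eq rfl ha, ZMod.natCast_zmod_val]

theorem IsCircle.mem_LP₁_mk (h : IsCircle L x) (hred : ∀ i, x (i + 1) ≠ (x i).bar)
    {i j : ZMod m} {a b : ℕ} (ha : a + 2 ≤ m) (hb : b + 2 ≤ m) :
    ((⟨i.val, a + 2⟩, ⟨j.val, b + 2⟩) : Occ × Occ) ∈ LP₁ O L ↔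
      LinkedOne O (framedRun x i a) (framedRun x j b) ∨
        LinkedTwo O (framedRun x i a) (framedRun x j b) ∨
        LinkedThree O (framedRun x i a) (framedRun x j b) := by
  have hf : ∀ (i : ZMod m) (a : ℕ), FreelyReduced (framedRun x i a) := fun i a => by
    rw [framedRun_eq_run]
    exact freelyReduced_run hred _ _
  have hl : ∀ (i : ZMod m) (a : ℕ), 2 ≤ (framedRun x i a).length := fun i a => by
    rw [framedRun_eq_run, length_run]
    omega
  rw [mem_LP₁, mem_occs, mem_occs, h.length_eq, h.word_mk i ha, h.word_mk j hb, Linked]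
  simp only [ZMod.val_lt, ha, hb, hf, hl, true_and]

open Classical in
/-- The three types of linked pairs exclude each other. -/
theorem IsCircle.cobracketSum_split (h : IsCircle L x) (hred : ∀ i, x (i + 1) ≠ (x i).bar) :
    cobracketSum 𝕜 O L =
      ∑ z ∈ LP₁ O L with LinkedOne O (z.1.word L) (z.2.word L), cobracketTerm 𝕜 O L z.1 z.2 +
      ∑ z ∈ LP₁ O L with LinkedTwo O (z.1.word L) (z.2.word L), cobracketTerm 𝕜 O L z.1 z.2 +
      ∑ z ∈ LP₁ O L with LinkedThree O (z.1.word L) (z.2.word L), cobracketTerm 𝕜 O L z.1 z.2 := by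
  rw [cobracketSum, Finset.sum_filter, Finset.sum_filter, Finset.sum_filter,
    ← Finset.sum_add_distrib, ← Finset.sum_add_distrib]
  refine Finset.sum_congr rfl fun z hz => ?_
  obtain ⟨i, j, a, b, ha, hb, rfl⟩ := h.exists_of_mem_LP₁ hz
  have hl := (h.mem_LP₁_mk hred ha hb).1 hz
  have h12 : LinkedOne O (framedRun x i a) (framedRun x j b) →
      ¬ LinkedTwo O (framedRun x i a) (framedRun x j b) := fun h1 h2 => by
    have h1 := (linkedOne_framedRun.1 h1).1
    have h2 := (linkedTwo_framedRun.1 h2).2.1.1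
    omega
  have h13 : LinkedOne O (framedRun x i a) (framedRun x j b) →
      ¬ LinkedThree O (framedRun x i a) (framedRun x j b) := fun h1 h2 => by
    have h1 := (linkedOne_framedRun.1 h1).1
    have h2 := (linkedThree_framedRun.1 h2).2.1.1
    omega
  have h23 : LinkedThree O (framedRun x i a) (framedRun x j b) →
      ¬ LinkedTwo O (framedRun x i a) (framedRun x j b) := fun h3 =>
    h3.not_two (freelyReduced_run hred _ _)
  rw [h.word_mk i ha, h.word_mk j hb]
  rcases hl with h1 | h2 | h3
  · rw [if_pos h1, if_neg (h12 h1), if_neg (h13 h1), add_zero, add_zero]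
  · rw [if_pos h2, if_neg fun h1 => h12 h1 h2, if_neg fun h3 => h23 h3 h2, add_zero, zero_add]
  · rw [if_pos h3, if_neg fun h1 => h13 h1 h3, if_neg (h23 h3), add_zero, zero_add]

end Terms

section Sums

variable {n m : ℕ} [NeZero m] {L : Word n} {x : ZMod m → Letter n} {O : Cycle (Letter n)}
  {𝕜 : Type*} [Field 𝕜]

open Classical in
theorem IsCircle.sum_linkedOne (h : IsCircle L x) (hO : IsSurfaceSymbol O)
    (hL : IsReducedCyclic (L : Cycle (Letter n))) (pos : Letter n → ℕ) :
    ∑ z ∈ LP₁ O L with LinkedOne O (z.1.word L) (z.2.word L), cobracketTerm 𝕜 O L z.1 z.2 =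
      ∑ p : ZMod m × ZMod m, orient O [(x p.1).bar, (x p.2).bar, x (p.1 + 1), x (p.2 + 1)] •
        pieces x (letterAlphabet pos) 𝕜 p.1 p.2 := by
  have hred := h.reduced hL
  rw [← Finset.sum_filter_of_ne (s := Finset.univ)
    (p := fun p : ZMod m × ZMod m =>
      orient O [(x p.1).bar, (x p.2).bar, x (p.1 + 1), x (p.2 + 1)] ≠ 0)
    (fun p _ hp h0 => hp (by rw [h0, zero_smul]))]
  refine Finset.sum_nbij' (fun z => ((z.1.start : ZMod m), (z.2.start : ZMod m)))
    (fun p => (⟨p.1.val, 2⟩, ⟨p.2.val, 2⟩)) ?_ ?_ ?_ ?_ ?_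
  · intro z hz
    rw [Finset.mem_filter] at hz
    obtain ⟨hz, h1⟩ := hz
    obtain ⟨i, j, a, b, ha, hb, rfl⟩ := h.exists_of_mem_LP₁ hz
    dsimp only at h1
    rw [h.word_mk i ha, h.word_mk j hb, linkedOne_framedRun] at h1
    simpa using h1.2.2
  · rintro ⟨i, j⟩ hp
    replace hp := (Finset.mem_filter.1 hp).2
    have hm : 0 + 2 ≤ m := by
      have hn := nodup_of_orient_ne_zero hO hp
      by_contra hm
      have : m = 1 := by have := NeZero.ne m; omega
      subst this
      rw [Subsingleton.elim j i] at hn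
      simp at hn
    have h1 : LinkedOne O (framedRun x i 0) (framedRun x j 0) :=
      linkedOne_framedRun.2 ⟨rfl, rfl, hp⟩
    rw [Finset.mem_filter]
    refine ⟨(h.mem_LP₁_mk hred hm hm).2 (Or.inl h1), ?_⟩
    have := h.word_mk i hm
    rw [Nat.zero_add] at this
    have h' := h.word_mk j hm
    rw [Nat.zero_add] at h'
    rwa [this, h']
  · intro z hz
    rw [Finset.mem_filter] at hz
    obtain ⟨hz, h1⟩ := hz
    obtain ⟨i, j, a, b, ha, hb, rfl⟩ := h.exists_of_mem_LP₁ hz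
    dsimp only at h1
    rw [h.word_mk i ha, h.word_mk j hb, linkedOne_framedRun] at h1
    obtain ⟨rfl, rfl, -⟩ := h1
    simp
  · intro p _
    simp
  · intro z hz
    rw [Finset.mem_filter] at hz
    exact h.term_one hO hL pos hz.1 hz.2

open Classical in
theorem IsCircle.sum_linkedTwo (h : IsCircle L x) (hO : IsSurfaceSymbol O)
    (hL : IsReducedCyclic (L : Cycle (Letter n))) (pos : Letter n → ℕ) :
    ∑ z ∈ LP₁ O L with LinkedTwo O (z.1.word L) (z.2.word L), cobracketTerm 𝕜 O L z.1 z.2 =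
      ∑ p : ZMod m × ZMod m, ∑ k ∈ Finset.range (m - 1),
        if IsMaxChain (shiftSame m) (TieSame x) p k ∧
            orient O [(x p.1).bar, (x p.2).bar, x (p.1 + 1)] =
            orient O [x (p.1 + k + 1), x (p.2 + k + 1), (x (p.1 + k)).bar]
          then orient O [(x p.1).bar, (x p.2).bar, x (p.1 + 1)] •
            pieces x (letterAlphabet pos) 𝕜 p.1 p.2
          else 0 := by
  have hred := h.reduced hL
  refine Eq.trans ?_ (Finset.sum_product' Finset.univ (Finset.range (m - 1)) _)
  rw [← Finset.sum_filter]
  refine Finset.sum_nbij'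
    (fun z => (((z.1.start : ZMod m), (z.2.start : ZMod m)), z.1.len - 2))
    (fun q => (⟨q.1.1.val, q.2 + 2⟩, ⟨q.1.2.val, q.2 + 2⟩)) ?_ ?_ ?_ ?_ ?_
  · intro z hz
    rw [Finset.mem_filter] at hz
    obtain ⟨hz, h1⟩ := hz
    obtain ⟨i, j, a, b, ha, hb, rfl⟩ := h.exists_of_mem_LP₁ hz
    dsimp only at h1
    rw [h.word_mk i ha, h.word_mk j hb, linkedTwo_framedRun] at h1
    simp only [Finset.mem_filter, Finset.mem_product, Finset.mem_univ, true_and, Finset.mem_range,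
      ZMod.natCast_zmod_val, Nat.add_sub_cancel]
    exact ⟨by omega, h1.2⟩
  · rintro ⟨⟨i, j⟩, k⟩ hp
    simp only [Finset.mem_filter, Finset.mem_product, Finset.mem_univ, true_and,
      Finset.mem_range] at hp
    have hm : k + 2 ≤ m := by omega
    have h1 : LinkedTwo O (framedRun x i k) (framedRun x j k) :=
      linkedTwo_framedRun.2 ⟨rfl, hp.2⟩
    rw [Finset.mem_filter]
    refine ⟨(h.mem_LP₁_mk hred hm hm).2 (Or.inr (Or.inl h1)), ?_⟩
    dsimp only
    rwa [h.word_mk i hm, h.word_mk j hm]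
  · intro z hz
    rw [Finset.mem_filter] at hz
    obtain ⟨hz, h1⟩ := hz
    obtain ⟨i, j, a, b, ha, hb, rfl⟩ := h.exists_of_mem_LP₁ hz
    dsimp only at h1
    rw [h.word_mk i ha, h.word_mk j hb, linkedTwo_framedRun] at h1
    obtain ⟨rfl, -⟩ := h1
    simp
  · intro p _
    simp
  · intro z hz
    rw [Finset.mem_filter] at hz
    exact h.term_two hO hL pos hz.1 hz.2

open Classical in
theorem IsCircle.sum_linkedThree (h : IsCircle L x) (hO : IsSurfaceSymbol O)
    (hL : IsReducedCyclic (L : Cycle (Letter n))) (pos : Letter n → ℕ) :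
    ∑ z ∈ LP₁ O L with LinkedThree O (z.1.word L) (z.2.word L), cobracketTerm 𝕜 O L z.1 z.2 =
      ∑ p : ZMod m × ZMod m, ∑ k ∈ Finset.range (m - 1),
        if IsMaxChain (shiftOpposite m) (TieOpposite x) p k ∧
            orient O [x (p.2 + 1), (x p.1).bar, x (p.1 + 1)] =
            orient O [(x (p.2 - k)).bar, x (p.1 + k + 1), (x (p.1 + k)).bar]
          then orient O [x (p.2 + 1), (x p.1).bar, x (p.1 + 1)] •
            pieces x (letterAlphabet pos) 𝕜 p.1 p.2
          else 0 := by
  have hred := h.reduced hL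
  refine Eq.trans ?_ (Finset.sum_product' Finset.univ (Finset.range (m - 1)) _)
  rw [← Finset.sum_filter]
  refine Finset.sum_nbij'
    (fun z => (((z.1.start : ZMod m), (z.2.start : ZMod m) + (z.1.len - 2 : ℕ)), z.1.len - 2))
    (fun q => (⟨q.1.1.val, q.2 + 2⟩, ⟨(q.1.2 - q.2).val, q.2 + 2⟩)) ?_ ?_ ?_ ?_ ?_
  · intro z hz
    rw [Finset.mem_filter] at hz
    obtain ⟨hz, h1⟩ := hz
    obtain ⟨i, j, a, b, ha, hb, rfl⟩ := h.exists_of_mem_LP₁ hz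
    dsimp only at h1
    rw [h.word_mk i ha, h.word_mk j hb, linkedThree_framedRun] at h1
    simp only [Finset.mem_filter, Finset.mem_product, Finset.mem_univ, true_and, Finset.mem_range,
      ZMod.natCast_zmod_val, Nat.add_sub_cancel, add_sub_cancel_right]
    exact ⟨by omega, h1.2⟩
  · rintro ⟨⟨i, j⟩, k⟩ hp
    simp only [Finset.mem_filter, Finset.mem_product, Finset.mem_univ, true_and,
      Finset.mem_range] at hp
    have hm : k + 2 ≤ m := by omega
    have h1 : LinkedThree O (framedRun x i k) (framedRun x (j - k) k) := by
      rw [linkedThree_framedRun, sub_add_cancel]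
      exact ⟨rfl, hp.2⟩
    rw [Finset.mem_filter]
    refine ⟨(h.mem_LP₁_mk hred hm hm).2 (Or.inr (Or.inr h1)), ?_⟩
    dsimp only
    rwa [h.word_mk i hm, h.word_mk (j - k) hm]
  · intro z hz
    rw [Finset.mem_filter] at hz
    obtain ⟨hz, h1⟩ := hz
    obtain ⟨i, j, a, b, ha, hb, rfl⟩ := h.exists_of_mem_LP₁ hz
    dsimp only at h1
    rw [h.word_mk i ha, h.word_mk j hb, linkedThree_framedRun] at h1
    obtain ⟨rfl, -⟩ := h1
    simp
  · intro p _
    simp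
  · intro z hz
    rw [Finset.mem_filter] at hz
    obtain ⟨hz, h3⟩ := hz
    obtain ⟨i, j, a, b, ha, hb, rfl⟩ := h.exists_of_mem_LP₁ hz
    exact h.term_three hO hL pos hz h3 rfl

/-- On reduced cyclic words the cobracket is given by the sum over pairs of cuts. -/
theorem cobracketSum_eq_cutSum {R : Word n} (hR : R.Nodup) (hmem : ∀ a, a ∈ R)
    (hL : IsReducedCyclic (L : Cycle (Letter n))) :
    cobracketSum 𝕜 (R : Cycle (Letter n)) L =
      (letterAlphabet fun a => R.idxOf a).cutSum 𝕜 L := by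
  have hO : IsSurfaceSymbol (R : Cycle (Letter n)) := ⟨Cycle.nodup_coe_iff.2 hR, hmem⟩
  have hne : L ≠ [] := ((isReducedCyclic_iff L).1 hL).1
  obtain ⟨m, hm⟩ : ∃ m, L.length = m := ⟨_, rfl⟩
  have : NeZero m := ⟨fun h0 => hne (List.length_eq_zero_iff.1 (hm.trans h0))⟩
  obtain ⟨x, hx⟩ := exists_circle L hm
  have h : IsCircle L x := ⟨hm, hx⟩
  rw [h.cobracketSum_split (h.reduced hL), h.sum_linkedOne hO hL fun a => R.idxOf a,
    h.sum_linkedTwo hO hL fun a => R.idxOf a, h.sum_linkedThree hO hL fun a => R.idxOf a,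
    ← sum_cutCrossing_eq hR hmem (h.reduced hL) (pieces x (letterAlphabet fun a => R.idxOf a) 𝕜)
      (fun i j h => pieces_add_one x (letterAlphabet fun a => R.idxOf a) h)
      (fun i j h => pieces_strip x (letterAlphabet fun a => R.idxOf a) h),
    ← Alphabet.cutSum_eq_sum_zmod, ← eq_seg_of_getElem? hm hx]

end Sums

end CyclicWords

theorem theoremt1 (𝕜 : Type*) [Field 𝕜] (n : ℕ) (O : Cycle (CyclicWords.Letter n))
    (hO : CyclicWords.IsSurfaceSymbol O) :
    CyclicWords.IsLieCoalgebra 𝕜 (CyclicWords.cobracket 𝕜 O) := by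
  obtain ⟨R, rfl⟩ : ∃ R : CyclicWords.Word n, O = (R : Cycle (CyclicWords.Letter n)) :=
    ⟨_, (Quotient.exists_rep O).choose_spec.symm⟩
  have hR : R.Nodup := Cycle.nodup_coe_iff.1 hO.1
  exact CyclicWords.isLieCoalgebra_of_eq_cutSum (CyclicWords.idxOf_injective hO.2)
    fun L hL => CyclicWords.cobracketSum_eq_cutSum hR hO.2 hL
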